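/- Let $n\in\mathbb N$, $\mathbb R^+=[0,\infty)$, $\mathbb R^-=(-\infty,0]$, and let $I$ be one of $\mathbb R,\mathbb R^+,\mathbb R^-$. Let $P,Q,R$ be $C^1$ paths of real $n\times n$ matrices on $I$ with $P(t),R(t)$ symmetric, such that for some constants $C_1>0$, $C_2$, $C_3$ and all $t\in I$, $v\in\mathbb R^n$ $$|P(t)v|\ge C_1|v|,\qquad |Q(t)v|\le C_2|v|,\qquad |R(t)v|\le C_3|v|,$$ and such that the limits $P_\pm,Q_\pm,R_\pm$ of $P,Q,R$ at each infinite end $\pm\infty$ of $I$ exist. Assume that the expression $$\mathcal A=-\frac{d}{dt}\Big[P(t)\frac{d}{dt}+Q(t)\Big]+Q(t)^{T}\frac{d}{dt}+R(t)$$ maps $W^{2,2}(I,\mathbb R^n)$ into $L^2(I,\mathbb R^n)$ (for instance, $\dot P$ and $\dot Q$ are bounded). Put $$J=\begin{bmatrix}0&-\mathrm{Id}\\ \mathrm{Id}&0\end{bmatrix},\qquad B(t)=\begin{bmatrix}P^{-1}&-P^{-1}Q\\ -Q^{T}P^{-1}&Q^{T}P^{-1}Q-R\end{bmatrix}(t),\qquad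 \mathcal F=-J\frac{d}{dt}-B(t),$$ and let $B(\pm\infty)=\lim_{t\to\pm\infty}B(t)$, that is, the matrix $B$ formed with $P_\pm,Q_\pm,R_\pm$. A real matrix is called hyperbolic if it has no eigenvalue on the imaginary axis. An unbounded operator is called Fredholm if it is closed, has finite-dimensional kernel, and has closed range of finite codimension. (i) Let $I=\mathbb R$, let $\mathscr A$ be the operator $\mathcal A$ in $L^2(\mathbb R,\mathbb R^n)$ with domain $W^{2,2}(\mathbb R,\mathbb R^n)$, and let $\mathscr F$ be the operator $\mathcal F$ in $L^2(\mathbb R,\mathbb R^{2n})$ with domain $W^{1,2}(\mathbb R,\mathbb R^{2n})$. Then $$\mathscr A\text{ is Fredholm}\iff\mathscr F\text{ is Fredholm}\iff JB(-\infty)\text{ and }JB(+\infty)\text{ are both hyperbolic}.$$ (ii) Let $I=\mathbb R^\pm$ and let $L_0$ be a Lagrangian subspace of $\mathbb R^{2n}$ with the symplectic form $\omega(u,v)=\langle Ju,v\rangle$. Let $\mathscr A^\pm$ be the operator $\mathcal A$ in $L^2(\mathbb R^\pm,\mathbb R^n)$ with domain $\{w\in W^{2,2}(\mathbb R^\pm,\mathbb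 R^n): (P(0)\dot w(0)+Q(0)w(0),\,w(0))\in L_0\}$, and let $\mathscr F^\pm$ be the operator $\mathcal F$ in $L^2(\mathbb R^\pm,\mathbb R^{2n})$ with domain $\{z\in W^{1,2}(\mathbb R^\pm,\mathbb R^{2n}): z(0)\in L_0\}$. Then, for each choice of the sign, $$\mathscr A^\pm\text{ is Fredholm}\iff\mathscr F^\pm\text{ is Fredholm}\iff JB(\pm\infty)\text{ is hyperbolic}.$$ -/

import Mathlib

open MeasureTheory Filter Topology
open scoped Matrix

noncomputable section

namespace SturmLiouville

/-- The real Hilbert space `L²(I; ℝ^ι)`, where `ℝ^ι` carries its Euclidean norm. -/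
abbrev L2 (I : Set ℝ) (ι : Type) [Fintype ι] : Type :=
  Lp (EuclideanSpace ℝ ι) 2 (volume.restrict I)

/-- `u` is the (locally absolutely) continuous representative on the interval `I` of an element
of `W^{1,2}(I; ℝ^ι)`, and `v` is its derivative: both are square integrable on `I`, and `u` is a
primitive of `v` on `I`. Being the continuous representative, `u` has values at single points. -/
def IsW12 {ι : Type} [Fintype ι] (I : Set ℝ) (u v : ℝ → EuclideanSpace ℝ ι) : Prop :=
  MemLp u 2 (volume.restrict I) ∧ MemLp v 2 (volume.restrict I) ∧
    ∀ a ∈ I, ∀ b ∈ I, u b - u a = ∫ s in a..b, v s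

/-- `u` and `u₁` are the continuous representatives on `I` of an element of `W^{2,2}(I; ℝ^ι)` and
of its first derivative, and `u₂` is its second derivative. -/
def IsW22 {ι : Type} [Fintype ι] (I : Set ℝ) (u u₁ u₂ : ℝ → EuclideanSpace ℝ ι) : Prop :=
  IsW12 I u u₁ ∧ IsW12 I u₁ u₂

/-- The action of a matrix on Euclidean space. -/
abbrev act {ι κ : Type} [Fintype ι] [DecidableEq ι] (M : Matrix κ ι ℝ) :
    EuclideanSpace ℝ ι →ₗ[ℝ] EuclideanSpace ℝ κ :=
  Matrix.toLpLin 2 2 M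

/-- The vector `(p, q)` of `ℝ^{2n}` with components `p, q` in `ℝⁿ`. -/
def pair {n : ℕ} (p q : EuclideanSpace ℝ (Fin n)) : EuclideanSpace ℝ (Fin n ⊕ Fin n) :=
  WithLp.toLp 2 (Sum.elim p.ofLp q.ofLp)

lemma pair_add {n : ℕ} (p q p' q' : EuclideanSpace ℝ (Fin n)) :
    pair (p + p') (q + q') = pair p q + pair p' q' := by
  ext i; rcases i with i | i <;> simp [pair]

lemma pair_smul {n : ℕ} (c : ℝ) (p q : EuclideanSpace ℝ (Fin n)) :
    pair (c • p) (c • q) = c • pair p q := by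
  ext i; rcases i with i | i <;> simp [pair]

lemma pair_zero {n : ℕ} : pair (0 : EuclideanSpace ℝ (Fin n)) 0 = 0 := by
  ext i; rcases i with i | i <;> simp [pair]

/-- `L₀` is a Lagrangian subspace of `(ℝ^{2n}, ω)`, `ω(u, v) = ⟨J u, v⟩`: it is `n`-dimensional
and `ω` vanishes on it. -/
def IsLagrangian {n : ℕ} (L₀ : Submodule ℝ (EuclideanSpace ℝ (Fin n ⊕ Fin n))) : Prop :=
  Module.finrank ℝ L₀ = n ∧
    ∀ u ∈ L₀, ∀ v ∈ L₀, inner ℝ (act (Matrix.J (Fin n) ℝ) u) v = 0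

/-- The symmetric matrix `B` with blocks `P⁻¹, -P⁻¹Q; -QᵀP⁻¹, QᵀP⁻¹Q - R`. -/
def hamMatrix {n : ℕ} (P Q R : Matrix (Fin n) (Fin n) ℝ) :
    Matrix (Fin n ⊕ Fin n) (Fin n ⊕ Fin n) ℝ :=
  Matrix.fromBlocks P⁻¹ (-(P⁻¹ * Q)) (-(Qᵀ * P⁻¹)) (Qᵀ * P⁻¹ * Q - R)

/-- A real square matrix is hyperbolic if it has no (complex) eigenvalue on the imaginary axis. -/
def IsHyperbolic {ι : Type} [Fintype ι] [DecidableEq ι] (M : Matrix ι ι ℝ) : Prop :=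
  ∀ μ ∈ spectrum ℂ (M.map (algebraMap ℝ ℂ)), μ.re ≠ 0

/-- A (possibly unbounded) operator is Fredholm if it is closed, its kernel is
finite dimensional, and its range is closed and of finite codimension. -/
def IsFredholm {X Y : Type*} [NormedAddCommGroup X] [NormedSpace ℝ X]
    [NormedAddCommGroup Y] [NormedSpace ℝ Y] (T : X →ₗ.[ℝ] Y) : Prop :=
  T.IsClosed ∧ FiniteDimensional ℝ (LinearMap.ker T.toFun) ∧
    IsClosed (LinearMap.range T.toFun : Set Y) ∧
    FiniteDimensional ℝ (Y ⧸ LinearMap.range T.toFun)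

section Sobolev

variable {ι : Type} [Fintype ι] {I : Set ℝ}

lemma IsW12.add {u v u' v' : ℝ → EuclideanSpace ℝ ι} [hI : I.OrdConnected]
    (h : IsW12 I u v) (h' : IsW12 I u' v') : IsW12 I (u + u') (v + v') := by
  refine ⟨h.1.add h'.1, h.2.1.add h'.2.1, fun a ha b hb => ?_⟩
  have key : ∀ w : ℝ → EuclideanSpace ℝ ι, MemLp w 2 (volume.restrict I) →
      IntervalIntegrable w volume a b := by
    intro w hw
    rw [intervalIntegrable_iff']
    have h1 : MemLp w 2 (volume.restrict (Set.uIcc a b)) :=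
      hw.mono_measure (Measure.restrict_mono (hI.uIcc_subset ha hb) le_rfl)
    have hfin : IsFiniteMeasure (volume.restrict (Set.uIcc a b)) :=
      isFiniteMeasure_restrict.2 isCompact_uIcc.measure_lt_top.ne
    exact h1.integrable (by norm_num)
  have e : ∫ s in a..b, (v + v') s = (∫ s in a..b, v s) + ∫ s in a..b, v' s :=
    intervalIntegral.integral_add (key v h.2.1) (key v' h'.2.1)
  rw [e, ← h.2.2 a ha b hb, ← h'.2.2 a ha b hb]
  simp only [Pi.add_apply]
  abel

lemma IsW12.smul {u v : ℝ → EuclideanSpace ℝ ι} (c : ℝ)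
    (h : IsW12 I u v) : IsW12 I (c • u) (c • v) := by
  refine ⟨h.1.const_smul c, h.2.1.const_smul c, fun a ha b hb => ?_⟩
  have e : ∫ s in a..b, (c • v) s = c • ∫ s in a..b, v s :=
    intervalIntegral.integral_smul c v
  rw [e, ← h.2.2 a ha b hb]
  simp only [Pi.smul_apply, smul_sub]

lemma IsW12.zero : IsW12 I (0 : ℝ → EuclideanSpace ℝ ι) 0 :=
  ⟨MemLp.zero, MemLp.zero, fun a _ b _ => by simp⟩

/-- The continuous representative and the derivative of the zero element vanish. -/
lemma IsW12.eq_zero {u v : ℝ → EuclideanSpace ℝ ι} [hI : I.OrdConnected] (hn : I.Nontrivial)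
    (h : IsW12 I u v) (h0 : u =ᵐ[volume.restrict I] 0) :
    (∀ t ∈ I, u t = 0) ∧ v =ᵐ[volume.restrict I] 0 := by
  have hmeas : MeasurableSet I := hI.measurableSet
  have hint : ∀ a ∈ I, ∀ b ∈ I, IntegrableOn v (Set.uIcc a b) := by
    intro a ha b hb
    have h1 : MemLp v 2 (volume.restrict (Set.uIcc a b)) :=
      h.2.1.mono_measure (Measure.restrict_mono (hI.uIcc_subset ha hb) le_rfl)
    have hfin : IsFiniteMeasure (volume.restrict (Set.uIcc a b)) :=
      isFiniteMeasure_restrict.2 isCompact_uIcc.measure_lt_top.ne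
    exact h1.integrable (by norm_num)
  have hu : ∀ t ∈ I, u t = 0 := by
    intro t ht
    obtain ⟨s, hs, hst⟩ := hn.exists_ne t
    have hsub : Set.uIcc s t ⊆ I := hI.uIcc_subset hs ht
    have hc : ContinuousOn u (Set.uIcc s t) := by
      have h2 : ContinuousOn (fun x => u s + ∫ r in s..x, v r) (Set.uIcc s t) :=
        continuousOn_const.add
          (intervalIntegral.continuousOn_primitive_interval (hint s hs t ht))
      refine h2.congr fun x hx => ?_
      have h7 := h.2.2 s hs x (hsub hx)
      simp only [← h7]; abel
    have h3 : u =ᵐ[volume.restrict (Set.uIcc s t)] 0 :=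
      h0.filter_mono (ae_mono (Measure.restrict_mono hsub le_rfl))
    have hne : min s t ≠ max s t := by
      intro e; exact hst (inf_eq_sup.1 e)
    exact Measure.eqOn_Icc_of_ae_eq volume hne h3 hc continuousOn_const Set.right_mem_uIcc
  refine ⟨hu, ?_⟩
  have hzero : ∀ a ∈ I, ∀ b ∈ I, ∫ s in a..b, v s = 0 := by
    intro a ha b hb
    rw [← h.2.2 a ha b hb, hu a ha, hu b hb, sub_zero]
  have hloc : LocallyIntegrable (I.indicator v) volume :=
    ((memLp_indicator_iff_restrict hmeas).2 h.2.1).locallyIntegrable (by norm_num)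
  obtain ⟨c, hc⟩ := hn.nonempty
  have hfr : volume (frontier I) = 0 := hI.convex.addHaar_frontier volume
  have hfr' : ∀ᵐ x : ℝ, x ∉ frontier I := measure_eq_zero_iff_ae_notMem.1 hfr
  rw [EventuallyEq, ae_restrict_iff' hmeas]
  filter_upwards [LocallyIntegrable.ae_hasDerivAt_integral hloc, hfr'] with x hx hxf hxI
  have hxi : x ∈ interior I := by
    by_contra hcon
    exact hxf ⟨subset_closure hxI, hcon⟩
  have h4 : (fun y => ∫ t in c..y, I.indicator v t) =ᶠ[𝓝 x] fun _ => 0 := by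
    filter_upwards [mem_interior_iff_mem_nhds.1 hxi] with y hy
    rw [← hzero c hc y hy]
    refine intervalIntegral.integral_congr fun t ht => ?_
    exact Set.indicator_of_mem (hI.uIcc_subset hc hy ht) v
  have h5 := (hx c).congr_of_eventuallyEq h4.symm
  have h6 := h5.unique (hasDerivAt_const x 0)
  rwa [Set.indicator_of_mem hxI] at h6

end Sobolev

section Operators

variable {n : ℕ} (I : Set ℝ) [hI : I.OrdConnected]
  (L : Submodule ℝ (EuclideanSpace ℝ (Fin n ⊕ Fin n)))
  (P Q R : ℝ → Matrix (Fin n) (Fin n) ℝ)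

/-- The function `P ẇ + Q w`, where `w₁ = ẇ`. -/
def quasiDeriv {n : ℕ} (P Q : ℝ → Matrix (Fin n) (Fin n) ℝ)
    (w w₁ : ℝ → EuclideanSpace ℝ (Fin n)) (t : ℝ) : EuclideanSpace ℝ (Fin n) :=
  act (P t) (w₁ t) + act (Q t) (w t)

/-- The graph of the operator `-d/dt (P d/dt + Q) + Qᵀ d/dt + R` in `L²(I; ℝⁿ)` with domain the
set of those `w ∈ W^{2,2}(I; ℝⁿ)` which satisfy the boundary condition
`(P(0) ẇ(0) + Q(0) w(0), w(0)) ∈ L` and which the differential expression maps into `L²`.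
The choice `L = ⊤` imposes no boundary condition. Here `w₁ = ẇ`, `w₂ = ẅ` and `q` is the
derivative of `P ẇ + Q w`. -/
def slGraph : Submodule ℝ (L2 I (Fin n) × L2 I (Fin n)) where
  carrier := {x | ∃ w w₁ w₂ q : ℝ → EuclideanSpace ℝ (Fin n),
    IsW22 I w w₁ w₂ ∧ IsW12 I (quasiDeriv P Q w w₁) q ∧
    pair (quasiDeriv P Q w w₁ 0) (w 0) ∈ L ∧
    x.1 =ᵐ[volume.restrict I] w ∧
    x.2 =ᵐ[volume.restrict I] fun t => -q t + act (Q t)ᵀ (w₁ t) + act (R t) (w t)}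
  zero_mem' := by
    have e : quasiDeriv P Q (0 : ℝ → EuclideanSpace ℝ (Fin n)) 0 = 0 := by
      funext t; simp [quasiDeriv]
    refine ⟨0, 0, 0, 0, ⟨IsW12.zero, IsW12.zero⟩, ?_, ?_, ?_, ?_⟩
    · rw [e]; exact IsW12.zero
    · rw [e, Pi.zero_apply, pair_zero]; exact L.zero_mem
    · exact Lp.coeFn_zero _ _ _
    · filter_upwards [Lp.coeFn_zero (EuclideanSpace ℝ (Fin n)) 2 (volume.restrict I)] with t ht
      simp only [Prod.snd_zero, ht]; simp
  add_mem' := by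
    rintro x y ⟨w, w₁, w₂, q, hw, hq, hL, h1, h2⟩ ⟨w', w₁', w₂', q', hw', hq', hL', h1', h2'⟩
    have e : quasiDeriv P Q (w + w') (w₁ + w₁') = quasiDeriv P Q w w₁ + quasiDeriv P Q w' w₁' := by
      funext t; simp only [quasiDeriv, Pi.add_apply, map_add]; abel
    refine ⟨w + w', w₁ + w₁', w₂ + w₂', q + q', ⟨hw.1.add hw'.1, hw.2.add hw'.2⟩, ?_, ?_, ?_, ?_⟩
    · rw [e]; exact hq.add hq'
    · rw [e, Pi.add_apply, Pi.add_apply, pair_add]; exact L.add_mem hL hL'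
    · filter_upwards [Lp.coeFn_add x.1 y.1, h1, h1'] with t ht h h'
      simp only [Prod.fst_add, ht, Pi.add_apply, h, h']
    · filter_upwards [Lp.coeFn_add x.2 y.2, h2, h2'] with t ht h h'
      simp only [Prod.snd_add, ht, Pi.add_apply, h, h', map_add]; abel
  smul_mem' := by
    rintro c x ⟨w, w₁, w₂, q, hw, hq, hL, h1, h2⟩
    have e : quasiDeriv P Q (c • w) (c • w₁) = c • quasiDeriv P Q w w₁ := by
      funext t; simp only [quasiDeriv, Pi.smul_apply, map_smul, smul_add]
    refine ⟨c • w, c • w₁, c • w₂, c • q, ⟨hw.1.smul c, hw.2.smul c⟩, ?_, ?_, ?_, ?_⟩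
    · rw [e]; exact hq.smul c
    · rw [e, Pi.smul_apply, Pi.smul_apply, pair_smul]; exact L.smul_mem c hL
    · filter_upwards [Lp.coeFn_smul c x.1, h1] with t ht h
      simp only [Prod.smul_fst, ht, Pi.smul_apply, h]
    · filter_upwards [Lp.coeFn_smul c x.2, h2] with t ht h
      simp only [Prod.smul_snd, ht, Pi.smul_apply, h, map_smul, smul_add, smul_neg]

/-- The graph of the operator `-J d/dt - B(t)` in `L²(I; ℝ^{2n})` with domain
`{z ∈ W^{1,2}(I; ℝ^{2n}) | z(0) ∈ L}`. The choice `L = ⊤` imposes no boundary condition. -/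
def hamGraph : Submodule ℝ (L2 I (Fin n ⊕ Fin n) × L2 I (Fin n ⊕ Fin n)) where
  carrier := {x | ∃ z z₁ : ℝ → EuclideanSpace ℝ (Fin n ⊕ Fin n),
    IsW12 I z z₁ ∧ z 0 ∈ L ∧ x.1 =ᵐ[volume.restrict I] z ∧
    x.2 =ᵐ[volume.restrict I] fun t =>
      -act (Matrix.J (Fin n) ℝ) (z₁ t) - act (hamMatrix (P t) (Q t) (R t)) (z t)}
  zero_mem' := by
    refine ⟨0, 0, IsW12.zero, L.zero_mem, Lp.coeFn_zero _ _ _, ?_⟩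
    filter_upwards [Lp.coeFn_zero (EuclideanSpace ℝ (Fin n ⊕ Fin n)) 2 (volume.restrict I)]
      with t ht
    simp only [Prod.snd_zero, ht]; simp
  add_mem' := by
    rintro x y ⟨z, z₁, hz, hL, h1, h2⟩ ⟨z', z₁', hz', hL', h1', h2'⟩
    refine ⟨z + z', z₁ + z₁', hz.add hz', L.add_mem hL hL', ?_, ?_⟩
    · filter_upwards [Lp.coeFn_add x.1 y.1, h1, h1'] with t ht h h'
      simp only [Prod.fst_add, ht, Pi.add_apply, h, h']
    · filter_upwards [Lp.coeFn_add x.2 y.2, h2, h2'] with t ht h h'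
      simp only [Prod.snd_add, ht, Pi.add_apply, h, h', map_add]; abel
  smul_mem' := by
    rintro c x ⟨z, z₁, hz, hL, h1, h2⟩
    refine ⟨c • z, c • z₁, hz.smul c, L.smul_mem c hL, ?_, ?_⟩
    · filter_upwards [Lp.coeFn_smul c x.1, h1] with t ht h
      simp only [Prod.smul_fst, ht, Pi.smul_apply, h]
    · filter_upwards [Lp.coeFn_smul c x.2, h2] with t ht h
      simp only [Prod.smul_snd, ht, Pi.smul_apply, h, map_smul, smul_sub, smul_neg]

/-- The Sturm–Liouville operator `-d/dt (P d/dt + Q) + Qᵀ d/dt + R`, an unbounded operator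
in `L²(I; ℝⁿ)`. -/
def slOp : L2 I (Fin n) →ₗ.[ℝ] L2 I (Fin n) := (slGraph I L P Q R).toLinearPMap

/-- The Hamiltonian operator `-J d/dt - B(t)`, an unbounded operator in `L²(I; ℝ^{2n})`. -/
def hamOp : L2 I (Fin n ⊕ Fin n) →ₗ.[ℝ] L2 I (Fin n ⊕ Fin n) :=
  (hamGraph I L P Q R).toLinearPMap

lemma slOp_graph (hn : I.Nontrivial) : (slOp I L P Q R).graph = slGraph I L P Q R := by
  refine Submodule.toLinearPMap_graph_eq _ ?_
  rintro ⟨x, y⟩ ⟨w, w₁, w₂, q, hw, hq, -, h1, h2⟩ (rfl : x = 0)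
  have h0 : w =ᵐ[volume.restrict I] 0 := h1.symm.trans (Lp.coeFn_zero _ _ _)
  obtain ⟨a, b⟩ := hw.1.eq_zero hn h0
  have h3 : quasiDeriv P Q w w₁ =ᵐ[volume.restrict I] 0 := by
    filter_upwards [h0, b] with t ht ht'
    simp [quasiDeriv, ht, ht']
  have h4 := (hq.eq_zero hn h3).2
  refine Lp.ext ?_
  filter_upwards [h2, h0, b, h4,
    Lp.coeFn_zero (EuclideanSpace ℝ (Fin n)) 2 (volume.restrict I)] with t e1 e2 e3 e4 e5
  rw [e1, e2, e3, e4, e5]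
  simp

lemma hamOp_graph (hn : I.Nontrivial) : (hamOp I L P Q R).graph = hamGraph I L P Q R := by
  refine Submodule.toLinearPMap_graph_eq _ ?_
  rintro ⟨x, y⟩ ⟨z, z₁, hz, -, h1, h2⟩ (rfl : x = 0)
  have h0 : z =ᵐ[volume.restrict I] 0 := h1.symm.trans (Lp.coeFn_zero _ _ _)
  obtain ⟨-, b⟩ := hz.eq_zero hn h0
  refine Lp.ext ?_
  filter_upwards [h2, h0, b,
    Lp.coeFn_zero (EuclideanSpace ℝ (Fin n ⊕ Fin n)) 2 (volume.restrict I)] with t e1 e2 e3 e4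
  rw [e1, e2, e3, e4]
  simp

end Operators

/-- The standing assumptions on the coefficients over the interval `I`, except for the limits at
infinity: `P, Q, R` are of class `C¹`, `P` and `R` are symmetric, `|P(t) v| ≥ C₁ |v|` with a
constant `C₁ > 0`, and `Q` and `R` are bounded. -/
structure IsCoefficient {n : ℕ} (I : Set ℝ) (P Q R : ℝ → Matrix (Fin n) (Fin n) ℝ) : Prop where
  contDiffOn_P : ∀ i j, ContDiffOn ℝ 1 (fun t => P t i j) I
  contDiffOn_Q : ∀ i j, ContDiffOn ℝ 1 (fun t => Q t i j) I
  contDiffOn_R : ∀ i j, ContDiffOn ℝ 1 (fun t => R t i j) I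
  symm_P : ∀ t ∈ I, (P t).IsSymm
  symm_R : ∀ t ∈ I, (R t).IsSymm
  lower_P : ∃ C₁ > 0, ∀ t ∈ I, ∀ v, C₁ * ‖v‖ ≤ ‖act (P t) v‖
  upper_Q : ∃ C₂, ∀ t ∈ I, ∀ v, ‖act (Q t) v‖ ≤ C₂ * ‖v‖
  upper_R : ∃ C₃, ∀ t ∈ I, ∀ v, ‖act (R t) v‖ ≤ C₃ * ‖v‖

/-- The expression `-d/dt (P d/dt + Q) + Qᵀ d/dt + R` with bounded `Q` and `R` maps
`W^{2,2}(I; ℝⁿ)` into `L²(I; ℝⁿ)`: for every `w` in `W^{2,2}`, the function `P ẇ + Q w` is in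
`W^{1,2}`. This always holds if the derivatives of `P` and `Q` are bounded. -/
def MapsW22IntoL2 {n : ℕ} (I : Set ℝ) (P Q : ℝ → Matrix (Fin n) (Fin n) ℝ) : Prop :=
  ∀ w w₁ w₂ : ℝ → EuclideanSpace ℝ (Fin n), IsW22 I w w₁ w₂ →
    ∃ q, IsW12 I (quasiDeriv P Q w w₁) q

end SturmLiouville

end

open SturmLiouville

/-!
The Sturm–Liouville equation `-(P w' + Q w)' + Qᵀ w' + R w = g` is equivalent to the Hamiltonian
system `-J z' - B z = (0, g)` for `z = (P w' + Q w, w)`, and the Hamiltonian system is the linear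
system `z' = S z + h` with `S = J B`, which is asymptotically constant. Both parts of the theorem
are proved for graphs of operators, for which `IsFredholm` amounts to closedness of the graph,
finite dimension of the kernel and finite codimension of the range (`isFredholm_iff_graph`).

*Sturm–Liouville against Hamiltonian.* Kernels, ranges and closedness of the two operators
correspond to each other by an algebraic argument (`fredholm_iff_of_reduction`), provided that
each solution of the Hamiltonian system with right-hand side `(0, g)` has its second component in
`W^{2,2}`, and that every right-hand side can be brought to the form `(0, g)` by subtracting an
element of the range. Both facts need that multiplication by `P`, `Q` and `P⁻¹` preserves
`W^{1,2}` (`IsCoefficient.isW12_products`). The derivatives of `P` and `Q` may be unbounded; what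
is known is that the differential expression maps `W^{2,2}` into `L²`. A function `u` in `W^{1,2}`
is dominated by a scalar function `φ` in `W^{2,2}` with `|φ'| ≤ φ`, the sum of two exponential
averages of `|u| + |u'|` (`IsW12.exists_majorant`). The hypothesis applied to `φ cos t e` and to
`φ sin t e`, for constant vectors `e`, shows that `φ P' e` and `φ Q' e` are square integrable, and
hence so are `P' u` and `Q' u` (`memLp_derivWithin_apply`).

*Hyperbolicity implies the Fredholm property.* The operator is always closed, and its
kernel is finite dimensional, because elements of the kernel are determined by their value at `0`. On the
whole line, the system with a constant hyperbolic matrix is solved with a bound in `L²` by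
removing the eigenvalues one after the other: each factor `d/dt - μ` with `Re μ ≠ 0` is inverted
by a convolution with an exponential, and the Cayley–Hamilton theorem ends the procedure
(`exists_solution_of_aeval_eq_zero`). The bound is the same on all intervals, so the system with
coefficient `S` is solvable near an end of the line at which `S` has a hyperbolic limit
(`exists_isSolvable_of_isHyperbolic`). It is solvable on compact intervals, and glueing costs only
finitely many dimensions of the range (`coFG_odeRange_union`), as do boundary conditions.

*The Fredholm property implies hyperbolicity.* If the limit matrix has an imaginary eigenvalue,
the constant system has bounded oscillating solutions. Cut off to longer and longer intervals
going to infinity, they form a Weyl sequence (`isHyperbolic_of_fredholm`), which does not exist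
for a Fredholm operator (`not_exists_weyl_sequence`).
-/
namespace SturmLiouville

/-! ### Fredholm operators and their graphs -/

section Abstract

variable {X Y : Type*} [NormedAddCommGroup X] [NormedSpace ℝ X]
  [NormedAddCommGroup Y] [NormedSpace ℝ Y]

/-- A closed relation whose range has finite codimension has closed range: with a finite
dimensional complement `W` of the range, the surjection `G × W → Y` is open. -/
lemma isClosed_map_snd_of_coFG [CompleteSpace X] [CompleteSpace Y] {G : Submodule ℝ (X × Y)}
    (hG : IsClosed (G : Set (X × Y))) (h : (G.map (LinearMap.snd ℝ X Y)).CoFG) :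
    IsClosed (G.map (LinearMap.snd ℝ X Y) : Set Y) := by
  obtain ⟨W, hW⟩ := Submodule.exists_isCompl (G.map (LinearMap.snd ℝ X Y))
  have : FiniteDimensional ℝ W := .of_fg <| Submodule.CoFG.fg_of_isCompl hW h
  have : CompleteSpace G := hG.completeSpace_coe
  let f : G →L[ℝ] Y := (ContinuousLinearMap.snd ℝ X Y).comp G.subtypeL
  let F : (G × W) →L[ℝ] Y := f.coprod W.subtypeL
  have hF : Function.Surjective F := by
    intro y
    have : y ∈ G.map (LinearMap.snd ℝ X Y) ⊔ W := by rw [hW.sup_eq_top]; trivial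
    obtain ⟨a, ⟨g, hg, rfl⟩, w, hw, rfl⟩ := Submodule.mem_sup.1 this
    exact ⟨(⟨g, hg⟩, ⟨w, hw⟩), by simp [F, f]⟩
  have hq := (F.isOpenMap hF).isQuotientMap F.continuous hF
  rw [← hq.isClosed_preimage]
  have : F ⁻¹' (G.map (LinearMap.snd ℝ X Y) : Set Y) = {p : G × W | p.2 = 0} := by
    ext ⟨⟨g, hg⟩, w⟩
    simp only [Set.mem_preimage, SetLike.mem_coe, Set.mem_ofPred_eq]
    have hgm : g.2 ∈ G.map (LinearMap.snd ℝ X Y) := ⟨g, hg, rfl⟩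
    have e : F (⟨g, hg⟩, w) = g.2 + w := by simp [F, f]
    rw [e]
    constructor
    · intro h1
      have h2 : (w : Y) ∈ G.map (LinearMap.snd ℝ X Y) := by
        simpa using Submodule.sub_mem _ h1 hgm
      exact Subtype.ext (Submodule.disjoint_def.1 hW.disjoint _ h2 w.2)
    · rintro rfl
      simpa using hgm
  rw [this]
  exact isClosed_eq continuous_snd continuous_const

/-- Fredholmness of an operator in terms of its graph. That the range is closed is automatic for
a closed operator whose range has finite codimension. -/
lemma isFredholm_iff_graph [CompleteSpace X] [CompleteSpace Y] (T : X →ₗ.[ℝ] Y) :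
    IsFredholm T ↔ IsClosed (T.graph : Set (X × Y)) ∧
      FiniteDimensional ℝ (T.graph.comap (LinearMap.inl ℝ X Y)) ∧
      (T.graph.map (LinearMap.snd ℝ X Y)).CoFG := by
  have hr : LinearMap.range T.toFun = T.graph.map (LinearMap.snd ℝ X Y) := by
    ext y
    simp only [LinearMap.mem_range, Submodule.mem_map, LinearMap.snd_apply, Prod.exists,
      LinearPMap.mem_graph_iff]
    constructor
    · rintro ⟨x, rfl⟩; exact ⟨x, _, ⟨x, rfl, rfl⟩, rfl⟩
    · rintro ⟨a, b, ⟨x, rfl, h⟩, rfl⟩; exact ⟨x, h⟩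
  have hk : FiniteDimensional ℝ (LinearMap.ker T.toFun) ↔
      FiniteDimensional ℝ (T.graph.comap (LinearMap.inl ℝ X Y)) := by
    have e : T.graph.comap (LinearMap.inl ℝ X Y) =
        (LinearMap.ker T.toFun).map T.domain.subtype := by
      ext x
      simp only [Submodule.mem_comap, LinearMap.inl_apply, LinearPMap.mem_graph_iff,
        Submodule.mem_map, LinearMap.mem_ker, Submodule.subtype_apply]
      constructor
      · rintro ⟨y, hy, h⟩; exact ⟨y, h, hy⟩
      · rintro ⟨y, h, hy⟩; exact ⟨y, hy, h⟩
    rw [e]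
    exact Module.Finite.equiv_iff
      (Submodule.equivMapOfInjective _ (Submodule.injective_subtype _) _)
  unfold IsFredholm
  rw [hk, hr]
  constructor
  · rintro ⟨a, b, -, d⟩; exact ⟨a, b, d⟩
  · rintro ⟨a, b, d⟩; exact ⟨a, b, isClosed_map_snd_of_coFG a d, d⟩

/-- A closed relation with closed range is boundedly invertible modulo its kernel. -/
lemma exists_norm_sub_ker_le [CompleteSpace X] [CompleteSpace Y] {G : Submodule ℝ (X × Y)}
    (hG : IsClosed (G : Set (X × Y))) (h : (G.map (LinearMap.snd ℝ X Y)).CoFG) :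
    ∃ C > 0, ∀ p ∈ G, ∃ k, (k, (0 : Y)) ∈ G ∧ ‖p.1 - k‖ ≤ C * ‖p.2‖ := by
  have hcl := isClosed_map_snd_of_coFG hG h
  have : CompleteSpace G := hG.completeSpace_coe
  have : CompleteSpace (G.map (LinearMap.snd ℝ X Y)) := hcl.completeSpace_coe
  let f : G →L[ℝ] (G.map (LinearMap.snd ℝ X Y)) :=
    ((ContinuousLinearMap.snd ℝ X Y).comp G.subtypeL).codRestrict _
      (fun g => ⟨g, g.2, rfl⟩)
  have hf : Function.Surjective f := by
    rintro ⟨_, g, hg, rfl⟩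
    exact ⟨⟨g, hg⟩, rfl⟩
  obtain ⟨C, hC, hb⟩ := f.exists_preimage_norm_le hf
  refine ⟨C, hC, fun p hp => ?_⟩
  obtain ⟨⟨g, hg⟩, h1, h2⟩ := hb ⟨p.2, p, hp, rfl⟩
  have h3 : g.2 = p.2 := congrArg Subtype.val h1
  refine ⟨p.1 - g.1, ?_, ?_⟩
  · have := G.sub_mem hp hg
    rwa [show p - g = (p.1 - g.1, (0 : Y)) from Prod.ext rfl (by simp [h3])] at this
  · rw [sub_sub_cancel]
    exact (norm_fst_le g).trans h2

/-- Imposing finitely many linear conditions changes the codimension by a finite amount. -/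
lemma coFG_comap_inl {V W : Type*} [AddCommGroup V] [Module ℝ V] [AddCommGroup W] [Module ℝ W]
    [FiniteDimensional ℝ W] (Γ : Submodule ℝ (V × W))
    (h : (Γ.map (LinearMap.fst ℝ V W)).CoFG) : (Γ.comap (LinearMap.inl ℝ V W)).CoFG := by
  -- The subspace `N` of `Γ` cut out by the conditions has a finite dimensional complement in `Γ`.
  let s : Γ →ₗ[ℝ] W := (LinearMap.snd ℝ V W).comp Γ.subtype
  obtain ⟨N, hN⟩ := Submodule.exists_isCompl (LinearMap.ker s)
  have hNf : N.FG := Submodule.CoFG.fg_of_isCompl hN (Submodule.CoFG.ker s)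
  obtain ⟨M, hM⟩ := Submodule.exists_isCompl (Γ.map (LinearMap.fst ℝ V W))
  have hMf : M.FG := Submodule.CoFG.fg_of_isCompl hM h
  let N' := N.map ((LinearMap.fst ℝ V W).comp Γ.subtype)
  refine Submodule.FG.cofg_of_codisjoint (S := N' ⊔ M) ?_ ((hNf.map _).sup hMf)
  rw [codisjoint_iff, eq_top_iff]
  rintro v -
  have : v ∈ Γ.map (LinearMap.fst ℝ V W) ⊔ M := by rw [hM.sup_eq_top]; trivial
  obtain ⟨_, ⟨g, hg, rfl⟩, m, hm, rfl⟩ := Submodule.mem_sup.1 this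
  have : (⟨g, hg⟩ : Γ) ∈ LinearMap.ker s ⊔ N := by rw [hN.sup_eq_top]; trivial
  obtain ⟨a, ha, b, hb, hab⟩ := Submodule.mem_sup.1 this
  have e : g.1 = a.1.1 + b.1.1 := by
    have := congrArg (fun z : Γ => z.1.1) hab
    simpa using this.symm
  have ha' : a.1.1 ∈ Γ.comap (LinearMap.inl ℝ V W) := by
    have : a.1.2 = 0 := ha
    simp only [Submodule.mem_comap, LinearMap.inl_apply]
    rw [← this]
    exact a.2
  have hb' : b.1.1 ∈ N' := ⟨b, hb, rfl⟩
  have : (LinearMap.fst ℝ V W) g + m = (b.1.1 + m) + a.1.1 := by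
    simp only [LinearMap.fst_apply, e]; abel
  rw [this]
  exact Submodule.add_mem_sup (Submodule.add_mem_sup hb' hm) ha'

/-- A closed relation that can be solved approximately, with control on the solution, can be
solved. -/
lemma exists_mem_of_approx [CompleteSpace X] {G : Submodule ℝ (X × Y)}
    (hG : IsClosed (G : Set (X × Y))) (C : ℝ)
    (h : ∀ y : Y, ∃ p ∈ G, ‖p.1‖ ≤ C * ‖y‖ ∧ ‖y - p.2‖ ≤ 2⁻¹ * ‖y‖) (y : Y) :
    ∃ x, (x, y) ∈ G := by
  choose f hfG hf1 hf2 using h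
  let r : ℕ → Y := fun n => Nat.rec y (fun _ z => z - (f z).2) n
  have hr : ∀ n, r (n + 1) = r n - (f (r n)).2 := fun n => rfl
  have hrn : ∀ n, ‖r n‖ ≤ 2⁻¹ ^ n * ‖y‖ := by
    intro n
    induction n with
    | zero => simp [r]
    | succ n ih =>
      rw [hr, pow_succ', mul_assoc]
      exact (hf2 _).trans (by gcongr)
  have hr0 : Tendsto r atTop (𝓝 0) := by
    refine squeeze_zero_norm hrn ?_
    simpa using (tendsto_pow_atTop_nhds_zero_of_lt_one (r := (2⁻¹ : ℝ)) (by norm_num)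
      (by norm_num)).mul_const ‖y‖
  have hsum : Summable fun n => (f (r n)).1 := by
    refine Summable.of_norm_bounded (g := fun n => |C| * (2⁻¹ ^ n * ‖y‖)) ?_ fun n => ?_
    · exact ((summable_geometric_of_lt_one (by norm_num) (by norm_num)).mul_right _).mul_left _
    · refine (hf1 _).trans ?_
      exact mul_le_mul (le_abs_self C) (hrn n) (norm_nonneg _) (abs_nonneg _)
  obtain ⟨x, hx⟩ := hsum
  have hS : ∀ n, (∑ k ∈ Finset.range n, (f (r k)).2) = y - r n := by
    intro n
    induction n with
    | zero => simp [r]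
    | succ n ih => rw [Finset.sum_range_succ, ih, hr]; abel
  refine ⟨x, hG.mem_of_tendsto (b := atTop)
    (f := fun n => ∑ k ∈ Finset.range n, f (r k)) ?_ (Eventually.of_forall fun n => ?_)⟩
  · refine Tendsto.congr (f₁ := fun n => (∑ k ∈ Finset.range n, (f (r k)).1, y - r n))
      (fun n => ?_) ?_
    · rw [← hS]; exact Prod.ext (by simp [Prod.fst_sum]) (by simp [Prod.snd_sum])
    · exact (hx.tendsto_sum_nat).prodMk_nhds (by simpa using tendsto_const_nhds.sub hr0)
  · exact Submodule.sum_mem _ fun k _ => hfG _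

/-- Comparison of a second order operator with the associated first order system: `A` and `F` are
the graphs of the two operators, `ι` is the inclusion `g ↦ (0, g)` of right-hand sides and
`π` is the projection `(p, w) ↦ w` of solutions. -/
lemma fredholm_iff_of_reduction {X₁ Y₁ : Type*} [NormedAddCommGroup X₁] [NormedSpace ℝ X₁]
    [NormedAddCommGroup Y₁] [NormedSpace ℝ Y₁] [CompleteSpace X] [CompleteSpace Y]
    (A : Submodule ℝ (X₁ × Y₁)) (F : Submodule ℝ (X × Y)) (ι : Y₁ →L[ℝ] Y) (π : X →L[ℝ] X₁)
    (hAF : ∀ p ∈ A, ∃ z, π z = p.1 ∧ (z, ι p.2) ∈ F)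
    (hFA : ∀ z g, (z, ι g) ∈ F → (π z, g) ∈ A)
    (hker : ∀ z, (z, (0 : Y)) ∈ F → π z = 0 → z = 0)
    (hsurj : ∀ y, ∃ x g, (x, y - ι g) ∈ F)
    (hF : IsClosed (F : Set (X × Y))) :
    (IsClosed (A : Set (X₁ × Y₁)) ∧
      FiniteDimensional ℝ (A.comap (LinearMap.inl ℝ X₁ Y₁)) ∧
      (A.map (LinearMap.snd ℝ X₁ Y₁)).CoFG) ↔
    (IsClosed (F : Set (X × Y)) ∧
      FiniteDimensional ℝ (F.comap (LinearMap.inl ℝ X Y)) ∧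
      (F.map (LinearMap.snd ℝ X Y)).CoFG) := by
  have hkA : A.comap (LinearMap.inl ℝ X₁ Y₁) =
      (F.comap (LinearMap.inl ℝ X Y)).map (π : X →ₗ[ℝ] X₁) := by
    ext w
    simp only [Submodule.mem_comap, LinearMap.inl_apply, Submodule.mem_map]
    constructor
    · intro hw
      obtain ⟨z, hz, hzF⟩ := hAF _ hw
      exact ⟨z, by simpa using hzF, hz⟩
    · rintro ⟨z, hz, rfl⟩
      exact hFA z 0 (by simpa using hz)
  have hrA : A.map (LinearMap.snd ℝ X₁ Y₁) =
      (F.map (LinearMap.snd ℝ X Y)).comap (ι : Y₁ →ₗ[ℝ] Y) := by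
    ext g
    simp only [Submodule.mem_comap, Submodule.mem_map, LinearMap.snd_apply, Prod.exists,
      exists_eq_right]
    constructor
    · rintro ⟨w, hw⟩
      obtain ⟨z, -, hzF⟩ := hAF _ hw
      exact ⟨z, hzF⟩
    · rintro ⟨z, hz⟩
      exact ⟨_, hFA z g hz⟩
  constructor
  · rintro ⟨-, h1, h2⟩
    refine ⟨hF, ?_, ?_⟩
    · rw [hkA] at h1
      let e : (F.comap (LinearMap.inl ℝ X Y)) →ₗ[ℝ]
          (F.comap (LinearMap.inl ℝ X Y)).map (π : X →ₗ[ℝ] X₁) :=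
        (π : X →ₗ[ℝ] X₁).submoduleMap _
      refine Module.Finite.of_injective e ?_
      rw [← LinearMap.ker_eq_bot, LinearMap.ker_eq_bot']
      rintro ⟨z, hz⟩ h0
      exact Subtype.ext (hker z hz (congrArg Subtype.val h0))
    · rw [hrA] at h2
      let q : Y₁ →ₗ[ℝ] (Y ⧸ F.map (LinearMap.snd ℝ X Y)) :=
        (Submodule.mkQ _).comp (ι : Y₁ →ₗ[ℝ] Y)
      have hq : Function.Surjective q := by
        intro c
        obtain ⟨y, rfl⟩ := Submodule.mkQ_surjective _ c
        obtain ⟨x, g, hx⟩ := hsurj y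
        refine ⟨g, ?_⟩
        have hy : ι g - y ∈ F.map (LinearMap.snd ℝ X Y) := by
          rw [← neg_sub]; exact Submodule.neg_mem _ ⟨_, hx, rfl⟩
        simpa [q] using (Submodule.Quotient.eq _).2 hy
      have hk : LinearMap.ker q = (F.map (LinearMap.snd ℝ X Y)).comap (ι : Y₁ →ₗ[ℝ] Y) := by
        rw [LinearMap.ker_comp, Submodule.ker_mkQ]
      have h3 : (LinearMap.ker q).CoFG := by rw [hk]; exact h2
      have h4 := Submodule.range_fg_iff_ker_cofg.2 h3
      rw [LinearMap.range_eq_top.2 hq] at h4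
      exact Module.finite_def.2 h4
  · rintro ⟨-, h1, h2⟩
    have hAk : FiniteDimensional ℝ (A.comap (LinearMap.inl ℝ X₁ Y₁)) := by
      rw [hkA]; exact Module.Finite.map _ _
    refine ⟨?_, hAk, ?_⟩
    · have hcl := isClosed_map_snd_of_coFG hF h2
      have hclA : IsClosed (A.map (LinearMap.snd ℝ X₁ Y₁) : Set Y₁) := by
        rw [hrA]; exact hcl.preimage ι.continuous
      obtain ⟨C, -, hC⟩ := exists_norm_sub_ker_le hF h2
      have hkcl : IsClosed (A.comap (LinearMap.inl ℝ X₁ Y₁) : Set X₁) :=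
        Submodule.closed_of_finiteDimensional _
      refine IsSeqClosed.isClosed ?_
      rintro u ⟨w, g⟩ hu hlim
      have hlim1 : Tendsto (fun n => (u n).1) atTop (𝓝 w) :=
        (continuous_fst.tendsto _).comp hlim
      have hlim2 : Tendsto (fun n => (u n).2) atTop (𝓝 g) :=
        (continuous_snd.tendsto _).comp hlim
      -- The limit `g` lies in the range; correct `u n` by solutions tending to zero.
      have hg : g ∈ A.map (LinearMap.snd ℝ X₁ Y₁) :=
        hclA.mem_of_tendsto hlim2 (Eventually.of_forall fun n => ⟨u n, hu n, rfl⟩)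
      obtain ⟨⟨w', _⟩, hw', rfl⟩ := hg
      simp only [LinearMap.snd_apply] at *
      rename_i g
      have key : ∀ n, ∃ v, (v, ι ((u n).2 - g)) ∈ F ∧ ‖v‖ ≤ C * ‖ι ((u n).2 - g)‖ := by
        intro n
        obtain ⟨z, -, hzF⟩ := hAF _ (A.sub_mem (hu n) hw')
        obtain ⟨k, hk, hkb⟩ := hC _ hzF
        refine ⟨z - k, ?_, hkb⟩
        simpa using F.sub_mem hzF hk
      choose v hv hvb using key
      have hv0 : Tendsto v atTop (𝓝 0) := by
        refine squeeze_zero_norm hvb ?_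
        have : Tendsto (fun n => ι ((u n).2 - g)) atTop (𝓝 (ι (g - g))) :=
          (ι.continuous.tendsto _).comp (hlim2.sub_const g)
        simpa using this.norm.const_mul C
      have hk : ∀ n, (u n).1 - w' - π (v n) ∈ A.comap (LinearMap.inl ℝ X₁ Y₁) := by
        intro n
        have := A.sub_mem (A.sub_mem (hu n) hw') (hFA _ _ (hv n))
        rwa [show u n - (w', g) - (π (v n), (u n).2 - g) = ((u n).1 - w' - π (v n), 0) from
          Prod.ext rfl (by simp)] at this
      have hlimk : Tendsto (fun n => (u n).1 - w' - π (v n)) atTop (𝓝 (w - w' - π 0)) :=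
        (hlim1.sub_const w').sub ((π.continuous.tendsto _).comp hv0)
      have := hkcl.mem_of_tendsto hlimk (Eventually.of_forall hk)
      rw [map_zero, sub_zero] at this
      have := A.add_mem this hw'
      simpa using this
    · rw [hrA]
      let q : Y₁ →ₗ[ℝ] (Y ⧸ F.map (LinearMap.snd ℝ X Y)) :=
        (Submodule.mkQ _).comp (ι : Y₁ →ₗ[ℝ] Y)
      have : FiniteDimensional ℝ (Y ⧸ F.map (LinearMap.snd ℝ X Y)) := h2
      have h3 : (LinearMap.ker q).CoFG := Submodule.CoFG.ker q
      rwa [LinearMap.ker_comp, Submodule.ker_mkQ] at h3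

end Abstract

/-! ### Locally absolutely continuous functions -/

section Primitive

variable {A E F : Type*} [NormedAddCommGroup A] [NormedSpace ℝ A]
  [NormedAddCommGroup E] [NormedSpace ℝ E] [NormedAddCommGroup F] [NormedSpace ℝ F]
  {I : Set ℝ}

/-- On the interval `I` the function `u` is a primitive of the locally integrable function `v`;
that is, `u` is locally absolutely continuous on `I` with derivative `v`. Integrability of `v` is
required explicitly, since the integral of a function which is not integrable is zero. -/
def IsPrimitiveOn (I : Set ℝ) (u v : ℝ → E) : Prop :=
  ∀ a ∈ I, ∀ b ∈ I, IntervalIntegrable v volume a b ∧ u b - u a = ∫ s in a..b, v s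

lemma IsPrimitiveOn.mono {J : Set ℝ} {u v : ℝ → E} (h : IsPrimitiveOn I u v) (hJ : J ⊆ I) :
    IsPrimitiveOn J u v := fun a ha b hb => h a (hJ ha) b (hJ hb)

lemma IsPrimitiveOn.congr {u v u' v' : ℝ → E} [hI : I.OrdConnected] (h : IsPrimitiveOn I u v)
    (hu : ∀ t ∈ I, u t = u' t) (hv : ∀ t ∈ I, v t = v' t) : IsPrimitiveOn I u' v' := by
  intro a ha b hb
  have hs : Set.uIcc a b ⊆ I := hI.uIcc_subset ha hb
  obtain ⟨h1, h2⟩ := h a ha b hb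
  refine ⟨h1.congr fun t ht => hv t (hs (Set.uIoc_subset_uIcc ht)), ?_⟩
  rw [← hu a ha, ← hu b hb, h2]
  exact intervalIntegral.integral_congr fun t ht => hv t (hs ht)

lemma IsPrimitiveOn.continuousOn {u v : ℝ → E} [hI : I.OrdConnected]
    (h : IsPrimitiveOn I u v) {a b : ℝ} (ha : a ∈ I) (hb : b ∈ I) :
    ContinuousOn u (Set.uIcc a b) := by
  have h2 : ContinuousOn (fun x => u a + ∫ r in a..x, v r) (Set.uIcc a b) :=
    continuousOn_const.add
      (intervalIntegral.continuousOn_primitive_interval (by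
        have := (h a ha b hb).1
        rwa [intervalIntegrable_iff'] at this))
  refine h2.congr fun x hx => ?_
  have h7 := (h a ha x (hI.uIcc_subset ha hb hx)).2
  simp only [← h7]; abel

lemma IsPrimitiveOn.continuous {u v : ℝ → E} (h : IsPrimitiveOn Set.univ u v) :
    Continuous u := by
  rw [continuous_iff_continuousAt]
  intro t
  have : ContinuousOn u (Set.uIcc (t - 1) (t + 1)) :=
    h.continuousOn (Set.mem_univ _) (Set.mem_univ _)
  rw [Set.uIcc_of_le (by linarith)] at this
  exact this.continuousAt (Icc_mem_nhds (by linarith) (by linarith))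

lemma IsPrimitiveOn.add {u v u' v' : ℝ → E} (h : IsPrimitiveOn I u v)
    (h' : IsPrimitiveOn I u' v') :
    IsPrimitiveOn I (fun t => u t + u' t) (fun t => v t + v' t) := by
  intro a ha b hb
  obtain ⟨h1, h2⟩ := h a ha b hb
  obtain ⟨h1', h2'⟩ := h' a ha b hb
  refine ⟨h1.add h1', ?_⟩
  rw [intervalIntegral.integral_add h1 h1', ← h2, ← h2']
  exact add_sub_add_comm _ _ _ _

lemma IsPrimitiveOn.clm [CompleteSpace E] [CompleteSpace F] {u v : ℝ → E}
    (h : IsPrimitiveOn I u v) (T : E →L[ℝ] F) :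
    IsPrimitiveOn I (fun t => T (u t)) (fun t => T (v t)) := by
  intro a ha b hb
  obtain ⟨h1, h2⟩ := h a ha b hb
  refine ⟨⟨T.integrable_comp h1.1, T.integrable_comp h1.2⟩, ?_⟩
  rw [T.intervalIntegral_comp_comm h1, ← h2, map_sub]

lemma IsPrimitiveOn.comp_neg {u v : ℝ → E} (h : IsPrimitiveOn Set.univ u v) :
    IsPrimitiveOn Set.univ (fun t => u (-t)) (fun t => -v (-t)) := by
  intro a _ b _
  obtain ⟨h1, h2⟩ := h (-a) trivial (-b) trivial
  refine ⟨?_, ?_⟩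
  · have := (IntervalIntegrable.iff_comp_neg (f := v) (a := -a) (b := -b)).1 h1
    simp only [neg_neg] at this
    exact this.neg
  · rw [intervalIntegral.integral_neg, intervalIntegral.integral_comp_neg, h2,
      intervalIntegral.integral_symm]

lemma absolutelyContinuousOnInterval_of_dist_le {G : Type*} [SeminormedAddCommGroup G] {f : ℝ → G}
    {g h : ℝ → ℝ} {a b C : ℝ}
    (hg : AbsolutelyContinuousOnInterval g a b) (hh : AbsolutelyContinuousOnInterval h a b)
    (hf : ∀ x ∈ Set.uIcc a b, ∀ y ∈ Set.uIcc a b,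
      dist (f x) (f y) ≤ C * (dist (g x) (g y) + dist (h x) (h y))) :
    AbsolutelyContinuousOnInterval f a b := by
  unfold AbsolutelyContinuousOnInterval at *
  refine squeeze_zero' (Eventually.of_forall fun E => Finset.sum_nonneg fun _ _ => dist_nonneg)
    (g := fun E => C * (∑ i ∈ Finset.range E.1, dist (g (E.2 i).1) (g (E.2 i).2) +
      ∑ i ∈ Finset.range E.1, dist (h (E.2 i).1) (h (E.2 i).2))) ?_
      (by simpa using (hg.add hh).const_mul C)
  rw [eventually_inf_principal]
  refine Eventually.of_forall fun E hE => ?_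
  rw [← Finset.sum_add_distrib, Finset.mul_sum]
  exact Finset.sum_le_sum fun i hi => hf _ (hE.1 i hi).1 _ (hE.1 i hi).2

/-- The increments of a primitive are controlled by those of a scalar absolutely continuous
function, its variation. -/
lemma IsPrimitiveOn.exists_variation {u v : ℝ → E} {a b : ℝ}
    (h : IsPrimitiveOn (Set.uIcc a b) u v) :
    ∃ g : ℝ → ℝ, AbsolutelyContinuousOnInterval g a b ∧
      ∀ x ∈ Set.uIcc a b, ∀ y ∈ Set.uIcc a b, dist (u x) (u y) ≤ dist (g x) (g y) := by
  have hv := (h a Set.left_mem_uIcc b Set.right_mem_uIcc).1.norm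
  refine ⟨fun x => ∫ s in a..x, ‖v s‖,
    hv.absolutelyContinuousOnInterval_intervalIntegral Set.left_mem_uIcc, ?_⟩
  intro x hx y hy
  have hax := (h a Set.left_mem_uIcc x hx).1.norm
  have hay := (h a Set.left_mem_uIcc y hy).1.norm
  rw [dist_comm, dist_comm (∫ s in a..x, ‖v s‖), dist_eq_norm, dist_eq_norm,
    (h x hx y hy).2, intervalIntegral.integral_interval_sub_left hay hax]
  exact intervalIntegral.norm_integral_le_abs_integral_norm

lemma intervalIntegrable_bilin (B : A →L[ℝ] E →L[ℝ] F) {M : ℝ → A} {u : ℝ → E} {a b : ℝ}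
    (hM : IntervalIntegrable M volume a b) (hu : ContinuousOn u (Set.uIcc a b)) :
    IntervalIntegrable (fun t => B (M t) (u t)) volume a b := by
  obtain ⟨K, hK⟩ := isCompact_uIcc.exists_bound_of_continuousOn hu
  rw [intervalIntegrable_iff] at *
  have hum : AEStronglyMeasurable u (volume.restrict (Set.uIoc a b)) :=
    (hu.mono Set.uIoc_subset_uIcc).aestronglyMeasurable measurableSet_uIoc
  refine Integrable.mono' (hM.norm.const_mul (‖B‖ * K))
    (B.aestronglyMeasurable_comp₂ hM.aestronglyMeasurable hum) ?_
  filter_upwards [ae_restrict_mem measurableSet_uIoc] with t ht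
  have h1 := B.le_opNorm₂ (M t) (u t)
  have h2 := hK t (Set.uIoc_subset_uIcc ht)
  calc _ ≤ _ := h1
    _ ≤ ‖B‖ * ‖M t‖ * K := by gcongr
    _ = _ := by ring

/-- Leibniz rule for locally absolutely continuous functions: the product and the primitive of the
expected derivative are absolutely continuous and have the same derivative almost everywhere. -/
lemma IsPrimitiveOn.bilin [CompleteSpace A] [CompleteSpace E] [CompleteSpace F]
    [hI : I.OrdConnected] (B : A →L[ℝ] E →L[ℝ] F)
    {M M' : ℝ → A} {u v : ℝ → E} (hM : IsPrimitiveOn I M M') (hu : IsPrimitiveOn I u v) :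
    IsPrimitiveOn I (fun t => B (M t) (u t)) (fun t => B (M' t) (u t) + B (M t) (v t)) := by
  intro a ha b hb
  have hs : Set.uIcc a b ⊆ I := hI.uIcc_subset ha hb
  have hcM := hM.continuousOn ha hb
  have hcu := hu.continuousOn ha hb
  have i1 := intervalIntegrable_bilin B (hM a ha b hb).1 hcu
  have i2 : IntervalIntegrable (fun t => B (M t) (v t)) volume a b :=
    intervalIntegrable_bilin B.flip (hu a ha b hb).1 hcM
  have i3 := i1.add i2
  refine ⟨i3, ?_⟩
  obtain ⟨K, hK⟩ := isCompact_uIcc.exists_bound_of_continuousOn hcM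
  obtain ⟨K', hK'⟩ := isCompact_uIcc.exists_bound_of_continuousOn hcu
  have hK0 : 0 ≤ K := (norm_nonneg _).trans (hK a Set.left_mem_uIcc)
  have hK0' : 0 ≤ K' := (norm_nonneg _).trans (hK' a Set.left_mem_uIcc)
  obtain ⟨g, hg, hgM⟩ := (hM.mono hs).exists_variation
  obtain ⟨h, hh, hhu⟩ := (hu.mono hs).exists_variation
  have ac1 : AbsolutelyContinuousOnInterval (fun t => B (M t) (u t)) a b := by
    refine absolutelyContinuousOnInterval_of_dist_le hg hh (C := ‖B‖ * (K + K')) ?_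
    intro x hx y hy
    have e : B (M x) (u x) - B (M y) (u y) = B (M x - M y) (u x) + B (M y) (u x - u y) := by
      simp
    rw [dist_eq_norm, e]
    have e1 := B.le_opNorm₂ (M x - M y) (u x)
    have e2 := B.le_opNorm₂ (M y) (u x - u y)
    rw [← dist_eq_norm] at e1 e2
    have e3 : ‖B‖ * dist (M x) (M y) * ‖u x‖ ≤ ‖B‖ * dist (g x) (g y) * K' := by
      gcongr
      · exact hgM x hx y hy
      · exact hK' x hx
    have e4 : ‖B‖ * ‖M y‖ * dist (u x) (u y) ≤ ‖B‖ * K * dist (h x) (h y) := by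
      gcongr
      · exact hK y hy
      · exact hhu x hx y hy
    have p1 : 0 ≤ ‖B‖ * dist (g x) (g y) * K := by positivity
    have p2 : 0 ≤ ‖B‖ * dist (h x) (h y) * K' := by positivity
    calc _ ≤ _ := norm_add_le _ _
      _ ≤ ‖B‖ * dist (g x) (g y) * K' + ‖B‖ * K * dist (h x) (h y) :=
        add_le_add (e1.trans e3) (e2.trans e4)
      _ ≤ _ := by linarith
  have prim : IsPrimitiveOn (Set.uIcc a b)
      (fun t => ∫ s in a..t, (B (M' s) (u s) + B (M s) (v s)))
      (fun s => B (M' s) (u s) + B (M s) (v s)) := by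
    intro x hx y hy
    have j : ∀ x ∈ Set.uIcc a b, IntervalIntegrable
        (fun s => B (M' s) (u s) + B (M s) (v s)) volume a x := fun x hx =>
      i3.mono_set (Set.uIcc_subset_uIcc Set.left_mem_uIcc hx)
    exact ⟨(j x hx).symm.trans (j y hy),
      intervalIntegral.integral_interval_sub_left (j y hy) (j x hx)⟩
  obtain ⟨k, hk, hkF⟩ := prim.exists_variation
  have ac2 := absolutelyContinuousOnInterval_of_dist_le hk hk (C := 1)
    (f := fun t => ∫ s in a..t, (B (M' s) (u s) + B (M s) (v s))) (fun x hx y hy => by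
      have := hkF x hx y hy
      have p := dist_nonneg (x := k x) (y := k y)
      linarith)
  have ac3 := ac1.sub ac2
  obtain ⟨c, hc⟩ := ac3.const_of_ae_hasDerivAt_zero (by
    have hMi := (hM a ha b hb).1.ae_hasDerivAt_integral
    have hui := (hu a ha b hb).1.ae_hasDerivAt_integral
    have hne : ∀ᵐ x : ℝ, x ∉ ({a, b} : Set ℝ) :=
      measure_eq_zero_iff_ae_notMem.1 ((Set.toFinite {a, b}).measure_zero _)
    filter_upwards [hMi, hui, i3.ae_hasDerivAt_integral, hne] with x h1 h2 h3 h4 hx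
    have hx1 := h1 hx a Set.left_mem_uIcc
    have hx2 := h2 hx a Set.left_mem_uIcc
    have hx3 := h3 hx a Set.left_mem_uIcc
    have hnb : Set.uIcc a b ∈ 𝓝 x := by
      simp only [Set.mem_insert_iff, Set.mem_singleton_iff, not_or] at h4
      rw [Set.uIcc, Set.mem_Icc] at hx
      refine Icc_mem_nhds (lt_of_le_of_ne hx.1 ?_) (lt_of_le_of_ne hx.2 ?_)
      · rcases min_choice a b with e | e <;> rw [e] <;> tauto
      · rcases max_choice a b with e | e <;> rw [e] <;> tauto
    have d1 : HasDerivAt M (M' x) x := by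
      refine (hx1.const_add (M a)).congr_of_eventuallyEq ?_
      filter_upwards [hnb] with y hy
      rw [← (hM a ha y (hs hy)).2]; abel
    have d2 : HasDerivAt u (v x) x := by
      refine (hx2.const_add (u a)).congr_of_eventuallyEq ?_
      filter_upwards [hnb] with y hy
      rw [← (hu a ha y (hs hy)).2]; abel
    have d3 := (B.hasFDerivAt_of_bilinear d1.hasFDerivAt d2.hasFDerivAt).hasDerivAt
    have d4 := d3.sub hx3
    convert d4 using 1
    simp [add_comm])
  have e1 := hc a Set.left_mem_uIcc
  have e2 := hc b Set.right_mem_uIcc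
  simp only [intervalIntegral.integral_same, sub_zero, Pi.sub_apply] at e1 e2
  simp only
  rw [e1, ← e2]
  abel

lemma isPrimitiveOn_of_contDiffOn [CompleteSpace E] [hI : I.OrdConnected]
    (hU : UniqueDiffOn ℝ I) {M : ℝ → E} (hM : ContDiffOn ℝ 1 M I) :
    IsPrimitiveOn I M (derivWithin M I) := by
  have hc : ContinuousOn (derivWithin M I) I := hM.continuousOn_derivWithin hU le_rfl
  intro a ha b hb
  have hs : Set.uIcc a b ⊆ I := hI.uIcc_subset ha hb
  have hint : IntervalIntegrable (derivWithin M I) volume a b := (hc.mono hs).intervalIntegrable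
  refine ⟨hint, ?_⟩
  symm
  refine intervalIntegral.integral_eq_sub_of_hasDeriv_right (hM.continuousOn.mono hs) ?_ hint
  intro x hx
  have hx' : Set.uIcc a b ∈ 𝓝 x := Icc_mem_nhds hx.1 hx.2
  have hxI : x ∈ I := hs ⟨hx.1.le, hx.2.le⟩
  have := ((hM.differentiableOn one_ne_zero) x hxI).hasDerivWithinAt
  exact (this.hasDerivAt (mem_of_superset hx' hs)).hasDerivWithinAt

/-- The derivative of a locally absolutely continuous function is unique. -/
lemma IsPrimitiveOn.ae_eq [CompleteSpace E] [hI : I.OrdConnected] {u v v' : ℝ → E}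
    (h : IsPrimitiveOn I u v) (h' : IsPrimitiveOn I u v') :
    v =ᵐ[volume.restrict I] v' := by
  have hmeas : MeasurableSet I := hI.measurableSet
  rw [EventuallyEq, ae_restrict_iff' hmeas]
  have hfr : ∀ᵐ x : ℝ, x ∉ frontier I :=
    measure_eq_zero_iff_ae_notMem.1 (hI.convex.addHaar_frontier volume)
  -- Rational end points suffice to cover the interior of `I`, and they are countable in number.
  have key : ∀ p q : ℚ, ∀ᵐ x : ℝ, (p : ℝ) ∈ I → (q : ℝ) ∈ I → x ∈ Set.Ioo (p : ℝ) q →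
      v x = v' x := by
    intro p q
    by_cases hp : (p : ℝ) ∈ I
    swap
    · exact Eventually.of_forall fun x h => absurd h hp
    by_cases hq : (q : ℝ) ∈ I
    swap
    · exact Eventually.of_forall fun x _ h => absurd h hq
    filter_upwards [(h p hp q hq).1.ae_hasDerivAt_integral,
      (h' p hp q hq).1.ae_hasDerivAt_integral] with x h1 h2 _ _ hx
    have hx' : x ∈ Set.uIcc (p : ℝ) q := Set.Icc_subset_uIcc ⟨hx.1.le, hx.2.le⟩
    refine (h1 hx' p Set.left_mem_uIcc).unique
      ((h2 hx' p Set.left_mem_uIcc).congr_of_eventuallyEq ?_)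
    filter_upwards [isOpen_Ioo.mem_nhds hx] with y hy
    have hy' : y ∈ I := hI.out hp hq ⟨hy.1.le, hy.2.le⟩
    rw [← (h p hp y hy').2, ← (h' p hp y hy').2]
  have key' : ∀ᵐ x : ℝ, ∀ p q : ℚ, (p : ℝ) ∈ I → (q : ℝ) ∈ I → x ∈ Set.Ioo (p : ℝ) q →
      v x = v' x := by
    rw [ae_all_iff]; intro p
    rw [ae_all_iff]; exact key p
  filter_upwards [key', hfr] with x hx hxf hxI
  have hxi : x ∈ interior I := by
    by_contra hcon
    exact hxf ⟨subset_closure hxI, hcon⟩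
  obtain ⟨l, r, hlr, hsub⟩ := mem_nhds_iff_exists_Ioo_subset.1 (mem_interior_iff_mem_nhds.1 hxi)
  obtain ⟨p, hp1, hp2⟩ := exists_rat_btwn hlr.1
  obtain ⟨q, hq1, hq2⟩ := exists_rat_btwn hlr.2
  exact hx p q (hsub ⟨hp1, hp2.trans hlr.2⟩) (hsub ⟨hlr.1.trans hq1, hq2⟩) ⟨hp2, hq1⟩

/-- Square integrable functions are integrable over compact subintervals. -/
lemma intervalIntegrable_of_memLp {G : Type*} [NormedAddCommGroup G] [hI : I.OrdConnected]
    {v : ℝ → G}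
    (hv : MemLp v 2 (volume.restrict I)) {a b : ℝ} (ha : a ∈ I) (hb : b ∈ I) :
    IntervalIntegrable v volume a b := by
  rw [intervalIntegrable_iff']
  have h1 : MemLp v 2 (volume.restrict (Set.uIcc a b)) :=
    hv.mono_measure (Measure.restrict_mono (hI.uIcc_subset ha hb) le_rfl)
  have hfin : IsFiniteMeasure (volume.restrict (Set.uIcc a b)) :=
    isFiniteMeasure_restrict.2 isCompact_uIcc.measure_lt_top.ne
  exact h1.integrable (by norm_num)

variable {ι : Type} [Fintype ι]

lemma IsW12.isPrimitiveOn [hI : I.OrdConnected] {u v : ℝ → EuclideanSpace ℝ ι}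
    (h : IsW12 I u v) : IsPrimitiveOn I u v :=
  fun a ha b hb => ⟨intervalIntegrable_of_memLp h.2.1 ha hb, h.2.2 a ha b hb⟩

lemma IsPrimitiveOn.isW12 {u v : ℝ → EuclideanSpace ℝ ι} (h : IsPrimitiveOn I u v)
    (hu : MemLp u 2 (volume.restrict I)) (hv : MemLp v 2 (volume.restrict I)) : IsW12 I u v :=
  ⟨hu, hv, fun a ha b hb => (h a ha b hb).2⟩

end Primitive

/-! ### Scalar equations on the line -/

section ExpConv

variable {E F : Type*} [NormedAddCommGroup E] [NormedSpace ℝ E] [NormedAddCommGroup F]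
  [NormedSpace ℝ F]

/-- Cauchy–Schwarz inequality with the weight `k`. -/
lemma lintegral_mul_sq_le {α : Type*} [MeasurableSpace α] (μ : Measure α) {k g : α → ENNReal}
    (hk : AEMeasurable k μ) (hg : AEMeasurable g μ) :
    (∫⁻ a, k a * g a ∂μ) ^ 2 ≤ (∫⁻ a, k a ∂μ) * ∫⁻ a, k a * g a ^ 2 ∂μ := by
  have e : ∀ x : ENNReal, (x ^ (1 / 2 : ℝ)) ^ (2 : ℝ) = x := fun x => by
    rw [← ENNReal.rpow_mul]; norm_num
  have h := ENNReal.lintegral_mul_le_Lp_mul_Lq μ Real.HolderConjugate.two_two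
    (hk.pow_const (1 / 2 : ℝ)) ((hk.pow_const (1 / 2 : ℝ)).mul hg)
  have e1 : ∀ a, ((fun a => k a ^ (1 / 2 : ℝ)) * ((fun a => k a ^ (1 / 2 : ℝ)) * g)) a
      = k a * g a := fun a => by
    have := e (k a)
    rw [ENNReal.rpow_two, sq] at this
    simp only [Pi.mul_apply, ← mul_assoc, this]
  have e2 : ∀ a, (((fun a => k a ^ (1 / 2 : ℝ)) * g) a) ^ (2 : ℝ) = k a * g a ^ 2 := fun a => by
    simp only [Pi.mul_apply]
    rw [ENNReal.mul_rpow_of_nonneg _ _ (by norm_num), e, ENNReal.rpow_two]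
  simp only [e1, e2, e] at h
  calc _ ≤ _ := pow_le_pow_left' h 2
    _ = _ := by
      rw [mul_pow, ← ENNReal.rpow_two, ← ENNReal.rpow_two, e, e]

/-- The convolution of `h` with the causal kernel `t ↦ exp (-l t)`, `t ≥ 0`. -/
noncomputable def expConv (l : ℝ) (h : ℝ → E) (t : ℝ) : E :=
  ∫ s in Set.Iic t, Real.exp (-(l * (t - s))) • h s

lemma integrableOn_exp_smul {l : ℝ} (hl : 0 < l) {h : ℝ → E} (hh : MemLp h 2 volume) (t : ℝ) :
    IntegrableOn (fun s => Real.exp (l * s) • h s) (Set.Iic t) := by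
  have h1 : MemLp (fun s => Real.exp (l * s)) 2 (volume.restrict (Set.Iic t)) := by
    rw [memLp_two_iff_integrable_sq (by fun_prop)]
    refine (integrableOn_exp_mul_Iic (a := 2 * l) (by positivity) t).congr
      (Eventually.of_forall fun s => ?_)
    simp only
    rw [← Real.exp_nat_mul]
    congr 1
    push_cast; ring
  exact memLp_one_iff_integrable.1 ((hh.mono_measure Measure.restrict_le_self).smul h1)

lemma expConv_eq (l : ℝ) (h : ℝ → E) (t : ℝ) :
    expConv l h t = Real.exp (-l * t) • ∫ s in Set.Iic t, Real.exp (l * s) • h s := by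
  rw [expConv, ← integral_smul]
  congr 1
  funext s
  rw [smul_smul, ← Real.exp_add]
  congr 2
  ring

lemma integrableOn_expConv {l : ℝ} (hl : 0 < l) {h : ℝ → E} (hh : MemLp h 2 volume) (t : ℝ) :
    IntegrableOn (fun s => Real.exp (-(l * (t - s))) • h s) (Set.Iic t) := by
  refine ((integrableOn_exp_smul hl hh t).smul (Real.exp (-l * t))).congr
    (Eventually.of_forall fun s => ?_)
  simp only [Pi.smul_apply]
  rw [smul_smul, ← Real.exp_add]
  congr 2
  ring

/-- `y = expConv l h` solves `y' = -l y + h`. -/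
lemma isPrimitiveOn_expConv [CompleteSpace E] {l : ℝ} (hl : 0 < l) {h : ℝ → E}
    (hh : MemLp h 2 volume) :
    IsPrimitiveOn Set.univ (expConv l h) (fun t => (-l) • expConv l h t + h t) := by
  have h1 : IsPrimitiveOn Set.univ (fun t => ∫ s in Set.Iic t, Real.exp (l * s) • h s)
      (fun t => Real.exp (l * t) • h t) := by
    intro a _ b _
    refine ⟨?_, intervalIntegral.integral_Iic_sub_Iic (integrableOn_exp_smul hl hh a)
      (integrableOn_exp_smul hl hh b)⟩
    rw [intervalIntegrable_iff]
    exact (integrableOn_exp_smul hl hh (max a b)).mono_set fun x hx => hx.2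
  have h2 : IsPrimitiveOn Set.univ (fun t => Real.exp (-l * t))
      (fun t => -l * Real.exp (-l * t)) := by
    intro a _ b _
    have hc : Continuous fun t : ℝ => -l * Real.exp (-l * t) := by fun_prop
    refine ⟨hc.intervalIntegrable _ _, ?_⟩
    symm
    refine intervalIntegral.integral_eq_sub_of_hasDerivAt (f := fun t => Real.exp (-l * t))
      (fun x _ => ?_) (hc.intervalIntegrable _ _)
    have := ((hasDerivAt_id x).const_mul (-l)).exp
    simpa [mul_comm] using this
  have h3 := h2.bilin (ContinuousLinearMap.lsmul ℝ ℝ (E := E)) h1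
  refine h3.congr (fun t _ => ?_) (fun t _ => ?_)
  · rw [expConv_eq]; simp
  · rw [expConv_eq]
    simp only [ContinuousLinearMap.lsmul_apply, smul_smul, ← Real.exp_add]
    rw [show -l * t + l * t = 0 by ring, Real.exp_zero, one_smul]

lemma clm_expConv [CompleteSpace E] [CompleteSpace F] {l : ℝ} (hl : 0 < l) {h : ℝ → E}
    (hh : MemLp h 2 volume) (T : E →L[ℝ] F) (t : ℝ) :
    T (expConv l h t) = expConv l (fun s => T (h s)) t := by
  rw [expConv, ← T.integral_comp_comm (integrableOn_expConv hl hh t)]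
  simp [expConv]

lemma expConv_eq_zero (l : ℝ) {h : ℝ → E} {t : ℝ} (hh : ∀ s < t, h s = 0) :
    expConv l h t = 0 := by
  rw [expConv, integral_Iic_eq_integral_Iio]
  exact setIntegral_eq_zero_of_forall_eq_zero fun s hs => by rw [hh s hs, smul_zero]

/-- The causal exponential kernel, as a function with values in `[0, ∞]`. -/
noncomputable def expKernel (l : ℝ) : ℝ → ENNReal :=
  (Set.Ici 0).indicator fun r => ENNReal.ofReal (Real.exp (-l * r))

lemma measurable_expKernel (l : ℝ) : Measurable (expKernel l) :=
  Measurable.indicator (by fun_prop) measurableSet_Ici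

lemma lintegral_expKernel {l : ℝ} (hl : 0 < l) : ∫⁻ r, expKernel l r = ENNReal.ofReal (1 / l) := by
  rw [expKernel, lintegral_indicator measurableSet_Ici, setLIntegral_congr Ioi_ae_eq_Ici.symm,
    ← ofReal_integral_eq_lintegral_ofReal (integrableOn_exp_mul_Ioi (by linarith) 0)
      (Eventually.of_forall fun r => (Real.exp_pos _).le),
    integral_exp_mul_Ioi (by linarith) 0]
  congr 1
  simp [neg_div_neg_eq]

/-- Young's inequality for the convolution with the causal exponential kernel. -/
lemma eLpNorm_expConv_le [CompleteSpace E] {l : ℝ} (hl : 0 < l) {h : ℝ → E}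
    (hh : MemLp h 2 volume) :
    eLpNorm (expConv l h) 2 volume ≤ ENNReal.ofReal (1 / l) * eLpNorm h 2 volume := by
  have hhm : AEMeasurable (fun s => ‖h s‖ₑ) := hh.1.enorm
  have hkm : ∀ t, AEMeasurable (fun s => expKernel l (t - s)) := fun t =>
    ((measurable_expKernel l).comp (by fun_prop)).aemeasurable
  have hpt : ∀ t, ‖expConv l h t‖ₑ ≤ ∫⁻ s, expKernel l (t - s) * ‖h s‖ₑ := by
    intro t
    refine (enorm_integral_le_lintegral_enorm _).trans ?_
    rw [← lintegral_indicator measurableSet_Iic]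
    refine lintegral_mono fun s => ?_
    by_cases hs : s ≤ t
    · rw [Set.indicator_of_mem (by exact hs), expKernel,
        Set.indicator_of_mem (by simpa using hs), enorm_smul]
      gcongr
      rw [Real.enorm_eq_ofReal (Real.exp_pos _).le, neg_mul]
    · rw [Set.indicator_of_notMem (by exact hs)]
      exact zero_le
  have hsq : ∀ t, ‖expConv l h t‖ₑ ^ 2 ≤
      ENNReal.ofReal (1 / l) * ∫⁻ s, expKernel l (t - s) * ‖h s‖ₑ ^ 2 := by
    intro t
    refine (pow_le_pow_left' (hpt t) 2).trans ?_
    refine (lintegral_mul_sq_le volume (hkm t) hhm).trans ?_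
    rw [lintegral_sub_left_eq_self (expKernel l) t, lintegral_expKernel hl]
  have hint : ∫⁻ t, ‖expConv l h t‖ₑ ^ 2 ≤
      ENNReal.ofReal (1 / l) ^ 2 * ∫⁻ s, ‖h s‖ₑ ^ 2 := by
    refine (lintegral_mono hsq).trans ?_
    rw [lintegral_const_mul' _ _ ENNReal.ofReal_ne_top, lintegral_lintegral_swap]
    · have : ∀ s, ∫⁻ t, expKernel l (t - s) * ‖h s‖ₑ ^ 2 =
          ENNReal.ofReal (1 / l) * ‖h s‖ₑ ^ 2 := by
        intro s
        rw [lintegral_mul_const' _ _ (by simp),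
          lintegral_sub_right_eq_self (expKernel l) s, lintegral_expKernel hl]
      simp only [this]
      rw [lintegral_const_mul' _ _ ENNReal.ofReal_ne_top, ← mul_assoc, ← sq]
    · refine AEMeasurable.mul ?_ ?_
      · exact ((measurable_expKernel l).comp (by fun_prop)).aemeasurable
      · exact (hhm.pow_const 2).comp_snd
  have e : ∀ f : ℝ → E, eLpNorm f 2 volume = (∫⁻ t, ‖f t‖ₑ ^ 2) ^ (1 / 2 : ℝ) := by
    intro f
    rw [eLpNorm_eq_lintegral_rpow_enorm_toReal (by norm_num) (by norm_num)]
    simp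
  rw [e, e]
  refine (ENNReal.rpow_le_rpow hint (by norm_num)).trans ?_
  rw [ENNReal.mul_rpow_of_nonneg _ _ (by norm_num), ← ENNReal.rpow_two, ← ENNReal.rpow_mul]
  norm_num

lemma memLp_expConv [CompleteSpace E] {l : ℝ} (hl : 0 < l) {h : ℝ → E}
    (hh : MemLp h 2 volume) : MemLp (expConv l h) 2 volume :=
  ⟨(isPrimitiveOn_expConv hl hh).continuous.aestronglyMeasurable,
    (eLpNorm_expConv_le hl hh).trans_lt (ENNReal.mul_lt_top ENNReal.ofReal_lt_top hh.2)⟩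

lemma memLp_comp_neg {G : Type*} [NormedAddCommGroup G] {h : ℝ → G} (hh : MemLp h 2 volume) :
    MemLp (fun t => h (-t)) 2 volume :=
  hh.comp_measurePreserving (Measure.measurePreserving_neg volume)

lemma eLpNorm_comp_neg {G : Type*} [NormedAddCommGroup G] {h : ℝ → G} (hh : MemLp h 2 volume) :
    eLpNorm (fun t => h (-t)) 2 volume = eLpNorm h 2 volume :=
  eLpNorm_comp_measurePreserving hh.1 (Measure.measurePreserving_neg volume)

/-- The equation `y' = c y + h` with `c ≠ 0` has a solution in `L²(ℝ)` with `‖y‖ ≤ ‖h‖ / |c|`,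
obtained by a convolution which commutes with linear maps and which only uses the values of
`h` on one side. -/
lemma exists_scalar_solution [CompleteSpace E] {c : ℝ} (hc : c ≠ 0) {h : ℝ → E}
    (hh : MemLp h 2 volume) :
    ∃ y : ℝ → E, MemLp y 2 volume ∧
      eLpNorm y 2 volume ≤ ENNReal.ofReal (1 / |c|) * eLpNorm h 2 volume ∧
      IsPrimitiveOn Set.univ y (fun t => c • y t + h t) ∧
      (∀ T : E →L[ℝ] E, (∀ s, T (h s) = 0) → ∀ t, T (y t) = 0) ∧
      (c < 0 → (∀ s < 0, h s = 0) → y 0 = 0) ∧ (0 < c → (∀ s > 0, h s = 0) → y 0 = 0) := by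
  rcases lt_or_gt_of_ne hc with hc | hc
  · have hl : 0 < -c := by linarith
    refine ⟨expConv (-c) h, memLp_expConv hl hh, ?_, ?_, ?_, fun _ => expConv_eq_zero _,
      fun h => absurd h (by linarith)⟩
    · rw [abs_of_neg hc]; exact eLpNorm_expConv_le hl hh
    · simpa using isPrimitiveOn_expConv hl hh
    · intro T hT t
      rw [clm_expConv hl hh T t]
      exact expConv_eq_zero _ fun s _ => hT s
  · have hh' : MemLp (fun s => -h (-s)) 2 volume := (memLp_comp_neg hh).neg
    refine ⟨fun t => expConv c (fun s => -h (-s)) (-t), memLp_comp_neg (memLp_expConv hc hh'),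
      ?_, ?_, ?_, fun h => absurd h (by linarith), fun _ h0 => ?_⟩
    · rw [abs_of_pos hc, eLpNorm_comp_neg (memLp_expConv hc hh')]
      refine (eLpNorm_expConv_le hc hh').trans_eq ?_
      congr 1
      rw [← eLpNorm_comp_neg hh]
      exact eLpNorm_neg (fun t => h (-t)) 2 volume
    · refine (isPrimitiveOn_expConv hc hh').comp_neg.congr (fun t _ => rfl) (fun t _ => ?_)
      simp [add_comm]
    · intro T hT t
      rw [clm_expConv hc hh' T]
      exact expConv_eq_zero _ fun s _ => by rw [map_neg, hT, neg_zero]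
    · simp only [neg_zero]
      exact expConv_eq_zero _ fun s hs => by rw [h0 _ (by linarith), neg_zero]

/-- The complex version of `exists_scalar_solution`, obtained from it by the modulation
`y ↦ exp (i Im μ t) y`. -/
lemma exists_complex_scalar_solution {E : Type*} [NormedAddCommGroup E] [NormedSpace ℂ E]
    [CompleteSpace E] {μ : ℂ} (hμ : μ.re ≠ 0) {h : ℝ → E} (hh : MemLp h 2 volume) :
    ∃ y : ℝ → E, MemLp y 2 volume ∧
      eLpNorm y 2 volume ≤ ENNReal.ofReal (1 / |μ.re|) * eLpNorm h 2 volume ∧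
      IsPrimitiveOn Set.univ y (fun t => μ • y t + h t) ∧
      (∀ T : E →L[ℂ] E, (∀ s, T (h s) = 0) → ∀ t, T (y t) = 0) := by
  let m : ℝ → ℝ → ℂ := fun β t => Complex.exp ((β * t : ℝ) * Complex.I)
  have hm : ∀ β t, ‖m β t‖ = 1 := fun β t => Complex.norm_exp_ofReal_mul_I _
  have hmc : ∀ β, Continuous (m β) := fun β => by fun_prop
  have hmem : ∀ β, ∀ g : ℝ → E, MemLp g 2 volume → MemLp (fun t => m β t • g t) 2 volume := by
    intro β g hg
    refine hg.of_le ((hmc β).aestronglyMeasurable.smul hg.1) (Eventually.of_forall fun t => ?_)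
    rw [norm_smul, hm, one_mul]
  have hnorm : ∀ β, ∀ g : ℝ → E,
      eLpNorm (fun t => m β t • g t) 2 volume = eLpNorm g 2 volume := by
    intro β g
    refine eLpNorm_congr_norm_ae (Eventually.of_forall fun t => ?_)
    rw [norm_smul, hm, one_mul]
  have hmm : ∀ t, m μ.im t * m (-μ.im) t = 1 := by
    intro t
    simp only [m]
    rw [← Complex.exp_add, ← add_mul]
    simp
  obtain ⟨y, hy, hyn, hyp, hyT, -, -⟩ := exists_scalar_solution hμ (hmem (-μ.im) h hh)
  refine ⟨fun t => m μ.im t • y t, hmem _ _ hy, ?_, ?_, ?_⟩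
  · rw [hnorm]
    refine hyn.trans_eq ?_
    rw [hnorm]
  · have h2 : IsPrimitiveOn Set.univ (m μ.im) (fun t => (μ.im * Complex.I) * m μ.im t) := by
      intro a _ b _
      have hcc : Continuous fun t : ℝ => (μ.im * Complex.I) * m μ.im t :=
        continuous_const.mul (hmc _)
      refine ⟨hcc.intervalIntegrable _ _, ?_⟩
      symm
      refine intervalIntegral.integral_eq_sub_of_hasDerivAt (f := m μ.im) (fun x _ => ?_)
        (hcc.intervalIntegrable _ _)
      have h3 : HasDerivAt (fun t : ℝ => ((μ.im * t : ℝ) : ℂ) * Complex.I)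
          (μ.im * Complex.I) x := by
        have := (((hasDerivAt_id x).const_mul μ.im).ofReal_comp).mul_const Complex.I
        simpa using this
      have h4 := h3.cexp
      rw [mul_comm] at h4
      exact h4
    have h3 := h2.bilin (ContinuousLinearMap.lsmul ℝ ℂ (E := E)) hyp
    refine h3.congr (fun t _ => rfl) (fun t _ => ?_)
    simp only [ContinuousLinearMap.lsmul_apply, smul_add, smul_smul, hmm, one_smul]
    rw [← add_assoc]
    congr 1
    rw [← Complex.coe_smul, smul_smul, ← add_smul]
    congr 1
    linear_combination m μ.im t * Complex.re_add_im μ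
  · intro T hT t
    rw [map_smul]
    have := hyT (T.restrictScalars ℝ) (fun s => by simp [hT]) t
    simp only [ContinuousLinearMap.coe_restrictScalars'] at this
    rw [this, smul_zero]

end ExpConv

/-! ### Hyperbolic systems with constant coefficients -/

section ConstantCoefficients

/-- Constant coefficient systems `z' = S z + h` on the line: if a polynomial in `S` whose roots
lie off the imaginary axis kills the values of `h`, then there is a solution in `L²`. The roots
are removed one after the other, by solving the scalar equations `y' = μ y + h`. -/
lemma exists_solution_of_aeval_eq_zero {E : Type*} [NormedAddCommGroup E] [NormedSpace ℂ E]
    [CompleteSpace E] (S : E →L[ℂ] E) (s : Multiset ℂ) (hs : ∀ μ ∈ s, μ.re ≠ 0) :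
    ∃ K : ℝ, 0 ≤ K ∧ ∀ h : ℝ → E, MemLp h 2 volume →
      (∀ t, Polynomial.aeval S (s.map fun μ => Polynomial.X - Polynomial.C μ).prod (h t) = 0) →
      ∃ z : ℝ → E, MemLp z 2 volume ∧ eLpNorm z 2 volume ≤ ENNReal.ofReal K * eLpNorm h 2 volume ∧
        IsPrimitiveOn Set.univ z (fun t => S (z t) + h t) := by
  induction s using Multiset.induction_on with
  | empty =>
    refine ⟨0, le_rfl, fun h _ h0 => ⟨fun _ => 0, MemLp.zero, ?_, ?_⟩⟩
    · have : (fun _ : ℝ => (0 : E)) = 0 := rfl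
      rw [this, eLpNorm_zero]; exact zero_le
    · have h0' : ∀ t, h t = 0 := by
        intro t
        have := h0 t
        rw [Multiset.map_zero, Multiset.prod_zero, map_one] at this
        exact this
      intro a _ b _
      simp [h0']
  | cons μ s ih =>
    obtain ⟨K, hK, hsol⟩ := ih fun ν hν => hs ν (Multiset.mem_cons_of_mem hν)
    have hμ := hs μ (Multiset.mem_cons_self μ s)
    let T : E →L[ℂ] E := S - μ • ContinuousLinearMap.id ℂ E
    have hT : Polynomial.aeval S (Polynomial.X - Polynomial.C μ) = T := by
      rw [map_sub, Polynomial.aeval_X, Polynomial.aeval_C, Algebra.algebraMap_eq_smul_one]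
      rfl
    refine ⟨1 / |μ.re| + K * ‖T‖ * (1 / |μ.re|), by positivity, fun h hh h0 => ?_⟩
    -- With `y' = μ y + h`, the difference `z - y` solves the system with right-hand side
    -- `(S - μ) y`, whose values are killed by the product over the remaining roots.
    obtain ⟨y, hy, hyn, hyp, hyT⟩ := exists_complex_scalar_solution hμ hh
    have hTy : MemLp (fun t => T (y t)) 2 volume := T.comp_memLp' hy
    have hTn : eLpNorm (fun t => T (y t)) 2 volume ≤ ENNReal.ofReal ‖T‖ * eLpNorm y 2 volume :=
      eLpNorm_le_mul_eLpNorm_of_ae_le_mul (Eventually.of_forall fun t => T.le_opNorm _) 2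
    obtain ⟨z, hz, hzn, hzp⟩ := hsol _ hTy (fun t => by
      refine hyT ((Polynomial.aeval S
        (s.map fun μ => Polynomial.X - Polynomial.C μ).prod).comp T) (fun t => ?_) t
      have := h0 t
      rw [Multiset.map_cons, Multiset.prod_cons, mul_comm, map_mul, hT] at this
      exact this)
    refine ⟨fun t => y t + z t, hy.add hz, ?_, ?_⟩
    · calc eLpNorm (fun t => y t + z t) 2 volume
          ≤ eLpNorm y 2 volume + eLpNorm z 2 volume := eLpNorm_add_le hy.1 hz.1 (by norm_num)
        _ ≤ eLpNorm y 2 volume + ENNReal.ofReal K * (ENNReal.ofReal ‖T‖ * eLpNorm y 2 volume) := by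
          gcongr
          exact hzn.trans (by gcongr)
        _ = (1 + ENNReal.ofReal K * ENNReal.ofReal ‖T‖) * eLpNorm y 2 volume := by ring
        _ ≤ (1 + ENNReal.ofReal K * ENNReal.ofReal ‖T‖) *
            (ENNReal.ofReal (1 / |μ.re|) * eLpNorm h 2 volume) := by gcongr
        _ = _ := by
          rw [ENNReal.ofReal_add (by positivity) (by positivity),
            ENNReal.ofReal_mul (by positivity), ENNReal.ofReal_mul (by positivity)]
          ring
    · refine (hyp.add hzp).congr (fun t _ => rfl) (fun t _ => ?_)
      simp only [T, map_add, sub_apply, smul_apply,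
        ContinuousLinearMap.id_apply]
      abel

variable {ι : Type} [Fintype ι]

/-- The componentwise inclusion of `ℝ^ι` in `ℂ^ι`. -/
noncomputable def complexify : EuclideanSpace ℝ ι →L[ℝ] EuclideanSpace ℂ ι :=
  LinearMap.toContinuousLinearMap
    { toFun := fun v => WithLp.toLp 2 fun i => (v i : ℂ)
      map_add' := fun v w => by ext i; simp
      map_smul' := fun c v => by ext i; simp }

/-- The componentwise real part from `ℂ^ι` to `ℝ^ι`. -/
noncomputable def realPart : EuclideanSpace ℂ ι →L[ℝ] EuclideanSpace ℝ ι :=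
  LinearMap.toContinuousLinearMap
    { toFun := fun v => WithLp.toLp 2 fun i => (v i).re
      map_add' := fun v w => by ext i; simp
      map_smul' := fun c v => by ext i; simp }

lemma complexify_apply (v : EuclideanSpace ℝ ι) (i : ι) : complexify v i = (v i : ℂ) := rfl

lemma realPart_apply (v : EuclideanSpace ℂ ι) (i : ι) : realPart v i = (v i).re := rfl

lemma memLp_indicator_of_restrict {G : Type*} [NormedAddCommGroup G] {J : Set ℝ}
    [hJ : J.OrdConnected] {h : ℝ → G} (hh : MemLp h 2 (volume.restrict J)) :
    MemLp (J.indicator h) 2 volume :=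
  (memLp_indicator_iff_restrict hJ.measurableSet).2 hh

lemma realPart_complexify (v : EuclideanSpace ℝ ι) : realPart (complexify v) = v := by
  ext i
  simp [realPart_apply, complexify_apply]

lemma norm_complexify (v : EuclideanSpace ℝ ι) : ‖complexify v‖ = ‖v‖ := by
  simp [EuclideanSpace.norm_eq, complexify_apply]

lemma norm_realPart_le (v : EuclideanSpace ℂ ι) : ‖realPart v‖ ≤ ‖v‖ := by
  rw [EuclideanSpace.norm_eq, EuclideanSpace.norm_eq]
  refine Real.sqrt_le_sqrt (Finset.sum_le_sum fun i _ => ?_)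
  rw [realPart_apply]
  exact pow_le_pow_left₀ (norm_nonneg _) (Complex.abs_re_le_norm _) 2

lemma memLp_complexify {h : ℝ → EuclideanSpace ℝ ι} (hh : MemLp h 2 volume) :
    MemLp (fun t => complexify (h t)) 2 volume :=
  hh.of_le (complexify.continuous.comp_aestronglyMeasurable hh.1)
    (Eventually.of_forall fun t => (norm_complexify (h t)).le)

lemma memLp_realPart {h : ℝ → EuclideanSpace ℂ ι} (hh : MemLp h 2 volume) :
    MemLp (fun t => realPart (h t)) 2 volume :=
  hh.of_le (realPart.continuous.comp_aestronglyMeasurable hh.1)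
    (Eventually.of_forall fun t => norm_realPart_le (h t))

/-- The scalar equation on an interval. On a half-line, the solution vanishes at the finite end if
`c` has the right sign, since the convolution sees no values of `h` beyond this end. -/
lemma exists_solution_smul {c : ℝ} (hc : c ≠ 0) (J : Set ℝ) [hJ : J.OrdConnected]
    {h : ℝ → EuclideanSpace ℝ ι} (hh : MemLp h 2 (volume.restrict J)) :
    ∃ z, IsW12 J z (fun t => c • z t + h t) ∧
      eLpNorm z 2 (volume.restrict J) ≤
        ENNReal.ofReal (1 / |c|) * eLpNorm h 2 (volume.restrict J) ∧
      (c < 0 → J ⊆ Set.Ici 0 → z 0 = 0) ∧ (0 < c → J ⊆ Set.Iic 0 → z 0 = 0) := by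
  have hJm : MeasurableSet J := hJ.measurableSet
  have hg : MemLp (J.indicator h) 2 volume := memLp_indicator_of_restrict hh
  obtain ⟨z, hz, hzn, hzp, -, h1, h2⟩ := exists_scalar_solution hc hg
  have hz' : MemLp z 2 (volume.restrict J) := hz.mono_measure Measure.restrict_le_self
  refine ⟨z, IsPrimitiveOn.isW12 ?_ hz' ((hz'.const_smul c).add hh), ?_, ?_, ?_⟩
  · refine (hzp.mono (Set.subset_univ J)).congr (fun t _ => rfl) fun t ht => ?_
    rw [Set.indicator_of_mem ht]
  · rw [← eLpNorm_indicator_eq_eLpNorm_restrict hJm (f := h)]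
    exact (eLpNorm_mono_measure _ Measure.restrict_le_self).trans hzn
  · intro hc hJ0
    exact h1 hc fun s hs => Set.indicator_of_notMem (fun h => not_le.2 hs (hJ0 h)) _
  · intro hc hJ0
    exact h2 hc fun s hs => Set.indicator_of_notMem (fun h => not_le.2 hs (hJ0 h)) _

variable [DecidableEq ι]

lemma realPart_toEuclideanCLM (M : Matrix ι ι ℝ) (v : EuclideanSpace ℂ ι) :
    realPart (Matrix.toEuclideanCLM (𝕜 := ℂ) (M.map (algebraMap ℝ ℂ)) v) =
      Matrix.toEuclideanCLM (𝕜 := ℝ) M (realPart v) := by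
  ext i
  rw [realPart_apply, Matrix.ofLp_toEuclideanCLM, Matrix.ofLp_toEuclideanCLM]
  simp [Matrix.mulVec, dotProduct, realPart_apply]

/-- A hyperbolic system with constant coefficients has a bounded right inverse in `L²`, on any
interval and with a bound independent of the interval. -/
lemma exists_solution_of_isHyperbolic {M : Matrix ι ι ℝ} (hM : IsHyperbolic M) :
    ∃ C : ℝ, 0 ≤ C ∧ ∀ (J : Set ℝ) [J.OrdConnected] (h : ℝ → EuclideanSpace ℝ ι),
      MemLp h 2 (volume.restrict J) →
      ∃ z, IsW12 J z (fun t => Matrix.toEuclideanCLM (𝕜 := ℝ) M (z t) + h t) ∧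
        eLpNorm z 2 (volume.restrict J) ≤
          ENNReal.ofReal C * eLpNorm h 2 (volume.restrict J) := by
  set Mc : Matrix ι ι ℂ := M.map (algebraMap ℝ ℂ) with hMc
  set S := Matrix.toEuclideanCLM (𝕜 := ℂ) Mc with hS
  have hroots : ∀ μ ∈ Mc.charpoly.roots, μ.re ≠ 0 := fun μ hμ =>
    hM μ (Matrix.mem_spectrum_of_isRoot_charpoly (Polynomial.isRoot_of_mem_roots hμ))
  have hprod : (Mc.charpoly.roots.map fun μ => Polynomial.X - Polynomial.C μ).prod =
      Mc.charpoly :=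
    ((IsAlgClosed.splits _).eq_prod_roots_of_monic (Matrix.charpoly_monic _)).symm
  have hCH : Polynomial.aeval S Mc.charpoly = 0 := by
    have := Polynomial.aeval_algHom_apply
      (Matrix.toEuclideanCLM (n := ι) (𝕜 := ℂ)).toAlgEquiv.toAlgHom Mc Mc.charpoly
    rw [Matrix.aeval_self_charpoly, map_zero] at this
    exact this
  obtain ⟨C, hC, hsol⟩ := exists_solution_of_aeval_eq_zero S _ hroots
  refine ⟨C, hC, fun J hJ h hh => ?_⟩
  have hJm : MeasurableSet J := hJ.measurableSet
  have hg : MemLp (J.indicator h) 2 volume := memLp_indicator_of_restrict hh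
  have hg' : MemLp (fun t => complexify (J.indicator h t)) 2 volume :=
    memLp_complexify hg
  obtain ⟨z, hz, hzn, hzp⟩ := hsol _ hg' (fun t => by rw [hprod, hCH]; rfl)
  have hgn : eLpNorm (fun t => complexify (J.indicator h t)) 2 volume =
      eLpNorm h 2 (volume.restrict J) := by
    rw [← eLpNorm_indicator_eq_eLpNorm_restrict hJm]
    exact eLpNorm_congr_norm_ae (Eventually.of_forall fun t => norm_complexify _)
  have hrz : MemLp (fun t => realPart (z t)) 2 (volume.restrict J) :=
    (memLp_realPart hz).mono_measure Measure.restrict_le_self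
  have hprim : IsPrimitiveOn J (fun t => realPart (z t))
      (fun t => Matrix.toEuclideanCLM (𝕜 := ℝ) M (realPart (z t)) + h t) := by
    refine ((hzp.clm realPart).mono (Set.subset_univ J)).congr (fun t _ => rfl) fun t ht => ?_
    rw [map_add, hS, realPart_toEuclideanCLM, Set.indicator_of_mem ht, realPart_complexify]
  refine ⟨fun t => realPart (z t), hprim.isW12 hrz
    (((Matrix.toEuclideanCLM (𝕜 := ℝ) M).comp_memLp' hrz).add hh), ?_⟩
  calc eLpNorm (fun t => realPart (z t)) 2 (volume.restrict J)
      ≤ eLpNorm (fun t => realPart (z t)) 2 volume :=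
        eLpNorm_mono_measure _ Measure.restrict_le_self
    _ ≤ eLpNorm z 2 volume :=
      eLpNorm_mono_ae (Eventually.of_forall fun t => norm_realPart_le _)
    _ ≤ _ := by rw [← hgn]; exact hzn

end ConstantCoefficients

/-! ### Closedness and kernel of first order systems -/

section Evolution

variable {ι : Type} [Fintype ι]

lemma IsPrimitiveOn.congr_ae {E : Type*} [NormedAddCommGroup E] [NormedSpace ℝ E] {I : Set ℝ}
    [hI : I.OrdConnected] {u v v' : ℝ → E} (h : IsPrimitiveOn I u v)
    (hv : v =ᵐ[volume.restrict I] v') : IsPrimitiveOn I u v' := by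
  intro a ha b hb
  have hs : Set.uIoc a b ⊆ I := Set.uIoc_subset_uIcc.trans (hI.uIcc_subset ha hb)
  have h' : v =ᵐ[volume.restrict (Set.uIoc a b)] v' :=
    hv.filter_mono (ae_mono (Measure.restrict_mono hs le_rfl))
  obtain ⟨h1, h2⟩ := h a ha b hb
  exact ⟨h1.congr_ae h', by rw [h2, intervalIntegral.integral_congr_ae_restrict h']⟩

/-- Primitives on two intervals with a common point are primitives on the union. -/
lemma IsPrimitiveOn.union {E : Type*} [NormedAddCommGroup E] [NormedSpace ℝ E] {I J K : Set ℝ}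
    {u v : ℝ → E} (hJ : IsPrimitiveOn J u v) (hK : IsPrimitiveOn K u v) {c : ℝ} (hcJ : c ∈ J)
    (hcK : c ∈ K) (hI : I ⊆ J ∪ K) : IsPrimitiveOn I u v := by
  have key : ∀ a ∈ I, IntervalIntegrable v volume a c ∧ u c - u a = ∫ s in a..c, v s := by
    intro a ha
    rcases hI ha with h | h
    · exact hJ a h c hcJ
    · exact hK a h c hcK
  intro a ha b hb
  obtain ⟨h1, h2⟩ := key a ha
  obtain ⟨h3, h4⟩ := key b hb
  refine ⟨h1.trans h3.symm, ?_⟩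
  rw [← intervalIntegral.integral_add_adjacent_intervals h1 h3.symm, ← h2,
    intervalIntegral.integral_symm, ← h4]
  abel

/-- Cauchy–Schwarz inequality for the integral over a compact subinterval. -/
lemma norm_intervalIntegral_le {E : Type*} [NormedAddCommGroup E] [NormedSpace ℝ E] {I : Set ℝ}
    [hI : I.OrdConnected] {v : ℝ → E} (hv : MemLp v 2 (volume.restrict I)) {a b : ℝ}
    (ha : a ∈ I) (hb : b ∈ I) :
    ‖∫ s in a..b, v s‖ ≤
      (eLpNorm v 2 (volume.restrict I)).toReal * (volume (Set.uIoc a b)).toReal ^ (1 / 2 : ℝ) := by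
  have hs : Set.uIoc a b ⊆ I := Set.uIoc_subset_uIcc.trans (hI.uIcc_subset ha hb)
  have hfin : volume (Set.uIoc a b) ≠ ⊤ := by
    rw [Set.uIoc]; exact measure_Ioc_lt_top.ne
  have hv' : MemLp v 2 (volume.restrict (Set.uIoc a b)) :=
    hv.mono_measure (Measure.restrict_mono hs le_rfl)
  have h1 : ‖∫ s in a..b, v s‖ₑ ≤
      eLpNorm v 2 (volume.restrict I) * volume (Set.uIoc a b) ^ (1 / 2 : ℝ) := by
    have e : ‖∫ s in a..b, v s‖ₑ = ‖∫ s in Set.uIoc a b, v s‖ₑ := by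
      rw [← ofReal_norm, ← ofReal_norm, intervalIntegral.norm_intervalIntegral_eq]
    rw [e]
    refine (enorm_integral_le_lintegral_enorm _).trans ?_
    rw [← eLpNorm_one_eq_lintegral_enorm]
    refine (eLpNorm_le_eLpNorm_mul_rpow_measure_univ (p := 1) (q := 2) (by norm_num) hv'.1).trans ?_
    rw [Measure.restrict_apply_univ]
    have := eLpNorm_mono_measure v (p := 2) (Measure.restrict_mono hs (le_refl volume))
    refine (mul_le_mul_left this _).trans_eq ?_
    norm_num
  have h2 := ENNReal.toReal_mono (ENNReal.mul_ne_top hv.2.ne (by finiteness)) h1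
  rwa [toReal_enorm, ENNReal.toReal_mul, ← ENNReal.toReal_rpow] at h2

variable {I : Set ℝ} [hI : I.OrdConnected]

/-- Multiplication by a bounded continuous path of operators, on `L²`. -/
lemma exists_mul_clm {S : ℝ → EuclideanSpace ℝ ι →L[ℝ] EuclideanSpace ℝ ι}
    (hS : ContinuousOn S I) {C : ℝ} (hC : ∀ t ∈ I, ‖S t‖ ≤ C) :
    ∃ M : L2 I ι →L[ℝ] L2 I ι, ∀ x, M x =ᵐ[volume.restrict I] fun t => S t (x t) := by
  have hIm : MeasurableSet I := hI.measurableSet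
  have hb : ∀ x : L2 I ι, ∀ᵐ t ∂(volume.restrict I), ‖S t (x t)‖ ≤ C * ‖x t‖ := by
    intro x
    filter_upwards [ae_restrict_mem hIm] with t ht
    exact (S t).le_of_opNorm_le (hC t ht) _
  have hmem : ∀ x : L2 I ι, MemLp (fun t => S t (x t)) 2 (volume.restrict I) := by
    intro x
    have hm : AEStronglyMeasurable (fun t => S t (x t)) (volume.restrict I) :=
      isBoundedBilinearMap_apply.continuous.comp_aestronglyMeasurable
        ((hS.aestronglyMeasurable hIm).prodMk (Lp.memLp x).1)
    exact (Lp.memLp x).of_le_mul hm (hb x)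
  let M : L2 I ι →ₗ[ℝ] L2 I ι :=
    { toFun := fun x => (hmem x).toLp _
      map_add' := fun x y => by
        refine Lp.ext ?_
        filter_upwards [(hmem (x + y)).coeFn_toLp, (hmem x).coeFn_toLp, (hmem y).coeFn_toLp,
          Lp.coeFn_add x y, Lp.coeFn_add ((hmem x).toLp _) ((hmem y).toLp _)] with t h1 h2 h3 h4 h5
        rw [h1, h5, Pi.add_apply, h2, h3, h4, Pi.add_apply, map_add]
      map_smul' := fun c x => by
        refine Lp.ext ?_
        filter_upwards [(hmem (c • x)).coeFn_toLp, (hmem x).coeFn_toLp,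
          Lp.coeFn_smul c x, Lp.coeFn_smul c ((hmem x).toLp _)] with t h1 h2 h4 h5
        rw [h1, RingHom.id_apply, h5, Pi.smul_apply, h2, h4, Pi.smul_apply, map_smul] }
  refine ⟨M.mkContinuous C fun x => ?_, fun x => (hmem x).coeFn_toLp⟩
  refine Lp.norm_le_mul_norm_of_ae_le_mul ?_
  filter_upwards [(hmem x).coeFn_toLp, hb x] with t h1 h2
  change ‖(hmem x).toLp _ t‖ ≤ _
  rwa [h1]

/-- The graph of the operator `z ↦ T (z' - S z)` on `W^{1,2}(I)`, together with the value of `z`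
at the point `c`. -/
noncomputable def traceGraph (I : Set ℝ) [hI : I.OrdConnected]
    (T : EuclideanSpace ℝ ι ≃L[ℝ] EuclideanSpace ℝ ι)
    (S : ℝ → EuclideanSpace ℝ ι →L[ℝ] EuclideanSpace ℝ ι) (c : ℝ) :
    Submodule ℝ ((L2 I ι × L2 I ι) × EuclideanSpace ℝ ι) where
  carrier := {x | ∃ z z₁ : ℝ → EuclideanSpace ℝ ι, IsW12 I z z₁ ∧ z c = x.2 ∧
    x.1.1 =ᵐ[volume.restrict I] z ∧
    x.1.2 =ᵐ[volume.restrict I] fun t => T (z₁ t - S t (z t))}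
  zero_mem' := by
    refine ⟨0, 0, IsW12.zero, rfl, Lp.coeFn_zero _ _ _, ?_⟩
    filter_upwards [Lp.coeFn_zero (EuclideanSpace ℝ ι) 2 (volume.restrict I)] with t ht
    simp only [Prod.fst_zero, Prod.snd_zero, ht]; simp
  add_mem' := by
    rintro x y ⟨z, z₁, hz, hL, h1, h2⟩ ⟨z', z₁', hz', hL', h1', h2'⟩
    refine ⟨z + z', z₁ + z₁', hz.add hz', by rw [Pi.add_apply, hL, hL']; rfl, ?_, ?_⟩
    · filter_upwards [Lp.coeFn_add x.1.1 y.1.1, h1, h1'] with t ht h h'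
      simp only [Prod.fst_add, ht, Pi.add_apply, h, h']
    · filter_upwards [Lp.coeFn_add x.1.2 y.1.2, h2, h2'] with t ht h h'
      simp only [Prod.fst_add, Prod.snd_add, ht, Pi.add_apply, h, h', map_add, map_sub]; abel
  smul_mem' := by
    rintro a x ⟨z, z₁, hz, hL, h1, h2⟩
    refine ⟨a • z, a • z₁, hz.smul a, by rw [Pi.smul_apply, hL]; rfl, ?_, ?_⟩
    · filter_upwards [Lp.coeFn_smul a x.1.1, h1] with t ht h
      simp only [Prod.smul_fst, ht, Pi.smul_apply, h]
    · filter_upwards [Lp.coeFn_smul a x.1.2, h2] with t ht h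
      simp only [Prod.smul_fst, Prod.smul_snd, ht, Pi.smul_apply, h, map_smul, smul_sub, map_sub]

/-- The graph of the operator `z ↦ T (z' - S z)` with domain `{z ∈ W^{1,2}(I) | z(0) ∈ L}`. -/
noncomputable def odeGraph (I : Set ℝ) [hI : I.OrdConnected] (L : Submodule ℝ (EuclideanSpace ℝ ι))
    (T : EuclideanSpace ℝ ι ≃L[ℝ] EuclideanSpace ℝ ι)
    (S : ℝ → EuclideanSpace ℝ ι →L[ℝ] EuclideanSpace ℝ ι) :
    Submodule ℝ (L2 I ι × L2 I ι) :=
  (traceGraph I T S 0 ⊓ L.comap (LinearMap.snd ℝ _ _)).map (LinearMap.fst ℝ _ _)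

variable {L : Submodule ℝ (EuclideanSpace ℝ ι)} {T : EuclideanSpace ℝ ι ≃L[ℝ] EuclideanSpace ℝ ι}
  {S : ℝ → EuclideanSpace ℝ ι →L[ℝ] EuclideanSpace ℝ ι}

lemma mem_odeGraph {x : L2 I ι × L2 I ι} :
    x ∈ odeGraph I L T S ↔ ∃ z z₁ : ℝ → EuclideanSpace ℝ ι, IsW12 I z z₁ ∧ z 0 ∈ L ∧
      x.1 =ᵐ[volume.restrict I] z ∧
      x.2 =ᵐ[volume.restrict I] fun t => T (z₁ t - S t (z t)) := by
  constructor
  · rintro ⟨⟨x, e⟩, ⟨⟨z, z₁, h1, h2, h3, h4⟩, he⟩, rfl⟩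
    refine ⟨z, z₁, h1, ?_, h3, h4⟩
    rw [h2]; exact he
  · rintro ⟨z, z₁, h1, h2, h3, h4⟩
    exact ⟨(x, z 0), ⟨⟨z, z₁, h1, rfl, h3, h4⟩, h2⟩, rfl⟩

/-- The operators `z ↦ T (z' - S z)` are closed: convergence of `z` and `z'` in `L²` implies
convergence of the values of `z` at all points of `I`. If `0` is not in `I`, the value of a
representative at `0` is arbitrary, and only `L = ⊤` makes sense. -/
lemma isClosed_odeGraph (hI0 : volume I ≠ 0) (hL : (0 : ℝ) ∈ I ∨ L = ⊤)
    (hS : ContinuousOn S I) {C : ℝ} (hC : ∀ t ∈ I, ‖S t‖ ≤ C) :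
    IsClosed (odeGraph I L T S : Set (L2 I ι × L2 I ι)) := by
  have hIm : MeasurableSet I := hI.measurableSet
  obtain ⟨M, hM⟩ := exists_mul_clm hS hC
  let D : L2 I ι × L2 I ι →L[ℝ] L2 I ι :=
    ((T.symm : EuclideanSpace ℝ ι →L[ℝ] EuclideanSpace ℝ ι).compLpL 2 (volume.restrict I)).comp
      (ContinuousLinearMap.snd ℝ _ _) + M.comp (ContinuousLinearMap.fst ℝ _ _)
  have hD : ∀ p : L2 I ι × L2 I ι,
      D p =ᵐ[volume.restrict I] fun t => T.symm (p.2 t) + S t (p.1 t) := by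
    intro p
    filter_upwards [Lp.coeFn_add (((T.symm : EuclideanSpace ℝ ι →L[ℝ]
      EuclideanSpace ℝ ι).compLpL 2 (volume.restrict I)) p.2) (M p.1), hM p.1,
      ContinuousLinearMap.coeFn_compLpL (T.symm : EuclideanSpace ℝ ι →L[ℝ]
        EuclideanSpace ℝ ι) p.2] with t h1 h2 h3
    change ((((T.symm : EuclideanSpace ℝ ι →L[ℝ]
      EuclideanSpace ℝ ι).compLpL 2 (volume.restrict I)) p.2) + (M p.1)) t = _
    rw [h1, Pi.add_apply, h2, h3]
    rfl
  refine IsSeqClosed.isClosed ?_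
  intro p q hp hpq
  choose z z₁ hz hzL hz1 hz2 using fun n => mem_odeGraph.1 (hp n)
  -- The derivative of `z n` is the image of the element `p n` of the graph under the operator `D`.
  have hDz : ∀ n, D (p n) =ᵐ[volume.restrict I] z₁ n := by
    intro n
    filter_upwards [hD (p n), hz1 n, hz2 n] with t h1 h2 h3
    rw [h1, h2, h3]
    simp
  have hlimD : Tendsto (fun n => D (p n)) atTop (𝓝 (D q)) := (D.continuous.tendsto q).comp hpq
  have hlim1 : Tendsto (fun n => (p n).1) atTop (𝓝 q.1) := (continuous_fst.tendsto q).comp hpq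
  obtain ⟨φ, hφ, hφlim⟩ := (tendstoInMeasure_of_tendsto_Lp hlim1).exists_seq_tendsto_ae
  have hprimD : ∀ n, IsPrimitiveOn I (z n) (D (p n)) := fun n =>
    (hz n).isPrimitiveOn.congr_ae (hDz n).symm
  have hall : ∀ᵐ t ∂(volume.restrict I), ∀ n, (p n).1 t = z n t := ae_all_iff.2 hz1
  have hae : ∀ᵐ t ∂(volume.restrict I), t ∈ I ∧ Tendsto (fun n => z (φ n) t) atTop (𝓝 (q.1 t)) := by
    filter_upwards [hφlim, hall, ae_restrict_mem hIm] with t h1 h2 h3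
    exact ⟨h3, by simpa only [h2] using h1⟩
  have : NeBot (ae (volume.restrict I)) := by
    rw [ae_neBot]; intro h; exact hI0 (Measure.restrict_eq_zero.1 h)
  obtain ⟨c, hcI, hc⟩ := hae.exists
  let Z : ℝ → EuclideanSpace ℝ ι := fun t => q.1 c + ∫ s in c..t, D q s
  have hDq : ∀ a ∈ I, ∀ b ∈ I, IntervalIntegrable (D q) volume a b := fun a ha b hb =>
    intervalIntegrable_of_memLp (Lp.memLp (D q)) ha hb
  have hZlim : ∀ t ∈ I, Tendsto (fun n => z (φ n) t) atTop (𝓝 (Z t)) := by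
    intro t ht
    have e : ∀ n, z (φ n) t = z (φ n) c + ∫ s in c..t, D (p (φ n)) s := by
      intro n
      rw [← (hprimD (φ n) c hcI t ht).2]; abel
    simp only [e]
    refine hc.add ?_
    rw [tendsto_iff_norm_sub_tendsto_zero]
    have hb : ∀ n, ‖(∫ s in c..t, D (p (φ n)) s) - ∫ s in c..t, D q s‖ ≤
        ‖D (p (φ n)) - D q‖ * (volume (Set.uIoc c t)).toReal ^ (1 / 2 : ℝ) := by
      intro n
      rw [← intervalIntegral.integral_sub (hprimD (φ n) c hcI t ht).1 (hDq c hcI t ht)]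
      have h1 := norm_intervalIntegral_le (I := I)
        ((Lp.memLp (D (p (φ n)))).sub (Lp.memLp (D q))) hcI ht
      refine h1.trans_eq ?_
      rw [Lp.norm_def, eLpNorm_congr_ae (Lp.coeFn_sub (D (p (φ n))) (D q))]
    refine squeeze_zero (fun n => norm_nonneg _) hb ?_
    have h2 := (hlimD.comp hφ.tendsto_atTop).sub_const (D q)
    rw [sub_self] at h2
    simpa using h2.norm.mul_const ((volume (Set.uIoc c t)).toReal ^ (1 / 2 : ℝ))
  have hqZ : q.1 =ᵐ[volume.restrict I] Z := by
    filter_upwards [hae] with t ht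
    exact tendsto_nhds_unique ht.2 (hZlim t ht.1)
  have hZp : IsPrimitiveOn I Z (D q) := by
    intro a ha b hb
    refine ⟨hDq a ha b hb, ?_⟩
    simp only [Z, add_sub_add_left_eq_sub]
    exact intervalIntegral.integral_interval_sub_left (hDq c hcI b hb) (hDq c hcI a ha)
  refine mem_odeGraph.2 ⟨Z, D q, hZp.isW12 ((memLp_congr_ae hqZ).1 (Lp.memLp q.1))
    (Lp.memLp _), ?_, hqZ, ?_⟩
  · rcases hL with h0 | rfl
    · have hLc : IsClosed (L : Set (EuclideanSpace ℝ ι)) := Submodule.closed_of_finiteDimensional L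
      exact hLc.mem_of_tendsto (hZlim 0 h0) (Eventually.of_forall fun n => hzL (φ n))
    · trivial
  · filter_upwards [hD q, hqZ] with t h1 h2
    rw [h1, h2, add_sub_cancel_right, ContinuousLinearEquiv.apply_symm_apply]

/-- A solution of a linear system which vanishes at one point vanishes. -/
lemma eq_zero_of_isPrimitiveOn (hS : ContinuousOn S I) {C : ℝ} (hC : ∀ t ∈ I, ‖S t‖ ≤ C)
    {z : ℝ → EuclideanSpace ℝ ι} (hz : IsPrimitiveOn I z (fun t => S t (z t))) {c : ℝ}
    (hc : c ∈ I) (h0 : z c = 0) : ∀ t ∈ I, z t = 0 := by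
  have key : ∀ a ∈ I, ∀ b ∈ I, a ≤ b → (z a = 0 → z b = 0) ∧ (z b = 0 → z a = 0) := by
    intro a ha b hb hab
    have hs : Set.Icc a b ⊆ I := hI.out ha hb
    have hzc : ContinuousOn z (Set.Icc a b) := by
      have := hz.continuousOn ha hb
      rwa [Set.uIcc_of_le hab] at this
    have hSz : ContinuousOn (fun t => S t (z t)) (Set.Icc a b) := (hS.mono hs).clm_apply hzc
    let g : ℝ → EuclideanSpace ℝ ι :=
      Set.IccExtend hab ((Set.Icc a b).domRestrict fun t => S t (z t))
    have hg : Continuous g := hSz.domRestrict.Icc_extend'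
    have hgS : ∀ t ∈ Set.Icc a b, g t = S t (z t) := fun t ht => Set.IccExtend_of_mem hab _ ht
    let w : ℝ → EuclideanSpace ℝ ι := fun t => z a + ∫ s in a..t, g s
    have hw : ∀ t, HasDerivAt w (g t) t := fun t =>
      (hg.integral_hasStrictDerivAt a t).hasDerivAt.const_add _
    have hwz : ∀ t ∈ Set.Icc a b, w t = z t := by
      intro t ht
      have h1 : ∫ s in a..t, g s = ∫ s in a..t, S s (z s) := by
        refine intervalIntegral.integral_congr fun s hs => hgS s ?_
        rw [Set.uIcc_of_le ht.1] at hs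
        exact ⟨hs.1, hs.2.trans ht.2⟩
      simp only [w]
      rw [h1, ← (hz a ha t (hs ht)).2]; abel
    have hw' : ∀ t ∈ Set.Icc a b, HasDerivAt w (S t (w t)) t := by
      intro t ht
      have := hw t
      rwa [hgS t ht, ← hwz t ht] at this
    have hC0 : 0 ≤ C := (norm_nonneg _).trans (hC a ha)
    have hlip : ∀ t ∈ Set.Icc a b, LipschitzOnWith ⟨C, hC0⟩ (fun x => S t x) Set.univ := by
      intro t ht
      refine ((S t).lipschitz.weaken ?_).lipschitzOnWith
      exact hC t (hs ht)
    have hz0 : ∀ t, HasDerivAt (fun _ : ℝ => (0 : EuclideanSpace ℝ ι)) (S t 0) t := fun t => by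
      rw [map_zero]; exact hasDerivAt_const _ _
    have hwc : ContinuousOn w (Set.Icc a b) := fun t ht =>
      (hw t).continuousAt.continuousWithinAt
    constructor
    · intro h
      have := ODE_solution_unique_of_mem_Icc_right (s := fun _ => Set.univ)
        (v := fun t x => S t x) (g := fun _ => 0)
        (fun t ht => hlip t ⟨ht.1, ht.2.le⟩) hwc
        (fun t ht => (hw' t ⟨ht.1, ht.2.le⟩).hasDerivWithinAt) (fun _ _ => trivial)
        continuousOn_const (fun t _ => (hz0 t).hasDerivWithinAt) (fun _ _ => trivial)
        (by rw [hwz a ⟨le_rfl, hab⟩, h])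
      rw [← hwz b ⟨hab, le_rfl⟩]
      exact this ⟨hab, le_rfl⟩
    · intro h
      have := ODE_solution_unique_of_mem_Icc_left (s := fun _ => Set.univ)
        (v := fun t x => S t x) (g := fun _ => 0)
        (fun t ht => hlip t ⟨ht.1.le, ht.2⟩) hwc
        (fun t ht => (hw' t ⟨ht.1.le, ht.2⟩).hasDerivWithinAt) (fun _ _ => trivial)
        continuousOn_const (fun t _ => (hz0 t).hasDerivWithinAt) (fun _ _ => trivial)
        (by rw [hwz b ⟨hab, le_rfl⟩, h])
      rw [← hwz a ⟨le_rfl, hab⟩]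
      exact this ⟨le_rfl, hab⟩
  intro t ht
  rcases le_total c t with h | h
  · exact (key c hc t ht h).1 h0
  · exact (key t ht c hc h).2 h0

/-- The kernel of `z ↦ T (z' - S z)` is finite dimensional, since its elements are determined by
their value at `0`. -/
lemma finiteDimensional_ker_odeGraph (h0 : (0 : ℝ) ∈ I) (hS : ContinuousOn S I) {C : ℝ}
    (hC : ∀ t ∈ I, ‖S t‖ ≤ C) :
    FiniteDimensional ℝ ((odeGraph I L T S).comap (LinearMap.inl ℝ (L2 I ι) (L2 I ι))) := by
  let j : L2 I ι × EuclideanSpace ℝ ι →ₗ[ℝ] (L2 I ι × L2 I ι) × EuclideanSpace ℝ ι :=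
    (LinearMap.inl ℝ (L2 I ι) (L2 I ι)).prodMap LinearMap.id
  let Γ := (traceGraph I T S 0).comap j
  have hinj : Function.Injective
      ((LinearMap.snd ℝ (L2 I ι) (EuclideanSpace ℝ ι)).comp Γ.subtype) := by
    rw [← LinearMap.ker_eq_bot, LinearMap.ker_eq_bot']
    rintro ⟨⟨x, e⟩, z, z₁, hz, hze, hx, hy⟩ he
    have he' : e = 0 := he
    subst he'
    have h1 : z₁ =ᵐ[volume.restrict I] fun t => S t (z t) := by
      filter_upwards [hy, Lp.coeFn_zero (EuclideanSpace ℝ ι) 2 (volume.restrict I)] with t h1 h2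
      have h3 : T (z₁ t - S t (z t)) = 0 := by
        rw [← h1]; exact h2
      exact sub_eq_zero.1 (T.map_eq_zero_iff.1 h3)
    have h2 := eq_zero_of_isPrimitiveOn hS hC (hz.isPrimitiveOn.congr_ae h1) h0 hze
    refine Subtype.ext (Prod.ext (Lp.ext ?_) rfl)
    filter_upwards [hx, Lp.coeFn_zero (EuclideanSpace ℝ ι) 2 (volume.restrict I),
      ae_restrict_mem hI.measurableSet] with t h3 h4 h5
    exact (h3.trans (h2 t h5)).trans h4.symm
  have : FiniteDimensional ℝ Γ := Module.Finite.of_injective _ hinj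
  have hle : (odeGraph I L T S).comap (LinearMap.inl ℝ (L2 I ι) (L2 I ι)) ≤
      Γ.map (LinearMap.fst ℝ _ _) := by
    intro x hx
    obtain ⟨⟨p, e⟩, ⟨hp, -⟩, hpx⟩ := hx
    have hpx' : p = (x, 0) := hpx
    subst hpx'
    exact ⟨(x, e), hp, rfl⟩
  exact Submodule.finiteDimensional_of_le hle

end Evolution

/-! ### Range of first order systems -/

section Surjectivity

variable {ι : Type} [Fintype ι] {I : Set ℝ} [hI : I.OrdConnected]
  {L : Submodule ℝ (EuclideanSpace ℝ ι)} {T : EuclideanSpace ℝ ι ≃L[ℝ] EuclideanSpace ℝ ι}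
  {S : ℝ → EuclideanSpace ℝ ι →L[ℝ] EuclideanSpace ℝ ι}

/-- The system `z' = S z + h` has a solution in `W^{1,2}(I)` for every `h` in `L²(I)`. -/
def IsSolvable (I : Set ℝ) (S : ℝ → EuclideanSpace ℝ ι →L[ℝ] EuclideanSpace ℝ ι) : Prop :=
  ∀ h : ℝ → EuclideanSpace ℝ ι, MemLp h 2 (volume.restrict I) →
    ∃ z z₁, IsW12 I z z₁ ∧ z₁ =ᵐ[volume.restrict I] fun t => S t (z t) + h t

lemma aestronglyMeasurable_apply (hS : ContinuousOn S I) {z : ℝ → EuclideanSpace ℝ ι}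
    (hz : AEStronglyMeasurable z (volume.restrict I)) :
    AEStronglyMeasurable (fun t => S t (z t)) (volume.restrict I) :=
  isBoundedBilinearMap_apply.continuous.comp_aestronglyMeasurable
    ((hS.aestronglyMeasurable hI.measurableSet).prodMk hz)

lemma memLp_apply (hS : ContinuousOn S I) {C : ℝ} (hC : ∀ t ∈ I, ‖S t‖ ≤ C)
    {z : ℝ → EuclideanSpace ℝ ι} (hz : MemLp z 2 (volume.restrict I)) :
    MemLp (fun t => S t (z t)) 2 (volume.restrict I) := by
  refine hz.of_le_mul (aestronglyMeasurable_apply hS hz.1) (c := C) ?_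
  filter_upwards [ae_restrict_mem hI.measurableSet] with t ht
  exact (S t).le_of_opNorm_le (hC t ht) _

/-- Solvability is stable under perturbations which are small relative to a right inverse of the
unperturbed operator. -/
lemma isSolvable_of_perturbation (hI0 : volume I ≠ 0) (hS : ContinuousOn S I)
    (S₀ : EuclideanSpace ℝ ι →L[ℝ] EuclideanSpace ℝ ι) {K ε : ℝ} (hK : 0 ≤ K) (hε : 0 ≤ ε)
    (hKε : K * ε ≤ 2⁻¹) (hSε : ∀ t ∈ I, ‖S t - S₀‖ ≤ ε)
    (hsol : ∀ h : ℝ → EuclideanSpace ℝ ι, MemLp h 2 (volume.restrict I) →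
      ∃ z, IsW12 I z (fun t => S₀ (z t) + h t) ∧
        eLpNorm z 2 (volume.restrict I) ≤ ENNReal.ofReal K * eLpNorm h 2 (volume.restrict I)) :
    IsSolvable I S := by
  have hIm : MeasurableSet I := hI.measurableSet
  have hC : ∀ t ∈ I, ‖S t‖ ≤ ‖S₀‖ + ε := fun t ht => by
    have := norm_add_le S₀ (S t - S₀)
    rw [add_sub_cancel] at this
    exact this.trans (by gcongr; exact hSε t ht)
  let T : EuclideanSpace ℝ ι ≃L[ℝ] EuclideanSpace ℝ ι := ContinuousLinearEquiv.refl ℝ _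
  have hcl : IsClosed (odeGraph I ⊤ T S : Set (L2 I ι × L2 I ι)) :=
    isClosed_odeGraph hI0 (Or.inr rfl) hS hC
  have happ := exists_mem_of_approx hcl K (fun y => by
    obtain ⟨z, hz, hzn⟩ := hsol y (Lp.memLp y)
    have hr : MemLp (fun t => (S₀ (z t) + y t) - S t (z t)) 2 (volume.restrict I) :=
      hz.2.1.sub (memLp_apply hS hC hz.1)
    have hzy : ‖hz.1.toLp z‖ ≤ K * ‖y‖ := by
      rw [Lp.norm_toLp, Lp.norm_def]
      refine (ENNReal.toReal_mono (ENNReal.mul_ne_top ENNReal.ofReal_ne_top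
        (Lp.memLp y).2.ne) hzn).trans_eq ?_
      rw [ENNReal.toReal_mul, ENNReal.toReal_ofReal hK]
    refine ⟨(hz.1.toLp z, hr.toLp _), mem_odeGraph.2 ⟨z, _, hz, trivial, hz.1.coeFn_toLp,
      hr.coeFn_toLp⟩, hzy, ?_⟩
    have h1 : ‖y - hr.toLp _‖ ≤ ε * ‖hz.1.toLp z‖ := by
      refine Lp.norm_le_mul_norm_of_ae_le_mul ?_
      filter_upwards [Lp.coeFn_sub y (hr.toLp _), hr.coeFn_toLp, hz.1.coeFn_toLp,
        ae_restrict_mem hIm] with t h1 h2 h3 ht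
      rw [h1, Pi.sub_apply, h2, h3]
      have e : y t - (S₀ (z t) + y t - S t (z t)) = (S t - S₀) (z t) := by
        rw [sub_apply]; abel
      rw [e]
      exact (S t - S₀).le_of_opNorm_le (hSε t ht) _
    calc ‖y - hr.toLp _‖ ≤ ε * (K * ‖y‖) := h1.trans (by gcongr)
      _ = (K * ε) * ‖y‖ := by ring
      _ ≤ 2⁻¹ * ‖y‖ := by gcongr)
  intro h hh
  obtain ⟨x, hx⟩ := happ (hh.toLp h)
  obtain ⟨z, z₁, hz, -, -, h2⟩ := mem_odeGraph.1 hx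
  refine ⟨z, z₁, hz, ?_⟩
  filter_upwards [h2, hh.coeFn_toLp] with t e1 e2
  have e3 : h t = z₁ t - S t (z t) := by rw [← e2]; exact e1
  rw [e3]; abel

/-- Near an end of the line, a system with hyperbolic limit is solvable. -/
lemma exists_isSolvable_of_isHyperbolic [DecidableEq ι] {M : Matrix ι ι ℝ} (hM : IsHyperbolic M) :
    ∃ ε > 0, ∀ (J : Set ℝ) [J.OrdConnected], volume J ≠ 0 → ContinuousOn S J →
      (∀ t ∈ J, ‖S t - Matrix.toEuclideanCLM (𝕜 := ℝ) M‖ ≤ ε) → IsSolvable J S := by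
  obtain ⟨K, hK, hsol⟩ := exists_solution_of_isHyperbolic hM
  refine ⟨2⁻¹ / (K + 1), by positivity, fun J hJ hJ0 hS hε =>
    isSolvable_of_perturbation hJ0 hS _ hK (by positivity) ?_ hε (fun h hh => hsol J h hh)⟩
  rw [mul_div_assoc', div_le_iff₀ (by positivity)]
  nlinarith

/-- On a compact interval every system is solvable. After the substitution `z = exp (l t) y` the
system becomes a small perturbation of `y' = -l y` for `l` large. -/
lemma isSolvable_Icc {a b : ℝ} (hab : a < b) (hS : ContinuousOn S (Set.Icc a b)) :
    IsSolvable (Set.Icc a b) S := by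
  obtain ⟨C, hC⟩ := isCompact_Icc.exists_bound_of_continuousOn hS
  have hC0 : 0 ≤ C := (norm_nonneg _).trans (hC a ⟨le_rfl, hab.le⟩)
  set l : ℝ := 2 * C + 1 with hl
  have hl0 : 0 < l := by positivity
  have hvol : volume (Set.Icc a b) ≠ 0 := by simp [hab]
  have h1 : IsSolvable (Set.Icc a b)
      (fun t => S t + (-l) • ContinuousLinearMap.id ℝ (EuclideanSpace ℝ ι)) := by
    refine isSolvable_of_perturbation hvol (hS.add continuousOn_const)
      ((-l) • ContinuousLinearMap.id ℝ _) (K := 1 / l) (ε := C) (by positivity) hC0 ?_ ?_ ?_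
    · rw [one_div_mul_eq_div, div_le_iff₀ hl0]; linarith
    · intro t ht; rw [add_sub_cancel_right]; exact hC t ht
    · intro h hh
      obtain ⟨z, hz, hzn, -⟩ := exists_solution_smul (c := -l) (by linarith) (Set.Icc a b) hh
      refine ⟨z, hz, ?_⟩
      rwa [abs_neg, abs_of_pos hl0] at hzn
  have hexp : ∀ c : ℝ, ∀ f : ℝ → EuclideanSpace ℝ ι, MemLp f 2 (volume.restrict (Set.Icc a b)) →
      MemLp (fun t => Real.exp (c * t) • f t) 2 (volume.restrict (Set.Icc a b)) := by
    intro c f hf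
    have hc : Continuous fun t : ℝ => Real.exp (c * t) := by fun_prop
    obtain ⟨B, hB⟩ := isCompact_Icc.exists_bound_of_continuousOn (s := Set.Icc a b) hc.continuousOn
    refine hf.of_le_mul (c := B) (hc.aestronglyMeasurable.smul hf.1) ?_
    filter_upwards [ae_restrict_mem measurableSet_Icc] with t ht
    rw [norm_smul]
    gcongr
    exact hB t ht
  intro h hh
  obtain ⟨y, y₁, hy, hy1⟩ := h1 _ (hexp (-l) h hh)
  have he : IsPrimitiveOn (Set.Icc a b) (fun t => Real.exp (l * t))
      (fun t => l * Real.exp (l * t)) := by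
    intro p _ q _
    have hc : Continuous fun t : ℝ => l * Real.exp (l * t) := by fun_prop
    refine ⟨hc.intervalIntegrable _ _, ?_⟩
    symm
    refine intervalIntegral.integral_eq_sub_of_hasDerivAt (f := fun t => Real.exp (l * t))
      (fun x _ => ?_) (hc.intervalIntegrable _ _)
    have := ((hasDerivAt_id x).const_mul l).exp
    simpa [mul_comm] using this
  have hz := he.bilin (ContinuousLinearMap.lsmul ℝ ℝ (E := EuclideanSpace ℝ ι)) hy.isPrimitiveOn
  have hzL := hexp l y hy.1
  have hzeq : (fun t => ContinuousLinearMap.lsmul ℝ ℝ (E := EuclideanSpace ℝ ι)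
      (l * Real.exp (l * t)) (y t) + ContinuousLinearMap.lsmul ℝ ℝ (E := EuclideanSpace ℝ ι)
      (Real.exp (l * t)) (y₁ t)) =ᵐ[volume.restrict (Set.Icc a b)]
      fun t => S t (Real.exp (l * t) • y t) + h t := by
    filter_upwards [hy1] with t ht
    simp only [ContinuousLinearMap.lsmul_apply, ht, add_apply, smul_apply,
      ContinuousLinearMap.id_apply, smul_add, smul_smul, ← Real.exp_add, map_smul]
    rw [show l * t + -l * t = 0 by ring, Real.exp_zero, one_smul]
    module
  exact ⟨fun t => Real.exp (l * t) • y t, fun t => S t (Real.exp (l * t) • y t) + h t,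
    (hz.congr_ae hzeq).isW12 hzL ((memLp_apply hS hC hzL).add hh), EventuallyEq.rfl⟩

/-- The range of `z ↦ T (z' - S z)` on `W^{1,2}(I)`. -/
noncomputable def odeRange (I : Set ℝ) [hI : I.OrdConnected]
    (T : EuclideanSpace ℝ ι ≃L[ℝ] EuclideanSpace ℝ ι)
    (S : ℝ → EuclideanSpace ℝ ι →L[ℝ] EuclideanSpace ℝ ι) : Submodule ℝ (L2 I ι) :=
  (odeGraph I ⊤ T S).map (LinearMap.snd ℝ _ _)

lemma IsSolvable.odeRange_eq_top (h : IsSolvable I S)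
    (T : EuclideanSpace ℝ ι ≃L[ℝ] EuclideanSpace ℝ ι) :
    odeRange I T S = ⊤ := by
  rw [eq_top_iff]
  rintro y -
  obtain ⟨z, z₁, hz, h1⟩ := h (fun t => T.symm (y t))
    ((T.symm : EuclideanSpace ℝ ι →L[ℝ] EuclideanSpace ℝ ι).comp_memLp' (Lp.memLp y))
  refine ⟨(hz.1.toLp z, y), mem_odeGraph.2 ⟨z, z₁, hz, trivial, hz.1.coeFn_toLp, ?_⟩, rfl⟩
  filter_upwards [h1] with t h1
  rw [h1, add_sub_cancel_left, ContinuousLinearEquiv.apply_symm_apply]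

/-- Restriction of square integrable functions to a smaller interval. -/
lemma exists_restrict {I J : Set ℝ} (hJ : J ⊆ I) :
    ∃ r : L2 I ι →ₗ[ℝ] L2 J ι, ∀ x, r x =ᵐ[volume.restrict J] x := by
  have hm : ∀ x : L2 I ι, MemLp x 2 (volume.restrict J) := fun x =>
    (Lp.memLp x).mono_measure (Measure.restrict_mono hJ le_rfl)
  have hle : ∀ {p : ℝ → Prop}, (∀ᵐ t ∂(volume.restrict I), p t) → ∀ᵐ t ∂(volume.restrict J), p t :=
    fun h => h.filter_mono (ae_mono (Measure.restrict_mono hJ le_rfl))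
  refine ⟨{ toFun := fun x => (hm x).toLp x, map_add' := fun x y => ?_,
            map_smul' := fun c x => ?_ }, fun x => (hm x).coeFn_toLp⟩
  · refine Lp.ext ?_
    filter_upwards [(hm (x + y)).coeFn_toLp, (hm x).coeFn_toLp, (hm y).coeFn_toLp,
      hle (Lp.coeFn_add x y), Lp.coeFn_add ((hm x).toLp _) ((hm y).toLp _)] with t h1 h2 h3 h4 h5
    rw [h1, h5, Pi.add_apply, h2, h3, h4, Pi.add_apply]
  · refine Lp.ext ?_
    filter_upwards [(hm (c • x)).coeFn_toLp, (hm x).coeFn_toLp,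
      hle (Lp.coeFn_smul c x), Lp.coeFn_smul c ((hm x).toLp _)] with t h1 h2 h4 h5
    rw [h1, RingHom.id_apply, h5, Pi.smul_apply, h2, h4, Pi.smul_apply]

/-- If the range has finite codimension on two adjacent intervals, then it does on their union:
solutions on the two intervals fit together if their values at the common point agree. -/
lemma coFG_odeRange_union {J K : Set ℝ} [hJo : J.OrdConnected] [hKo : K.OrdConnected] {c : ℝ}
    (hcJ : c ∈ J) (hcK : c ∈ K) (hJK : I = J ∪ K) (hJc : ∀ t ∈ J, t ≤ c) (hKc : ∀ t ∈ K, c ≤ t)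
    (hJ : (odeRange J T S).CoFG) (hK : (odeRange K T S).CoFG) : (odeRange I T S).CoFG := by
  have hJI : J ⊆ I := hJK ▸ Set.subset_union_left
  have hKI : K ⊆ I := hJK ▸ Set.subset_union_right
  obtain ⟨r, hr⟩ := exists_restrict (ι := ι) hJI
  obtain ⟨s, hs⟩ := exists_restrict (ι := ι) hKI
  let E := EuclideanSpace ℝ ι
  -- Pairs of a right-hand side and the jump of a solution which is allowed to jump at `c`.
  let Γ : Submodule ℝ (L2 I ι × E) :=
    { carrier := {p | ∃ x e y f, ((x, r p.1), e) ∈ traceGraph J T S c ∧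
        ((y, s p.1), f) ∈ traceGraph K T S c ∧ p.2 = e - f}
      zero_mem' := ⟨0, 0, 0, 0, by
        rw [Prod.fst_zero, map_zero]; exact Submodule.zero_mem _, by
        rw [Prod.fst_zero, map_zero]; exact Submodule.zero_mem _, by simp⟩
      add_mem' := by
        rintro p q ⟨x, e, y, f, h1, h2, h3⟩ ⟨x', e', y', f', h1', h2', h3'⟩
        refine ⟨x + x', e + e', y + y', f + f', ?_, ?_, ?_⟩
        · rw [Prod.fst_add, map_add]; exact Submodule.add_mem _ h1 h1'
        · rw [Prod.fst_add, map_add]; exact Submodule.add_mem _ h2 h2'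
        · rw [Prod.snd_add, h3, h3']; abel
      smul_mem' := by
        rintro a p ⟨x, e, y, f, h1, h2, h3⟩
        refine ⟨a • x, a • e, a • y, a • f, ?_, ?_, ?_⟩
        · rw [Prod.smul_fst, map_smul]; exact Submodule.smul_mem _ a h1
        · rw [Prod.smul_fst, map_smul]; exact Submodule.smul_mem _ a h2
        · rw [Prod.smul_snd, h3, smul_sub] }
  have hmem : ∀ {J : Set ℝ} [J.OrdConnected] {h : L2 J ι}, h ∈ odeRange J T S →
      ∃ x e, ((x, h), e) ∈ traceGraph J T S c := by
    rintro J _ h ⟨⟨x, h⟩, hp, rfl⟩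
    obtain ⟨z, z₁, hz, -, h1, h2⟩ := mem_odeGraph.1 hp
    exact ⟨x, z c, z, z₁, hz, rfl, h1, h2⟩
  have h1 : (Γ.map (LinearMap.fst ℝ (L2 I ι) E)).CoFG := by
    have hr1 : ((odeRange J T S).comap r).CoFG := by
      have : FiniteDimensional ℝ (L2 J ι ⧸ odeRange J T S) := hJ
      have := Submodule.CoFG.ker ((odeRange J T S).mkQ.comp r)
      rwa [LinearMap.ker_comp, Submodule.ker_mkQ] at this
    have hs1 : ((odeRange K T S).comap s).CoFG := by
      have : FiniteDimensional ℝ (L2 K ι ⧸ odeRange K T S) := hK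
      have := Submodule.CoFG.ker ((odeRange K T S).mkQ.comp s)
      rwa [LinearMap.ker_comp, Submodule.ker_mkQ] at this
    refine Submodule.CoFG.of_le ?_ (hr1.inf hs1)
    rintro h ⟨hh1, hh2⟩
    obtain ⟨x, e, he⟩ := hmem hh1
    obtain ⟨y, f, hf⟩ := hmem hh2
    exact ⟨(h, e - f), ⟨x, e, y, f, he, hf, rfl⟩, rfl⟩
  refine Submodule.CoFG.of_le ?_ (coFG_comap_inl Γ h1)
  rintro h ⟨x, e, y, f, ⟨z, z₁, hz, hze, -, hz2⟩, ⟨w, w₁, hw, hwf, -, hw2⟩, hef⟩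
  simp only [LinearMap.inl_apply] at hz2 hw2 hef hze hwf
  have hzw : z c = w c := by rw [hze, hwf]; exact (sub_eq_zero.1 hef.symm)
  have hJm := hJo.measurableSet
  have hKm := hKo.measurableSet
  have hne : ∀ μ : Measure ℝ, μ ≤ volume → ∀ᵐ t ∂μ, t ≠ c := fun μ hμ =>
    (ae_mono hμ) (measure_eq_zero_iff_ae_notMem.1 (measure_singleton c))
  let u : ℝ → E := fun t => if t < c then z t else w t
  let u₁ : ℝ → E := fun t => if t < c then z₁ t else w₁ t
  have huJ : ∀ t ∈ J, z t = u t := by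
    intro t ht
    rcases (hJc t ht).lt_or_eq with h | rfl
    · simp [u, h]
    · simp [u, hzw]
  have huK : ∀ t ∈ K, w t = u t := fun t ht => by simp [u, not_lt.2 (hKc t ht)]
  have huJ1 : z₁ =ᵐ[volume.restrict J] u₁ := by
    filter_upwards [ae_restrict_mem hJm, hne _ Measure.restrict_le_self] with t ht hne
    simp [u₁, lt_of_le_of_ne (hJc t ht) hne]
  have huK1 : ∀ t ∈ K, w₁ t = u₁ t := fun t ht => by simp [u₁, not_lt.2 (hKc t ht)]
  have huJ' : z =ᵐ[volume.restrict J] u := by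
    filter_upwards [ae_restrict_mem hJm] with t ht using huJ t ht
  have huK' : w =ᵐ[volume.restrict K] u := by
    filter_upwards [ae_restrict_mem hKm] with t ht using huK t ht
  have huK1' : w₁ =ᵐ[volume.restrict K] u₁ := by
    filter_upwards [ae_restrict_mem hKm] with t ht using huK1 t ht
  have hpJ : IsPrimitiveOn J u u₁ :=
    (hz.isPrimitiveOn.congr huJ fun t _ => rfl).congr_ae huJ1
  have hpK : IsPrimitiveOn K u u₁ := hw.isPrimitiveOn.congr huK huK1
  have hunion : ∀ {g : ℝ → E}, MemLp g 2 (volume.restrict J) → MemLp g 2 (volume.restrict K) →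
      MemLp g 2 (volume.restrict I) := by
    intro g hg1 hg2
    have hm : AEStronglyMeasurable g (volume.restrict I) := by
      rw [hJK]; exact aestronglyMeasurable_union_iff.2 ⟨hg1.1, hg2.1⟩
    rw [memLp_two_iff_integrable_sq_norm hm, hJK]
    exact IntegrableOn.union ((memLp_two_iff_integrable_sq_norm hg1.1).1 hg1)
      ((memLp_two_iff_integrable_sq_norm hg2.1).1 hg2)
  have hae : ∀ {p : ℝ → Prop}, (∀ᵐ t ∂(volume.restrict J), p t) →
      (∀ᵐ t ∂(volume.restrict K), p t) → ∀ᵐ t ∂(volume.restrict I), p t := by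
    intro p h1 h2
    rw [hJK, ae_restrict_union_eq]
    exact ⟨h1, h2⟩
  have hu : IsW12 I u u₁ :=
    (hpJ.union hpK hcJ hcK hJK.subset).isW12
      (hunion ((memLp_congr_ae huJ').1 hz.1) ((memLp_congr_ae huK').1 hw.1))
      (hunion ((memLp_congr_ae huJ1).1 hz.2.1) ((memLp_congr_ae huK1').1 hw.2.1))
  refine ⟨(hu.1.toLp u, h), mem_odeGraph.2 ⟨u, u₁, hu, trivial, hu.1.coeFn_toLp, hae ?_ ?_⟩, rfl⟩
  · filter_upwards [hr h, hz2, huJ1, huJ'] with t e1 e2 e3 e4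
    rw [← e1, ← e3, ← e4]; exact e2
  · filter_upwards [hs h, hw2, huK1', huK'] with t e1 e2 e3 e4
    rw [← e1, ← e3, ← e4]; exact e2

/-- Boundary conditions do not affect whether the range has finite codimension. -/
lemma coFG_map_snd_odeGraph (h : (odeRange I T S).CoFG) :
    ((odeGraph I L T S).map (LinearMap.snd ℝ (L2 I ι) (L2 I ι))).CoFG := by
  let E := EuclideanSpace ℝ ι
  let Γ := (traceGraph I T S 0).map
    (((LinearMap.snd ℝ (L2 I ι) (L2 I ι)).prodMap L.mkQ :
      (L2 I ι × L2 I ι) × E →ₗ[ℝ] L2 I ι × (E ⧸ L)))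
  have h1 : (Γ.map (LinearMap.fst ℝ (L2 I ι) (E ⧸ L))).CoFG := by
    refine Submodule.CoFG.of_le ?_ h
    rintro _ ⟨p, ⟨q, ⟨hq, -⟩, rfl⟩, rfl⟩
    exact ⟨_, ⟨q, hq, rfl⟩, rfl⟩
  refine Submodule.CoFG.of_le ?_ (coFG_comap_inl Γ h1)
  rintro y ⟨⟨p, e⟩, hp, hpy⟩
  have hp1 : p.2 = y := congrArg Prod.fst hpy
  have hp2 : L.mkQ e = 0 := congrArg Prod.snd hpy
  exact ⟨p, ⟨(p, e), ⟨hp, (Submodule.Quotient.mk_eq_zero L).1 hp2⟩, rfl⟩, hp1⟩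

end Surjectivity

/-! ### Oscillations and Weyl sequences -/

section Necessity

variable {ι : Type} [Fintype ι] {I : Set ℝ}
  {L : Submodule ℝ (EuclideanSpace ℝ ι)} {T : EuclideanSpace ℝ ι ≃L[ℝ] EuclideanSpace ℝ ι}
  {S : ℝ → EuclideanSpace ℝ ι →L[ℝ] EuclideanSpace ℝ ι}

/-- For a Fredholm relation there are no Weyl sequences escaping to infinity: the distance of such
a sequence to the kernel would tend to zero, hence a subsequence would converge to an element of
the kernel, of norm one, and vanishing everywhere because of the supports. -/
lemma not_exists_weyl_sequence {G : Submodule ℝ (L2 I ι × L2 I ι)}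
    (hG : IsClosed (G : Set (L2 I ι × L2 I ι)))
    (hk : FiniteDimensional ℝ (G.comap (LinearMap.inl ℝ (L2 I ι) (L2 I ι))))
    (hr : (G.map (LinearMap.snd ℝ (L2 I ι) (L2 I ι))).CoFG) (p : ℕ → L2 I ι × L2 I ι)
    (hp : ∀ n, p n ∈ G) (hp1 : ∀ n, ‖(p n).1‖ = 1)
    (hp2 : Tendsto (fun n => ‖(p n).2‖) atTop (𝓝 0))
    (hsupp : ∀ n : ℕ, ∀ᵐ t : ℝ ∂(volume.restrict I), |t| ≤ (n : ℝ) → (p n).1 t = 0) : False := by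
  obtain ⟨C, hC, hb⟩ := exists_norm_sub_ker_le hG hr
  choose k hkG hkb using fun n => hb (p n) (hp n)
  have hdiff : Tendsto (fun n => (p n).1 - k n) atTop (𝓝 0) :=
    squeeze_zero_norm hkb (by simpa using hp2.const_mul C)
  let k' : ℕ → G.comap (LinearMap.inl ℝ (L2 I ι) (L2 I ι)) := fun n => ⟨k n, hkG n⟩
  have hproper := FiniteDimensional.proper ℝ (G.comap (LinearMap.inl ℝ (L2 I ι) (L2 I ι)))
  obtain ⟨B, hB⟩ := hp2.bddAbove_range
  have hbdd : Bornology.IsBounded (Set.range k') := by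
    rw [isBounded_iff_forall_norm_le]
    refine ⟨1 + C * B, ?_⟩
    rintro _ ⟨n, rfl⟩
    have h1 : ‖k n‖ ≤ ‖(p n).1‖ + ‖(p n).1 - k n‖ := by
      have := norm_sub_le (p n).1 ((p n).1 - k n)
      rwa [sub_sub_cancel] at this
    have h2 : ‖(p n).2‖ ≤ B := hB ⟨n, rfl⟩
    calc ‖k' n‖ = ‖k n‖ := rfl
      _ ≤ _ := h1
      _ ≤ 1 + C * B := by
        rw [hp1]; gcongr
        exact (hkb n).trans (by gcongr)
  obtain ⟨κ, -, φ, hφ, hκ⟩ := tendsto_subseq_of_bounded hbdd (fun n => Set.mem_range_self n)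
  have hκ' : Tendsto (fun n => k (φ n)) atTop (𝓝 (κ : L2 I ι)) :=
    (continuous_subtype_val.tendsto κ).comp hκ
  have hx : Tendsto (fun n => (p (φ n)).1) atTop (𝓝 (κ : L2 I ι)) := by
    have := (hdiff.comp hφ.tendsto_atTop).add hκ'
    simpa using this
  have hn1 : ‖(κ : L2 I ι)‖ = 1 := by
    refine tendsto_nhds_unique hx.norm ?_
    simp only [hp1]
    exact tendsto_const_nhds
  obtain ⟨ψ, hψ, hae⟩ := (tendstoInMeasure_of_tendsto_Lp hx).exists_seq_tendsto_ae
  have h0 : (κ : L2 I ι) = 0 := by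
    refine Lp.ext ?_
    filter_upwards [hae, ae_all_iff.2 hsupp,
      Lp.coeFn_zero (EuclideanSpace ℝ ι) 2 (volume.restrict I)] with t h1 h2 h3
    rw [h3, Pi.zero_apply]
    refine tendsto_nhds_unique h1 (tendsto_const_nhds.congr' ?_)
    obtain ⟨N, hN⟩ := exists_nat_ge |t|
    filter_upwards [eventually_ge_atTop N] with n hn
    refine (h2 _ (hN.trans ?_)).symm
    exact_mod_cast hn.trans ((hψ.id_le n).trans (hφ.id_le _))
  rw [h0, norm_zero] at hn1
  exact zero_ne_one hn1

lemma norm_sq_eq_integral (x : L2 I ι) : ‖x‖ ^ 2 = ∫ t in I, ‖x t‖ ^ 2 := by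
  rw [← real_inner_self_eq_norm_sq, L2.inner_def]
  simp only [real_inner_self_eq_norm_sq]

lemma integrable_norm_sq (x : L2 I ι) : Integrable (fun t => ‖x t‖ ^ 2) (volume.restrict I) :=
  (memLp_two_iff_integrable_sq_norm (Lp.memLp x).1).1 (Lp.memLp x)

lemma exists_cutoff : ∃ χ : ℝ → ℝ, ∃ B > 0, ContDiff ℝ 1 χ ∧ (∀ t, |t| ≤ 1 / 2 → χ t = 1) ∧
    (∀ t, 1 ≤ |t| → χ t = 0 ∧ deriv χ t = 0) ∧ (∀ t, |χ t| ≤ 1) ∧ ∀ t, |deriv χ t| ≤ B := by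
  let f : ContDiffBump (0 : ℝ) := ⟨1 / 2, 3 / 4, by norm_num, by norm_num⟩
  have hc : ContDiff ℝ 1 f := f.contDiff
  have hcs : HasCompactSupport (deriv f) := f.hasCompactSupport.deriv
  obtain ⟨B, hB⟩ := (hc.continuous_deriv le_rfl).bounded_above_of_compact_support hcs
  refine ⟨f, max B 1, by positivity, hc, fun t ht => ?_, fun t ht => ?_, fun t => ?_, fun t => ?_⟩
  · exact f.one_of_mem_closedBall (by simpa [f] using ht)
  · have hnear : (f : ℝ → ℝ) =ᶠ[𝓝 t] fun _ => 0 := by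
      have : ∀ᶠ s in 𝓝 t, 3 / 4 < |s| :=
        continuous_abs.continuousAt.eventually (lt_mem_nhds (by linarith))
      filter_upwards [this] with s hs
      exact f.zero_of_le_dist (by rw [Real.dist_eq, sub_zero]; exact hs.le)
    exact ⟨hnear.eq_of_nhds, by rw [hnear.deriv_eq]; simp⟩
  · rw [abs_of_nonneg f.nonneg]; exact f.le_one
  · exact (hB t).trans (le_max_left _ _)

variable [hI : I.OrdConnected]

/-- Localization of a solution of `u' = A u` to the interval `[m - r, m + r]`. The error made
is of the order of `1 / r` relative to the amplitude of `u`, if `S` is `1 / r`-close to `A` on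
this interval. -/
lemma exists_localized_solution (hS : ContinuousOn S I) {C : ℝ} (hC : ∀ t ∈ I, ‖S t‖ ≤ C)
    {A : EuclideanSpace ℝ ι →L[ℝ] EuclideanSpace ℝ ι} {χ : ℝ → ℝ} {B ρ m r : ℝ}
    (hχ : ContDiff ℝ 1 χ) (hχ0 : ∀ t, 1 ≤ |t| → χ t = 0 ∧ deriv χ t = 0)
    (hχ1 : ∀ t, |χ t| ≤ 1) (hχB : ∀ t, |deriv χ t| ≤ B)
    (hr : 0 < r) (hm : ∀ t ∈ Set.Icc (m - r) (m + r), t ∈ I ∧ r < |t| ∧ ‖S t - A‖ ≤ r⁻¹)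
    {u : ℝ → EuclideanSpace ℝ ι} (hu : ∀ t, HasDerivAt u (A (u t)) t) (huρ : ∀ t, ‖u t‖ ≤ ρ) :
    ∃ p ∈ odeGraph I L T S, (∀ᵐ t ∂(volume.restrict I), p.1 t = χ ((t - m) / r) • u t) ∧
      ‖p.2‖ ^ 2 ≤ (‖(T : EuclideanSpace ℝ ι →L[ℝ] EuclideanSpace ℝ ι)‖ * ((B + 1) * ρ)) ^ 2 *
        (2 / r) ∧
      ∀ᵐ t ∂(volume.restrict I), |t| ≤ r → p.1 t = 0 := by
  let T' : EuclideanSpace ℝ ι →L[ℝ] EuclideanSpace ℝ ι :=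
    (T : EuclideanSpace ℝ ι →L[ℝ] EuclideanSpace ℝ ι)
  have hIm : MeasurableSet I := hI.measurableSet
  have hρ : 0 ≤ ρ := (norm_nonneg _).trans (huρ 0)
  have hB : 0 ≤ B := (abs_nonneg _).trans (hχB 0)
  have hout : ∀ t, t ∉ Set.Icc (m - r) (m + r) → 1 ≤ |(t - m) / r| := by
    intro t ht
    rw [abs_div, abs_of_pos hr, le_div_iff₀ hr, one_mul]
    by_contra hcon
    rw [not_le, abs_lt] at hcon
    exact ht ⟨by linarith, by linarith⟩
  have hucont : Continuous u := continuous_iff_continuousAt.2 fun t => (hu t).continuousAt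
  let z : ℝ → EuclideanSpace ℝ ι := fun t => χ ((t - m) / r) • u t
  let z₁ : ℝ → EuclideanSpace ℝ ι := fun t =>
    (r⁻¹ * deriv χ ((t - m) / r)) • u t + χ ((t - m) / r) • A (u t)
  have hz : ∀ t, HasDerivAt z (z₁ t) t := by
    intro t
    have h1 : HasDerivAt (fun t => (t - m) / r) r⁻¹ t := by
      simpa using ((hasDerivAt_id t).sub_const m).div_const r
    have h2 : HasDerivAt (fun t => χ ((t - m) / r)) (deriv χ ((t - m) / r) * r⁻¹) t :=
      ((hχ.differentiable one_ne_zero) _).hasDerivAt.comp t h1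
    have h3 := h2.smul (hu t)
    refine h3.congr_deriv ?_
    simp only [z₁]
    rw [add_comm, mul_comm]
  have hz1c : Continuous z₁ := by
    have h1 := hχ.continuous_deriv le_rfl
    have h2 := hχ.continuous
    have h3 := A.continuous
    fun_prop
  have hzc : Continuous z := continuous_iff_continuousAt.2 fun t => (hz t).continuousAt
  have hz0 : ∀ t, t ∉ Set.Icc (m - r) (m + r) → z t = 0 ∧ z₁ t = 0 := by
    intro t ht
    obtain ⟨h1, h2⟩ := hχ0 _ (hout t ht)
    simp [z, z₁, h1, h2]
  have hmemLp : ∀ f : ℝ → EuclideanSpace ℝ ι, Continuous f →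
      (∀ t, t ∉ Set.Icc (m - r) (m + r) → f t = 0) → MemLp f 2 (volume.restrict I) :=
    fun f hf h0 => (hf.memLp_of_hasCompactSupport
      (HasCompactSupport.intro isCompact_Icc h0)).mono_measure Measure.restrict_le_self
  have hzW : IsW12 I z z₁ := by
    refine ⟨hmemLp z hzc fun t ht => (hz0 t ht).1, hmemLp z₁ hz1c fun t ht => (hz0 t ht).2,
      fun a _ b _ => ?_⟩
    exact (intervalIntegral.integral_eq_sub_of_hasDerivAt (fun x _ => hz x)
      (hz1c.intervalIntegrable _ _)).symm
  have hyL : MemLp (fun t => T (z₁ t - S t (z t))) 2 (volume.restrict I) :=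
    T'.comp_memLp' (hzW.2.1.sub (memLp_apply hS hC hzW.1))
  have hsmall : ∀ t, |t| ≤ r → z t = 0 := by
    intro t ht
    refine (hz0 t fun hcon => ?_).1
    exact absurd (hm t hcon).2.1 (not_lt.2 ht)
  refine ⟨(hzW.1.toLp z, hyL.toLp _), mem_odeGraph.2 ⟨z, z₁, hzW, ?_, hzW.1.coeFn_toLp,
    hyL.coeFn_toLp⟩, hzW.1.coeFn_toLp, ?_, ?_⟩
  · rw [hsmall 0 (by simpa using hr.le)]; exact L.zero_mem
  · rw [norm_sq_eq_integral]
    set c : ℝ := ‖T'‖ * ((B + 1) * ρ) with hc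
    have hpt : ∀ t ∈ Set.Icc (m - r) (m + r), ‖T (z₁ t - S t (z t))‖ ≤ c * r⁻¹ := by
      intro t ht
      have e : z₁ t - S t (z t) = (r⁻¹ * deriv χ ((t - m) / r)) • u t -
          χ ((t - m) / r) • (S t - A) (u t) := by
        simp only [z₁, z, map_smul, sub_apply, smul_sub]; abel
      have b1 : ‖(r⁻¹ * deriv χ ((t - m) / r)) • u t‖ ≤ (r⁻¹ * B) * ρ := by
        rw [norm_smul, norm_mul, Real.norm_eq_abs, Real.norm_eq_abs, abs_of_pos (inv_pos.2 hr)]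
        gcongr
        · exact hχB _
        · exact huρ t
      have b2 : ‖χ ((t - m) / r) • (S t - A) (u t)‖ ≤ 1 * (r⁻¹ * ρ) := by
        rw [norm_smul]
        gcongr
        · exact hχ1 _
        · exact ((S t - A).le_of_opNorm_le (hm t ht).2.2 _).trans (by gcongr; exact huρ t)
      have b3 : ‖z₁ t - S t (z t)‖ ≤ (B + 1) * ρ * r⁻¹ := by
        rw [e]
        refine (norm_sub_le _ _).trans ((add_le_add b1 b2).trans_eq (by ring))
      calc ‖T' (z₁ t - S t (z t))‖ ≤ ‖T'‖ * ((B + 1) * ρ * r⁻¹) :=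
            T'.le_opNorm_of_le b3
        _ = c * r⁻¹ := by rw [hc]; ring
    have hle : ∀ᵐ t ∂(volume.restrict I), ‖hyL.toLp _ t‖ ^ 2 ≤
        (Set.Icc (m - r) (m + r)).indicator (fun _ => (c * r⁻¹) ^ 2) t := by
      filter_upwards [hyL.coeFn_toLp] with t ht
      rw [ht]
      by_cases h : t ∈ Set.Icc (m - r) (m + r)
      · rw [Set.indicator_of_mem h]
        exact pow_le_pow_left₀ (norm_nonneg _) (hpt t h) 2
      · rw [Set.indicator_of_notMem h, (hz0 t h).1, (hz0 t h).2]
        simp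
    have hind : Integrable ((Set.Icc (m - r) (m + r)).indicator fun _ => (c * r⁻¹) ^ 2) volume :=
      (integrable_indicator_iff measurableSet_Icc).2 (integrableOn_const measure_Icc_lt_top.ne)
    calc ∫ t in I, ‖hyL.toLp _ t‖ ^ 2
        ≤ ∫ t in I, (Set.Icc (m - r) (m + r)).indicator (fun _ => (c * r⁻¹) ^ 2) t :=
          integral_mono_ae (integrable_norm_sq _) hind.integrableOn hle
      _ ≤ ∫ t, (Set.Icc (m - r) (m + r)).indicator (fun _ => (c * r⁻¹) ^ 2) t :=
          setIntegral_le_integral hind (Eventually.of_forall fun t =>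
            Set.indicator_nonneg (fun _ _ => by positivity) t)
      _ = c ^ 2 * (2 / r) := by
          rw [integral_indicator measurableSet_Icc, setIntegral_const, measureReal_def,
            Real.volume_Icc, ENNReal.toReal_ofReal (by linarith), smul_eq_mul]
          field_simp
          ring
  · filter_upwards [hzW.1.coeFn_toLp] with t ht htr
    exact ht.trans (hsmall t htr)

variable [DecidableEq ι]

/-- A matrix which is not hyperbolic has a bounded oscillation `u' = M u` on the line. The
oscillations `u`, `v` are the real and the imaginary part of `exp (i β t) ξ`. -/
lemma exists_oscillation {M : Matrix ι ι ℝ} (hM : ¬ IsHyperbolic M) :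
    ∃ u v : ℝ → EuclideanSpace ℝ ι, ∃ ρ > 0,
      (∀ t, HasDerivAt u (Matrix.toEuclideanCLM (𝕜 := ℝ) M (u t)) t) ∧
      (∀ t, HasDerivAt v (Matrix.toEuclideanCLM (𝕜 := ℝ) M (v t)) t) ∧
      ∀ t, ‖u t‖ ^ 2 + ‖v t‖ ^ 2 = ρ ^ 2 := by
  unfold IsHyperbolic at hM
  push Not at hM
  obtain ⟨μ, hμ, hre⟩ := hM
  rw [← Matrix.spectrum_toLin', ← Module.End.hasEigenvalue_iff_mem_spectrum] at hμ
  obtain ⟨ξ, hξ⟩ := hμ.exists_hasEigenvector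
  have hξ0 : ξ ≠ 0 := hξ.2
  have hξe : (M.map (algebraMap ℝ ℂ)).mulVec ξ = μ • ξ := by
    have := hξ.apply_eq_smul
    rwa [Matrix.toLin'_apply] at this
  set A := Matrix.toEuclideanCLM (𝕜 := ℝ) M with hA
  let a : EuclideanSpace ℝ ι := WithLp.toLp 2 fun i => (ξ i).re
  let b : EuclideanSpace ℝ ι := WithLp.toLp 2 fun i => (ξ i).im
  set β := μ.im with hβ
  have hμ' : ∀ i, ∑ j, ((M i j : ℂ)) * ξ j = μ * ξ i := fun i => congrFun hξe i
  have hAa : A a = (-β) • b := by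
    ext i
    have h := congrArg Complex.re (hμ' i)
    rw [hA, Matrix.ofLp_toEuclideanCLM]
    simpa [Matrix.mulVec, dotProduct, a, b, hre, Complex.re_sum, Complex.mul_re] using h
  have hAb : A b = β • a := by
    ext i
    have h := congrArg Complex.im (hμ' i)
    rw [hA, Matrix.ofLp_toEuclideanCLM]
    simpa [Matrix.mulVec, dotProduct, a, b, hre, Complex.im_sum, Complex.mul_im] using h
  have hcos : ∀ t, HasDerivAt (fun t => Real.cos (β * t)) (-Real.sin (β * t) * β) t := fun t => by
    simpa using ((hasDerivAt_id t).const_mul β).cos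
  have hsin : ∀ t, HasDerivAt (fun t => Real.sin (β * t)) (Real.cos (β * t) * β) t := fun t => by
    simpa using ((hasDerivAt_id t).const_mul β).sin
  have hab : 0 < ‖a‖ ^ 2 + ‖b‖ ^ 2 := by
    by_contra hcon
    have h1 : ‖a‖ ^ 2 + ‖b‖ ^ 2 = 0 := le_antisymm (not_lt.1 hcon) (by positivity)
    have h2 : ‖a‖ = 0 := by nlinarith [sq_nonneg ‖a‖, sq_nonneg ‖b‖]
    have h3 : ‖b‖ = 0 := by nlinarith [sq_nonneg ‖a‖, sq_nonneg ‖b‖]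
    apply hξ0
    funext i
    refine Complex.ext ?_ ?_
    · exact congrArg (fun v : EuclideanSpace ℝ ι => v i) (norm_eq_zero.1 h2)
    · exact congrArg (fun v : EuclideanSpace ℝ ι => v i) (norm_eq_zero.1 h3)
  refine ⟨fun t => Real.cos (β * t) • a - Real.sin (β * t) • b,
    fun t => Real.sin (β * t) • a + Real.cos (β * t) • b, Real.sqrt (‖a‖ ^ 2 + ‖b‖ ^ 2),
    Real.sqrt_pos.2 hab, fun t => ?_, fun t => ?_, fun t => ?_⟩
  · refine (((hcos t).smul_const a).sub ((hsin t).smul_const b)).congr_deriv ?_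
    rw [map_sub, map_smul, map_smul, hAa, hAb]
    module
  · refine (((hsin t).smul_const a).add ((hcos t).smul_const b)).congr_deriv ?_
    rw [map_add, map_smul, map_smul, hAa, hAb]
    module
  · rw [Real.sq_sqrt hab.le, norm_sub_sq_real, norm_add_sq_real]
    simp only [norm_smul, Real.norm_eq_abs, mul_pow, sq_abs, inner_smul_left, inner_smul_right,
      RCLike.conj_to_real]
    linear_combination (‖a‖ ^ 2 + ‖b‖ ^ 2) * Real.sin_sq_add_cos_sq (β * t)

/-- If the operator is Fredholm and `S` has the limit `M` along an end of `I`, then `M` is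
hyperbolic. -/
lemma isHyperbolic_of_fredholm (hS : ContinuousOn S I) {C : ℝ} (hC : ∀ t ∈ I, ‖S t‖ ≤ C)
    {M : Matrix ι ι ℝ}
    (hend : ∀ r : ℝ, 0 < r → ∃ m, ∀ t ∈ Set.Icc (m - r) (m + r),
      t ∈ I ∧ r < |t| ∧ ‖S t - Matrix.toEuclideanCLM (𝕜 := ℝ) M‖ ≤ r⁻¹)
    (hG : IsClosed (odeGraph I L T S : Set (L2 I ι × L2 I ι)))
    (hk : FiniteDimensional ℝ ((odeGraph I L T S).comap (LinearMap.inl ℝ (L2 I ι) (L2 I ι))))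
    (hr : ((odeGraph I L T S).map (LinearMap.snd ℝ (L2 I ι) (L2 I ι))).CoFG) :
    IsHyperbolic M := by
  by_contra hM
  obtain ⟨u, v, ρ, hρ, hu, hv, huv⟩ := exists_oscillation hM
  obtain ⟨χ, B, hB, hχ, hχone, hχ0, hχ1, hχB⟩ := exists_cutoff
  have huρ : ∀ t, ‖u t‖ ≤ ρ := fun t => by
    refine (pow_le_pow_iff_left₀ (norm_nonneg _) hρ.le two_ne_zero).1 ?_
    nlinarith [huv t, sq_nonneg ‖v t‖]
  have hvρ : ∀ t, ‖v t‖ ≤ ρ := fun t => by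
    refine (pow_le_pow_iff_left₀ (norm_nonneg _) hρ.le two_ne_zero).1 ?_
    nlinarith [huv t, sq_nonneg ‖u t‖]
  set τ := ‖(T : EuclideanSpace ℝ ι →L[ℝ] EuclideanSpace ℝ ι)‖ with hτ
  set c := (τ * ((B + 1) * ρ)) ^ 2 with hc
  have key : ∀ r : ℝ, 0 < r → ∃ p ∈ odeGraph I L T S, ‖p.1‖ = 1 ∧
      ‖p.2‖ ^ 2 ≤ 4 * c / ρ ^ 2 * (r⁻¹) ^ 2 ∧
      ∀ᵐ t ∂(volume.restrict I), |t| ≤ r → p.1 t = 0 := by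
    intro r hr0
    obtain ⟨m, hm⟩ := hend r hr0
    obtain ⟨p, hp, hp1, hp2, hp3⟩ := exists_localized_solution (L := L) (T := T) hS hC hχ hχ0 hχ1
      hχB hr0 hm hu huρ
    obtain ⟨q, hq, hq1, hq2, hq3⟩ := exists_localized_solution (L := L) (T := T) hS hC hχ hχ0 hχ1
      hχB hr0 hm hv hvρ
    -- At least one of the two localized oscillations is large.
    have hsum : r * ρ ^ 2 ≤ ‖p.1‖ ^ 2 + ‖q.1‖ ^ 2 := by
      have hsub : Set.Icc (m - r / 2) (m + r / 2) ⊆ I := fun t ht =>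
        (hm t ⟨by linarith [ht.1], by linarith [ht.2]⟩).1
      rw [norm_sq_eq_integral, norm_sq_eq_integral,
        ← integral_add (integrable_norm_sq _) (integrable_norm_sq _)]
      have h1 : ∫ t in Set.Icc (m - r / 2) (m + r / 2), (‖p.1 t‖ ^ 2 + ‖q.1 t‖ ^ 2) ≤
          ∫ t in I, (‖p.1 t‖ ^ 2 + ‖q.1 t‖ ^ 2) :=
        setIntegral_mono_set ((integrable_norm_sq _).add (integrable_norm_sq _))
          (Eventually.of_forall fun t => by positivity) hsub.eventuallyLE
      refine le_trans (le_of_eq ?_) h1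
      have h2 : ∫ t in Set.Icc (m - r / 2) (m + r / 2), (‖p.1 t‖ ^ 2 + ‖q.1 t‖ ^ 2) =
          ∫ t in Set.Icc (m - r / 2) (m + r / 2), ρ ^ 2 := by
        refine integral_congr_ae ?_
        have hle := ae_mono (Measure.restrict_mono hsub (le_refl (volume : Measure ℝ)))
        filter_upwards [hp1.filter_mono hle, hq1.filter_mono hle,
          ae_restrict_mem measurableSet_Icc] with t e1 e2 ht
        have : χ ((t - m) / r) = 1 := by
          refine hχone _ ?_
          rw [abs_div, abs_of_pos hr0, div_le_iff₀ hr0, abs_le]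
          constructor <;> linarith [ht.1, ht.2]
        rw [e1, e2, this, one_smul, one_smul, huv t]
      rw [h2, setIntegral_const, measureReal_def, Real.volume_Icc,
        ENNReal.toReal_ofReal (by linarith), smul_eq_mul]
      ring
    have fin : ∀ p ∈ odeGraph I L T S, r * ρ ^ 2 / 2 ≤ ‖p.1‖ ^ 2 → ‖p.2‖ ^ 2 ≤ c * (2 / r) →
        (∀ᵐ t ∂(volume.restrict I), |t| ≤ r → p.1 t = 0) →
        ∃ p ∈ odeGraph I L T S, ‖p.1‖ = 1 ∧ ‖p.2‖ ^ 2 ≤ 4 * c / ρ ^ 2 * (r⁻¹) ^ 2 ∧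
          ∀ᵐ t ∂(volume.restrict I), |t| ≤ r → p.1 t = 0 := by
      intro p hp h1 h2 h3
      have hpos : 0 < ‖p.1‖ := by
        have : 0 < r * ρ ^ 2 / 2 := by positivity
        exact (norm_nonneg _).lt_of_ne' fun h0 => by
          rw [h0] at h1; linarith [zero_pow (M₀ := ℝ) two_ne_zero]
      refine ⟨‖p.1‖⁻¹ • p, Submodule.smul_mem _ _ hp, ?_, ?_, ?_⟩
      · rw [Prod.smul_fst, norm_smul, norm_inv, norm_norm, inv_mul_cancel₀ hpos.ne']
      · rw [Prod.smul_snd, norm_smul, norm_inv, norm_norm, mul_pow, inv_pow]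
        rw [inv_mul_le_iff₀ (by positivity)]
        have hcc : 0 ≤ c := by positivity
        calc ‖p.2‖ ^ 2 ≤ c * (2 / r) := h2
          _ = r * ρ ^ 2 / 2 * (4 * c / ρ ^ 2 * r⁻¹ ^ 2) := by field_simp; ring
          _ ≤ _ := by gcongr
      · filter_upwards [h3, Lp.coeFn_smul ‖p.1‖⁻¹ p.1] with t h4 h5 ht
        rw [Prod.smul_fst, h5, Pi.smul_apply, h4 ht, smul_zero]
    rcases le_total (r * ρ ^ 2 / 2) (‖p.1‖ ^ 2) with h | h
    · exact fin p hp h hp2 hp3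
    · exact fin q hq (by linarith) hq2 hq3
  choose p hp hp1 hp2 hp3 using fun n : ℕ => key (n + 1) (by positivity)
  refine not_exists_weyl_sequence hG hk hr p hp hp1 ?_ fun n => ?_
  · have h1 : Tendsto (fun n : ℕ => Real.sqrt (4 * c / ρ ^ 2 * (((n : ℝ) + 1)⁻¹) ^ 2)) atTop
        (𝓝 0) := by
      have h2 : Tendsto (fun n : ℕ => ((n : ℝ) + 1)⁻¹) atTop (𝓝 0) := by
        simpa using tendsto_one_div_add_atTop_nhds_zero_nat (𝕜 := ℝ)
      have h3 := ((h2.pow 2).const_mul (4 * c / ρ ^ 2)).sqrt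
      simpa using h3
    exact squeeze_zero (fun n => norm_nonneg _) (fun n => Real.le_sqrt_of_sq_le (hp2 n)) h1
  · filter_upwards [hp3 n] with t h ht
    exact h (ht.trans (by linarith))

end Necessity

/-! ### The coefficient of the Hamiltonian system -/

section Hamiltonian

variable {n : ℕ} {P Q R : ℝ → Matrix (Fin n) (Fin n) ℝ} {I : Set ℝ}

/-- Multiplication by `-J`, as a topological automorphism of `ℝ^{2n}`. -/
noncomputable def negJEquiv (n : ℕ) :
    EuclideanSpace ℝ (Fin n ⊕ Fin n) ≃L[ℝ] EuclideanSpace ℝ (Fin n ⊕ Fin n) :=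
  ContinuousLinearEquiv.equivOfInverse
    (Matrix.toEuclideanCLM (𝕜 := ℝ) (-Matrix.J (Fin n) ℝ))
    (Matrix.toEuclideanCLM (𝕜 := ℝ) (Matrix.J (Fin n) ℝ))
    (fun v => by
      rw [← mul_apply_eq_comp, ← map_mul, mul_neg, Matrix.J_squared, neg_neg, map_one]
      rfl)
    (fun v => by
      rw [← mul_apply_eq_comp, ← map_mul, neg_mul, Matrix.J_squared, neg_neg, map_one]
      rfl)

/-- The coefficient `J B(t)` of the Hamiltonian system `z' = J B(t) z`. -/
noncomputable def hamCoeff (P Q R : ℝ → Matrix (Fin n) (Fin n) ℝ) (t : ℝ) :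
    EuclideanSpace ℝ (Fin n ⊕ Fin n) →L[ℝ] EuclideanSpace ℝ (Fin n ⊕ Fin n) :=
  Matrix.toEuclideanCLM (𝕜 := ℝ) (Matrix.J (Fin n) ℝ * hamMatrix (P t) (Q t) (R t))

lemma negJEquiv_sub_hamCoeff (t : ℝ) (v w : EuclideanSpace ℝ (Fin n ⊕ Fin n)) :
    negJEquiv n (v - hamCoeff P Q R t w) =
      -act (Matrix.J (Fin n) ℝ) v - act (hamMatrix (P t) (Q t) (R t)) w := by
  change Matrix.toEuclideanCLM (𝕜 := ℝ) (-Matrix.J (Fin n) ℝ) (v - hamCoeff P Q R t w) =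
    -Matrix.toEuclideanCLM (𝕜 := ℝ) (Matrix.J (Fin n) ℝ) v -
      Matrix.toEuclideanCLM (𝕜 := ℝ) (hamMatrix (P t) (Q t) (R t)) w
  rw [map_sub, map_neg, neg_apply, hamCoeff, map_mul, neg_apply,
    mul_apply_eq_comp, ← mul_apply_eq_comp
      (Matrix.toEuclideanCLM (𝕜 := ℝ) (Matrix.J (Fin n) ℝ))
      (Matrix.toEuclideanCLM (𝕜 := ℝ) (Matrix.J (Fin n) ℝ)), ← map_mul, Matrix.J_squared,
    map_neg, map_one, neg_apply, one_apply_eq_self, neg_neg, sub_eq_add_neg]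

lemma hamGraph_eq_odeGraph [I.OrdConnected]
    (L : Submodule ℝ (EuclideanSpace ℝ (Fin n ⊕ Fin n))) :
    hamGraph I L P Q R = odeGraph I L (negJEquiv n) (hamCoeff P Q R) := by
  ext x
  rw [mem_odeGraph]
  simp only [negJEquiv_sub_hamCoeff]
  rfl

lemma det_ne_zero_of_lower_bound {M : Matrix (Fin n) (Fin n) ℝ} {C : ℝ} (hC : 0 < C)
    (h : ∀ v, C * ‖v‖ ≤ ‖act M v‖) : M.det ≠ 0 := by
  intro h0
  obtain ⟨v, hv, hMv⟩ := Matrix.exists_mulVec_eq_zero_iff.2 h0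
  have h1 := h (WithLp.toLp 2 v)
  have h2 : act M (WithLp.toLp 2 v) = 0 := by
    ext i
    exact congrFun hMv i
  rw [h2, norm_zero] at h1
  have h3 : ‖WithLp.toLp 2 v‖ = 0 := by nlinarith [norm_nonneg (WithLp.toLp 2 v)]
  exact hv ((WithLp.toLp_eq_zero 2).1 (norm_eq_zero.1 h3))

lemma tendsto_toEuclideanCLM {ι α : Type} [Fintype ι] [DecidableEq ι] {l : Filter α}
    {A : α → Matrix ι ι ℝ} {A₀ : Matrix ι ι ℝ} (h : Tendsto A l (𝓝 A₀)) :
    Tendsto (fun t => Matrix.toEuclideanCLM (𝕜 := ℝ) (A t)) l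
      (𝓝 (Matrix.toEuclideanCLM (𝕜 := ℝ) A₀)) :=
  ((LinearMap.continuous_of_finiteDimensional
    (Matrix.toEuclideanCLM (𝕜 := ℝ) (n := ι)).toAlgEquiv.toLinearMap).tendsto A₀).comp h

/-- The lower bound on `P` persists in the limit. -/
lemma IsCoefficient.det_ne_zero (h : IsCoefficient I P Q R) {l : Filter ℝ} [l.NeBot]
    {P₀ : Matrix (Fin n) (Fin n) ℝ} (hl : ∀ᶠ t in l, t ∈ I) (hP : Tendsto P l (𝓝 P₀)) :
    P₀.det ≠ 0 := by
  obtain ⟨C, hC, hb⟩ := h.lower_P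
  refine det_ne_zero_of_lower_bound hC fun v => ?_
  have h1 : Tendsto (fun t => ‖act (P t) v‖) l (𝓝 ‖act P₀ v‖) :=
    ((ContinuousLinearMap.apply ℝ _ v).continuous.tendsto _ |>.comp
      (tendsto_toEuclideanCLM hP)).norm
  exact ge_of_tendsto h1 (hl.mono fun t ht => hb t ht v)

lemma IsCoefficient.det_ne_zero_of_mem (h : IsCoefficient I P Q R) {t : ℝ} (ht : t ∈ I) :
    (P t).det ≠ 0 :=
  h.det_ne_zero (l := pure t) (by simpa using ht) (tendsto_pure_nhds P t)

/-- The coefficient `J B` depends continuously on `P`, `Q`, `R` where `P` is invertible. -/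
lemma tendsto_hamCoeff {l : Filter ℝ} {P₀ Q₀ R₀ : Matrix (Fin n) (Fin n) ℝ}
    (hP₀ : P₀.det ≠ 0) (hP : Tendsto P l (𝓝 P₀)) (hQ : Tendsto Q l (𝓝 Q₀))
    (hR : Tendsto R l (𝓝 R₀)) :
    Tendsto (hamCoeff P Q R) l (𝓝 (Matrix.toEuclideanCLM (𝕜 := ℝ)
      (Matrix.J (Fin n) ℝ * hamMatrix P₀ Q₀ R₀))) := by
  have hinv : Tendsto (fun t => (P t)⁻¹) l (𝓝 P₀⁻¹) := by
    refine (continuousAt_matrix_inv P₀ ?_).tendsto.comp hP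
    rw [Ring.inverse_eq_inv']
    exact continuousAt_inv₀ hP₀
  have hQt : Tendsto (fun t => (Q t)ᵀ) l (𝓝 Q₀ᵀ) :=
    (continuous_id.matrix_transpose.tendsto Q₀).comp hQ
  have hB : Tendsto (fun t => hamMatrix (P t) (Q t) (R t)) l (𝓝 (hamMatrix P₀ Q₀ R₀)) := by
    have h11 := hinv
    have h12 := (hinv.mul hQ).neg
    have h21 := (hQt.mul hinv).neg
    have h22 := ((hQt.mul hinv).mul hQ).sub hR
    refine tendsto_pi_nhds.2 fun i => tendsto_pi_nhds.2 fun j => ?_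
    rcases i with i | i <;> rcases j with j | j
    · exact tendsto_pi_nhds.1 (tendsto_pi_nhds.1 h11 i) j
    · exact tendsto_pi_nhds.1 (tendsto_pi_nhds.1 h12 i) j
    · exact tendsto_pi_nhds.1 (tendsto_pi_nhds.1 h21 i) j
    · exact tendsto_pi_nhds.1 (tendsto_pi_nhds.1 h22 i) j
  exact tendsto_toEuclideanCLM (tendsto_const_nhds.mul hB)

lemma IsCoefficient.continuousOn_P (h : IsCoefficient I P Q R) : ContinuousOn P I :=
  continuousOn_pi.2 fun i => continuousOn_pi.2 fun j => (h.contDiffOn_P i j).continuousOn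

lemma IsCoefficient.continuousOn_Q (h : IsCoefficient I P Q R) : ContinuousOn Q I :=
  continuousOn_pi.2 fun i => continuousOn_pi.2 fun j => (h.contDiffOn_Q i j).continuousOn

lemma IsCoefficient.continuousOn_R (h : IsCoefficient I P Q R) : ContinuousOn R I :=
  continuousOn_pi.2 fun i => continuousOn_pi.2 fun j => (h.contDiffOn_R i j).continuousOn

lemma IsCoefficient.continuousOn_hamCoeff (h : IsCoefficient I P Q R) :
    ContinuousOn (hamCoeff P Q R) I := fun t ht =>
  tendsto_hamCoeff (h.det_ne_zero_of_mem ht) (h.continuousOn_P t ht) (h.continuousOn_Q t ht)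
    (h.continuousOn_R t ht)

end Hamiltonian

/-! ### Bounds for functions with limits at infinity -/

section AsymptoticallyConstant

variable {E : Type*} [NormedAddCommGroup E] {I : Set ℝ}

lemma exists_bound_Ici {f : ℝ → E} {a : ℝ} {y : E} (hf : ContinuousOn f (Set.Ici a))
    (h : Tendsto f atTop (𝓝 y)) : ∃ C, ∀ t ∈ Set.Ici a, ‖f t‖ ≤ C := by
  obtain ⟨b, hb⟩ := eventually_atTop.1
    (h.norm.eventually (gt_mem_nhds (lt_add_one ‖y‖)))
  obtain ⟨C, hC⟩ := isCompact_Icc.exists_bound_of_continuousOn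
    (s := Set.Icc a b)
    (hf.mono Set.Icc_subset_Ici_self)
  refine ⟨max C (‖y‖ + 1), fun t ht => ?_⟩
  rcases le_total t b with htb | htb
  · exact (hC t ⟨ht, htb⟩).trans (le_max_left _ _)
  · exact (hb t htb).le.trans (le_max_right _ _)

lemma exists_bound_Iic {f : ℝ → E} {a : ℝ} {y : E} (hf : ContinuousOn f (Set.Iic a))
    (h : Tendsto f atBot (𝓝 y)) : ∃ C, ∀ t ∈ Set.Iic a, ‖f t‖ ≤ C := by
  obtain ⟨C, hC⟩ := exists_bound_Ici (f := fun t => f (-t)) (a := -a)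
    (hf.comp continuous_neg.continuousOn fun t ht => neg_le.1 (Set.mem_Ici.1 ht))
    (h.comp tendsto_neg_atTop_atBot)
  refine ⟨C, fun t ht => ?_⟩
  have := hC (-t) (neg_le_neg (Set.mem_Iic.1 ht))
  rwa [neg_neg] at this

lemma exists_bound_univ {f : ℝ → E} {x y : E} (hf : ContinuousOn f Set.univ)
    (hx : Tendsto f atBot (𝓝 x)) (hy : Tendsto f atTop (𝓝 y)) :
    ∃ C, ∀ t ∈ Set.univ, ‖f t‖ ≤ C := by
  obtain ⟨C, hC⟩ := exists_bound_Iic (a := 0) (hf.mono (Set.subset_univ _)) hx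
  obtain ⟨D, hD⟩ := exists_bound_Ici (a := 0) (hf.mono (Set.subset_univ _)) hy
  refine ⟨max C D, fun t _ => ?_⟩
  rcases le_total t 0 with ht | ht
  · exact (hC t ht).trans (le_max_left _ _)
  · exact (hD t ht).trans (le_max_right _ _)

end AsymptoticallyConstant

/-! ### Asymptotically constant systems -/

section FredholmOde

variable {ι : Type} [Fintype ι] {I : Set ℝ}
  {L : Submodule ℝ (EuclideanSpace ℝ ι)} {T : EuclideanSpace ℝ ι ≃L[ℝ] EuclideanSpace ℝ ι}
  {S : ℝ → EuclideanSpace ℝ ι →L[ℝ] EuclideanSpace ℝ ι} {M N : Matrix ι ι ℝ}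

/-- Intervals of any length exist near `+∞` on which `S` is as close to its limit as desired. -/
lemma exists_interval_atTop (hI : Set.Ici 0 ⊆ I)
    {A : EuclideanSpace ℝ ι →L[ℝ] EuclideanSpace ℝ ι} (hlim : Tendsto S atTop (𝓝 A))
    (r : ℝ) (hr : 0 < r) :
    ∃ m, ∀ t ∈ Set.Icc (m - r) (m + r), t ∈ I ∧ r < |t| ∧ ‖S t - A‖ ≤ r⁻¹ := by
  obtain ⟨b, hb⟩ := eventually_atTop.1
    (hlim.eventually (Metric.closedBall_mem_nhds _ (inv_pos.2 hr)))
  refine ⟨max b 0 + 2 * r + 1, fun t ht => ?_⟩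
  have h1 : max b 0 + r + 1 ≤ t := by linarith [ht.1]
  have h2 : 0 ≤ max b 0 := le_max_right _ _
  refine ⟨hI (Set.mem_Ici.2 (by linarith)), lt_of_lt_of_le (by linarith) (le_abs_self t), ?_⟩
  rw [← dist_eq_norm]
  exact hb t (by linarith [le_max_left b 0])

/-- Intervals of any length exist near `-∞` on which `S` is as close to its limit as desired. -/
lemma exists_interval_atBot (hI : Set.Iic 0 ⊆ I)
    {A : EuclideanSpace ℝ ι →L[ℝ] EuclideanSpace ℝ ι} (hlim : Tendsto S atBot (𝓝 A))
    (r : ℝ) (hr : 0 < r) :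
    ∃ m, ∀ t ∈ Set.Icc (m - r) (m + r), t ∈ I ∧ r < |t| ∧ ‖S t - A‖ ≤ r⁻¹ := by
  obtain ⟨b, hb⟩ := eventually_atBot.1
    (hlim.eventually (Metric.closedBall_mem_nhds _ (inv_pos.2 hr)))
  refine ⟨min b 0 - 2 * r - 1, fun t ht => ?_⟩
  have h1 : t ≤ min b 0 - r - 1 := by linarith [ht.2]
  have h2 : min b 0 ≤ 0 := min_le_right _ _
  refine ⟨hI (Set.mem_Iic.2 (by linarith)), lt_of_lt_of_le (by linarith) (neg_le_abs t), ?_⟩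
  rw [← dist_eq_norm]
  exact hb t (by linarith [min_le_left b 0])

variable [DecidableEq ι]

lemma coFG_odeRange_Ici (hS : ContinuousOn S (Set.Ici 0))
    (hlim : Tendsto S atTop (𝓝 (Matrix.toEuclideanCLM (𝕜 := ℝ) M))) (hM : IsHyperbolic M) :
    (odeRange (Set.Ici 0) T S).CoFG := by
  obtain ⟨ε, hε, hsolv⟩ := exists_isSolvable_of_isHyperbolic (S := S) hM
  obtain ⟨b, hb⟩ := eventually_atTop.1 (hlim.eventually (Metric.closedBall_mem_nhds _ hε))
  have hb1 : (0 : ℝ) < max b 1 := lt_max_of_lt_right one_pos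
  refine coFG_odeRange_union (J := Set.Icc 0 (max b 1)) (K := Set.Ici (max b 1))
    (c := max b 1) ⟨hb1.le, le_rfl⟩ Set.self_mem_Ici (Set.Icc_union_Ici_eq_Ici hb1.le).symm
    (fun t ht => ht.2) (fun t ht => ht) ?_ ?_
  · rw [(isSolvable_Icc hb1 (hS.mono Set.Icc_subset_Ici_self)).odeRange_eq_top]
    exact Submodule.CoFG.top
  · rw [(hsolv (Set.Ici (max b 1)) (by simp)
      (hS.mono (Set.Ici_subset_Ici.2 hb1.le)) fun t ht => ?_).odeRange_eq_top]
    · exact Submodule.CoFG.top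
    · rw [← dist_eq_norm]
      exact hb t ((le_max_left _ _).trans ht)

lemma coFG_odeRange_Iic (hS : ContinuousOn S (Set.Iic 0))
    (hlim : Tendsto S atBot (𝓝 (Matrix.toEuclideanCLM (𝕜 := ℝ) M))) (hM : IsHyperbolic M) :
    (odeRange (Set.Iic 0) T S).CoFG := by
  obtain ⟨ε, hε, hsolv⟩ := exists_isSolvable_of_isHyperbolic (S := S) hM
  obtain ⟨b, hb⟩ := eventually_atBot.1 (hlim.eventually (Metric.closedBall_mem_nhds _ hε))
  have hb1 : min b (-1) < 0 := min_lt_of_right_lt (by norm_num)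
  refine coFG_odeRange_union (J := Set.Iic (min b (-1))) (K := Set.Icc (min b (-1)) 0)
    (c := min b (-1)) Set.self_mem_Iic ⟨le_rfl, hb1.le⟩ (Set.Iic_union_Icc_eq_Iic hb1.le).symm
    (fun t ht => ht) (fun t ht => ht.1) ?_ ?_
  · rw [(hsolv (Set.Iic (min b (-1))) (by simp)
      (hS.mono (Set.Iic_subset_Iic.2 hb1.le)) fun t ht => ?_).odeRange_eq_top]
    · exact Submodule.CoFG.top
    · rw [← dist_eq_norm]
      exact hb t (le_trans ht (min_le_left _ _))
  · rw [(isSolvable_Icc hb1 (hS.mono Set.Icc_subset_Iic_self)).odeRange_eq_top]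
    exact Submodule.CoFG.top

end FredholmOde

/-! ### The Fredholm property of the Hamiltonian operator -/

section HamiltonianFredholm

variable {n : ℕ} {P Q R : ℝ → Matrix (Fin n) (Fin n) ℝ}
  {Pm Qm Rm Pp Qp Rp : Matrix (Fin n) (Fin n) ℝ}

lemma nontrivial_Ici : (Set.Ici (0 : ℝ)).Nontrivial :=
  Set.nontrivial_of_lt (x := 0) (y := 1) Set.self_mem_Ici (Set.mem_Ici.2 zero_le_one) one_pos

lemma nontrivial_Iic : (Set.Iic (0 : ℝ)).Nontrivial :=
  Set.nontrivial_of_lt (x := -1) (y := 0) (Set.mem_Iic.2 (by simp)) Set.self_mem_Iic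
    neg_one_lt_zero

lemma isFredholm_hamOp_Ici_iff (L : Submodule ℝ (EuclideanSpace ℝ (Fin n ⊕ Fin n)))
    (h : IsCoefficient (Set.Ici 0) P Q R)
    (hP : Tendsto P atTop (𝓝 Pp)) (hQ : Tendsto Q atTop (𝓝 Qp)) (hR : Tendsto R atTop (𝓝 Rp)) :
    IsFredholm (hamOp (Set.Ici 0) L P Q R) ↔
      IsHyperbolic (Matrix.J (Fin n) ℝ * hamMatrix Pp Qp Rp) := by
  have hS := h.continuousOn_hamCoeff
  have hlim := tendsto_hamCoeff (h.det_ne_zero (eventually_ge_atTop 0) hP) hP hQ hR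
  obtain ⟨C, hC⟩ := exists_bound_Ici hS hlim
  rw [isFredholm_iff_graph, hamOp_graph _ _ _ _ _ nontrivial_Ici,
    hamGraph_eq_odeGraph]
  refine ⟨fun ⟨h1, h2, h3⟩ => isHyperbolic_of_fredholm hS hC
    (exists_interval_atTop subset_rfl hlim) h1 h2 h3, fun hM => ⟨?_, ?_, ?_⟩⟩
  · exact isClosed_odeGraph (by simp) (Or.inl Set.self_mem_Ici) hS hC
  · exact finiteDimensional_ker_odeGraph Set.self_mem_Ici hS hC
  · exact coFG_map_snd_odeGraph (coFG_odeRange_Ici hS hlim hM)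

lemma isFredholm_hamOp_Iic_iff (L : Submodule ℝ (EuclideanSpace ℝ (Fin n ⊕ Fin n)))
    (h : IsCoefficient (Set.Iic 0) P Q R)
    (hP : Tendsto P atBot (𝓝 Pm)) (hQ : Tendsto Q atBot (𝓝 Qm)) (hR : Tendsto R atBot (𝓝 Rm)) :
    IsFredholm (hamOp (Set.Iic 0) L P Q R) ↔
      IsHyperbolic (Matrix.J (Fin n) ℝ * hamMatrix Pm Qm Rm) := by
  have hS := h.continuousOn_hamCoeff
  have hlim := tendsto_hamCoeff (h.det_ne_zero (eventually_le_atBot 0) hP) hP hQ hR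
  obtain ⟨C, hC⟩ := exists_bound_Iic hS hlim
  rw [isFredholm_iff_graph, hamOp_graph _ _ _ _ _ nontrivial_Iic,
    hamGraph_eq_odeGraph]
  refine ⟨fun ⟨h1, h2, h3⟩ => isHyperbolic_of_fredholm hS hC
    (exists_interval_atBot subset_rfl hlim) h1 h2 h3, fun hM => ⟨?_, ?_, ?_⟩⟩
  · exact isClosed_odeGraph (by simp) (Or.inl Set.self_mem_Iic) hS hC
  · exact finiteDimensional_ker_odeGraph Set.self_mem_Iic hS hC
  · exact coFG_map_snd_odeGraph (coFG_odeRange_Iic hS hlim hM)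

lemma isFredholm_hamOp_univ_iff (L : Submodule ℝ (EuclideanSpace ℝ (Fin n ⊕ Fin n)))
    (h : IsCoefficient Set.univ P Q R)
    (hPm : Tendsto P atBot (𝓝 Pm)) (hQm : Tendsto Q atBot (𝓝 Qm)) (hRm : Tendsto R atBot (𝓝 Rm))
    (hPp : Tendsto P atTop (𝓝 Pp)) (hQp : Tendsto Q atTop (𝓝 Qp))
    (hRp : Tendsto R atTop (𝓝 Rp)) :
    IsFredholm (hamOp Set.univ L P Q R) ↔
      IsHyperbolic (Matrix.J (Fin n) ℝ * hamMatrix Pm Qm Rm) ∧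
      IsHyperbolic (Matrix.J (Fin n) ℝ * hamMatrix Pp Qp Rp) := by
  have hS := h.continuousOn_hamCoeff
  have hlimm := tendsto_hamCoeff (h.det_ne_zero (by simp) hPm) hPm hQm hRm
  have hlimp := tendsto_hamCoeff (h.det_ne_zero (by simp) hPp) hPp hQp hRp
  obtain ⟨C, hC⟩ := exists_bound_univ hS hlimm hlimp
  rw [isFredholm_iff_graph, hamOp_graph _ _ _ _ _ Set.nontrivial_univ, hamGraph_eq_odeGraph]
  refine ⟨fun ⟨h1, h2, h3⟩ => ⟨isHyperbolic_of_fredholm hS hC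
    (exists_interval_atBot (Set.subset_univ _) hlimm) h1 h2 h3, isHyperbolic_of_fredholm hS hC
    (exists_interval_atTop (Set.subset_univ _) hlimp) h1 h2 h3⟩, fun ⟨hMm, hMp⟩ => ⟨?_, ?_, ?_⟩⟩
  · exact isClosed_odeGraph (by simp) (Or.inl (Set.mem_univ _)) hS hC
  · exact finiteDimensional_ker_odeGraph (Set.mem_univ _) hS hC
  · exact coFG_map_snd_odeGraph (coFG_odeRange_union (J := Set.Iic 0) (K := Set.Ici 0) (c := 0)
      Set.self_mem_Iic Set.self_mem_Ici Set.Iic_union_Ici.symm (fun t ht => ht) (fun t ht => ht)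
      (coFG_odeRange_Iic (hS.mono (Set.subset_univ _)) hlimm hMm)
      (coFG_odeRange_Ici (hS.mono (Set.subset_univ _)) hlimp hMp))

end HamiltonianFredholm

/-! ### Smooth majorants -/

section Majorant

variable {ι : Type} [Fintype ι] {I : Set ℝ}

lemma expConv_nonneg (l : ℝ) {g : ℝ → ℝ} (hg : ∀ t, 0 ≤ g t) (t : ℝ) : 0 ≤ expConv l g t :=
  integral_nonneg fun s => smul_nonneg (Real.exp_pos _).le (hg s)

/-- On the window `[t - 1, t]` the kernel of the exponential average is at least `exp (-1)`. -/
lemma integral_le_exp_mul_expConv {g : ℝ → ℝ} (hg : MemLp g 2 volume) (hg0 : ∀ t, 0 ≤ g t)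
    (t : ℝ) : ∫ s in (t - 1)..t, g s ≤ Real.exp 1 * expConv 1 g t := by
  have hsub : Set.Ioc (t - 1) t ⊆ Set.Iic t := fun s hs => hs.2
  have hint := integrableOn_expConv one_pos hg t
  have hgi : IntegrableOn g (Set.Ioc (t - 1) t) := by
    have := intervalIntegrable_of_memLp (I := Set.univ) (by rwa [Measure.restrict_univ])
      (Set.mem_univ (t - 1)) (Set.mem_univ t)
    rwa [intervalIntegrable_iff_integrableOn_Ioc_of_le (by linarith)] at this
  rw [intervalIntegral.integral_of_le (by linarith), expConv, ← integral_const_mul]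
  calc ∫ s in Set.Ioc (t - 1) t, g s
      ≤ ∫ s in Set.Ioc (t - 1) t, Real.exp 1 * (Real.exp (-(1 * (t - s))) • g s) := by
        refine setIntegral_mono_on hgi ((hint.mono_set hsub).const_mul _) measurableSet_Ioc
          fun s hs => ?_
        rw [smul_eq_mul, ← mul_assoc, ← Real.exp_add]
        exact le_mul_of_one_le_left (hg0 s) (Real.one_le_exp (by linarith [hs.1]))
    _ ≤ _ := setIntegral_mono_set (hint.const_mul _)
        (Eventually.of_forall fun s => mul_nonneg (Real.exp_pos _).le
          (smul_nonneg (Real.exp_pos _).le (hg0 s))) hsub.eventuallyLE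

/-- The majorant is `φ = a + b`, where `a' = g - a` and `b' = b - g` are the two-sided
exponential averages of `g`; it is of class `W^{2,2}`, since `φ' = b - a` and
`φ'' = φ - 2 g`. -/
lemma exists_smooth_majorant {g : ℝ → ℝ} (hg : MemLp g 2 volume) (hg0 : ∀ t, 0 ≤ g t) :
    ∃ φ φ₁ φ₂ : ℝ → ℝ, MemLp φ 2 volume ∧ MemLp φ₁ 2 volume ∧ MemLp φ₂ 2 volume ∧
      IsPrimitiveOn Set.univ φ φ₁ ∧ IsPrimitiveOn Set.univ φ₁ φ₂ ∧ (∀ t, |φ₁ t| ≤ φ t) ∧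
      (∀ t, ∫ s in (t - 1)..t, g s ≤ Real.exp 1 * φ t) ∧
      ∀ t, ∫ s in t..(t + 1), g s ≤ Real.exp 1 * φ t := by
  have hg' : MemLp (fun t => g (-t)) 2 volume := memLp_comp_neg hg
  set a : ℝ → ℝ := expConv 1 g with ha
  set b : ℝ → ℝ := fun t => expConv 1 (fun s => g (-s)) (-t) with hb
  have ha0 : ∀ t, 0 ≤ a t := expConv_nonneg 1 hg0
  have hb0 : ∀ t, 0 ≤ b t := fun t => expConv_nonneg 1 (fun s => hg0 (-s)) (-t)
  have haL : MemLp a 2 volume := memLp_expConv one_pos hg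
  have hbL : MemLp b 2 volume := memLp_comp_neg (memLp_expConv one_pos hg')
  have hap : IsPrimitiveOn Set.univ a (fun t => -a t + g t) :=
    (isPrimitiveOn_expConv one_pos hg).congr (fun _ _ => rfl) fun t _ => by simp [ha]
  have hbp : IsPrimitiveOn Set.univ b (fun t => b t - g t) :=
    (isPrimitiveOn_expConv one_pos hg').comp_neg.congr (fun _ _ => rfl) fun t _ => by
      simp [hb]; ring
  have hap' : IsPrimitiveOn Set.univ (fun t => -a t) (fun t => a t - g t) :=
    (hap.clm (-ContinuousLinearMap.id ℝ ℝ)).congr (fun _ _ => rfl) fun t _ => by simp; ring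
  refine ⟨fun t => a t + b t, fun t => -a t + b t, fun t => (a t - g t) + (b t - g t),
    haL.add hbL, haL.neg.add hbL, (haL.sub hg).add (hbL.sub hg),
    (hap.add hbp).congr (fun _ _ => rfl) (fun t _ => by ring), hap'.add hbp, fun t => ?_,
    fun t => ?_, fun t => ?_⟩
  · rw [abs_le]
    constructor <;> linarith [ha0 t, hb0 t]
  · refine (integral_le_exp_mul_expConv hg hg0 t).trans ?_
    gcongr
    linarith [hb0 t]
  · have h1 := integral_le_exp_mul_expConv hg' (fun s => hg0 (-s)) (-t)
    rw [intervalIntegral.integral_comp_neg, neg_neg, neg_sub, sub_neg_eq_add, add_comm 1 t] at h1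
    refine h1.trans ?_
    gcongr
    linarith [ha0 t]

/-- Sobolev inequality on an interval of unit length. -/
lemma norm_le_integral_add {u v : ℝ → EuclideanSpace ℝ ι} {a : ℝ}
    (hu : IsPrimitiveOn (Set.Icc a (a + 1)) u v) {t : ℝ} (ht : t ∈ Set.Icc a (a + 1)) :
    ‖u t‖ ≤ ∫ s in a..(a + 1), (‖u s‖ + ‖v s‖) := by
  have hle : a ≤ a + 1 := by linarith
  have ha : a ∈ Set.Icc a (a + 1) := Set.left_mem_Icc.2 hle
  have hb : a + 1 ∈ Set.Icc a (a + 1) := Set.right_mem_Icc.2 hle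
  have hvi := (hu a ha _ hb).1.norm
  have hui : IntervalIntegrable (fun s => ‖u s‖) volume a (a + 1) :=
    (hu.continuousOn ha hb).norm.intervalIntegrable
  have hpt : ∀ s ∈ Set.Icc a (a + 1), ‖u t‖ ≤ ‖u s‖ + ∫ r in a..(a + 1), ‖v r‖ := by
    intro s hs
    have h1 := (hu s hs t ht).2
    have h2 : ‖u t - u s‖ ≤ ∫ r in a..(a + 1), ‖v r‖ := by
      rw [h1]
      refine intervalIntegral.norm_integral_le_integral_norm_uIoc.trans ?_
      rw [intervalIntegral.integral_of_le hle]
      refine setIntegral_mono_set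
        ((intervalIntegrable_iff_integrableOn_Ioc_of_le hle).1 hvi)
        (Eventually.of_forall fun _ => norm_nonneg _) (LE.le.eventuallyLE ?_)
      exact fun r hr => ⟨(le_min hs.1 ht.1).trans_lt hr.1, hr.2.trans (max_le hs.2 ht.2)⟩
    calc ‖u t‖ = ‖u s + (u t - u s)‖ := by rw [add_sub_cancel]
      _ ≤ _ := (norm_add_le _ _).trans (by gcongr)
  have h3 := intervalIntegral.integral_mono_on hle
    (f := fun _ => ‖u t‖) (g := fun s => ‖u s‖ + ∫ r in a..(a + 1), ‖v r‖)
    (by simp) (hui.add (by simp)) hpt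
  rw [intervalIntegral.integral_add hui (by simp), intervalIntegral.integral_const,
    intervalIntegral.integral_const] at h3
  rw [intervalIntegral.integral_add hui hvi]
  simpa using h3

/-- A function in `W^{1,2}(I)` is dominated by a scalar function of class `W^{2,2}` on the line
which dominates its own derivative. Each point of `I` has to belong to an interval of unit length
in `I`. -/
lemma IsW12.exists_majorant [hI : I.OrdConnected]
    (hthick : ∀ t ∈ I, Set.Icc t (t + 1) ⊆ I ∨ Set.Icc (t - 1) t ⊆ I)
    {u v : ℝ → EuclideanSpace ℝ ι} (h : IsW12 I u v) :
    ∃ φ φ₁ φ₂ : ℝ → ℝ, MemLp φ 2 volume ∧ MemLp φ₁ 2 volume ∧ MemLp φ₂ 2 volume ∧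
      IsPrimitiveOn Set.univ φ φ₁ ∧ IsPrimitiveOn Set.univ φ₁ φ₂ ∧ (∀ t, |φ₁ t| ≤ φ t) ∧
      ∀ t ∈ I, ‖u t‖ ≤ Real.exp 1 * φ t := by
  set g : ℝ → ℝ := I.indicator fun t => ‖u t‖ + ‖v t‖ with hg
  have hgL : MemLp g 2 volume := memLp_indicator_of_restrict (h.1.norm.add h.2.1.norm)
  have hg0 : ∀ t, 0 ≤ g t := Set.indicator_nonneg fun t _ => by positivity
  obtain ⟨φ, φ₁, φ₂, h0, h1, h2, hp1, hp2, hle, hb1, hb2⟩ := exists_smooth_majorant hgL hg0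
  refine ⟨φ, φ₁, φ₂, h0, h1, h2, hp1, hp2, hle, fun t ht => ?_⟩
  have key : ∀ a, Set.Icc a (a + 1) ⊆ I → t ∈ Set.Icc a (a + 1) →
      ‖u t‖ ≤ ∫ s in a..(a + 1), g s := by
    intro a ha hta
    refine (norm_le_integral_add (h.isPrimitiveOn.mono ha) hta).trans_eq ?_
    refine intervalIntegral.integral_congr fun s hs => ?_
    rw [Set.uIcc_of_le (by linarith)] at hs
    rw [hg, Set.indicator_of_mem (ha hs)]
  rcases hthick t ht with hs | hs
  · exact (key t hs ⟨le_rfl, by linarith⟩).trans (hb2 t)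
  · have e : t - 1 + 1 = t := by ring
    have := key (t - 1) (by rwa [e]) ⟨by linarith, by linarith⟩
    rw [e] at this
    exact this.trans (hb1 t)

end Majorant

/-! ### Integrability of the derivatives of the coefficients -/

section CoefficientDerivatives

variable {n : ℕ} {ι : Type} [Fintype ι] {I : Set ℝ}
  {P Q : ℝ → Matrix (Fin n) (Fin n) ℝ}

lemma isPrimitiveOn_of_hasDerivAt {c c' : ℝ → ℝ} (h : ∀ t, HasDerivAt c (c' t) t)
    (hc' : Continuous c') : IsPrimitiveOn I c c' := fun a _ b _ =>
  ⟨hc'.intervalIntegrable a b, (intervalIntegral.integral_eq_sub_of_hasDerivAt (fun t _ => h t)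
    (hc'.intervalIntegrable a b)).symm⟩

lemma memLp_smul_of_abs_le_one {G : Type*} [NormedAddCommGroup G] [NormedSpace ℝ G] {c : ℝ → ℝ}
    {f : ℝ → G} {μ : Measure ℝ}
    (hc : Continuous c) (hc1 : ∀ t, |c t| ≤ 1) (hf : MemLp f 2 μ) :
    MemLp (fun t => c t • f t) 2 μ := by
  refine hf.of_le (hc.aestronglyMeasurable.smul hf.1) (Eventually.of_forall fun t => ?_)
  rw [norm_smul]
  exact mul_le_of_le_one_left (norm_nonneg _) (hc1 t)

/-- The path of operators on `ℝⁿ` given by a path of matrices. -/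
noncomputable def opPath (P : ℝ → Matrix (Fin n) (Fin n) ℝ) (t : ℝ) :
    EuclideanSpace ℝ (Fin n) →L[ℝ] EuclideanSpace ℝ (Fin n) :=
  Matrix.toEuclideanCLM (𝕜 := ℝ) (P t)

lemma contDiffOn_opPath (h : ∀ i j, ContDiffOn ℝ 1 (fun t => P t i j) I) :
    ContDiffOn ℝ 1 (opPath P) I := by
  have e : opPath P = fun t => ∑ i, ∑ j, P t i j •
      Matrix.toEuclideanCLM (𝕜 := ℝ) (Matrix.single i j (1 : ℝ)) := by
    funext t
    rw [opPath]
    conv_lhs => rw [Matrix.matrix_eq_sum_single (P t)]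
    simp only [map_sum, ← map_smul, Matrix.smul_single, smul_eq_mul, mul_one]
  rw [e]
  exact ContDiffOn.sum fun i _ => ContDiffOn.sum fun j _ => (h i j).smul contDiffOn_const

variable [hI : I.OrdConnected]

/-- If `φ N e` is square integrable for each constant vector `e`, then so is `N v` for each
function `v` dominated by `φ`. -/
lemma memLp_apply_of_majorant {N : ℝ → EuclideanSpace ℝ ι →L[ℝ] EuclideanSpace ℝ ι}
    (hN : ContinuousOn N I) {φ : ℝ → ℝ}
    (hφ : ∀ e, MemLp (fun t => φ t • N t e) 2 (volume.restrict I)) {v : ℝ → EuclideanSpace ℝ ι}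
    (hv : AEStronglyMeasurable v (volume.restrict I)) {K : ℝ} (hK : 0 ≤ K)
    (hvφ : ∀ t ∈ I, ‖v t‖ ≤ K * φ t) :
    MemLp (fun t => N t (v t)) 2 (volume.restrict I) := by
  classical
  have hsum : ∀ t, N t (v t) = ∑ j, v t j • N t (EuclideanSpace.basisFun ι ℝ j) := by
    intro t
    conv_lhs => rw [← (EuclideanSpace.basisFun ι ℝ).sum_repr (v t), map_sum]
    simp
  simp only [hsum]
  refine memLp_finsetSum _ fun j _ => ?_
  have hvj : AEStronglyMeasurable (fun t => v t j) (volume.restrict I) :=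
    (EuclideanSpace.proj (𝕜 := ℝ) j).continuous.comp_aestronglyMeasurable hv
  have hNj : AEStronglyMeasurable (fun t => N t (EuclideanSpace.basisFun ι ℝ j))
      (volume.restrict I) :=
    (hN.clm_apply continuousOn_const).aestronglyMeasurable hI.measurableSet
  refine (hφ (EuclideanSpace.basisFun ι ℝ j)).of_le_mul (c := K) (hvj.smul hNj) ?_
  filter_upwards [ae_restrict_mem hI.measurableSet] with t ht
  rw [norm_smul, norm_smul, ← mul_assoc]
  gcongr
  calc ‖v t j‖ ≤ ‖v t‖ := PiLp.norm_apply_le (v t) j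
    _ ≤ K * φ t := hvφ t ht
    _ ≤ K * ‖φ t‖ := by gcongr; exact le_abs_self _

/-- If the expression maps `W^{2,2}` into `L²`, then for each `f e` in `W^{2,2}`, with `f` scalar
and `e` a constant vector, `f' P' e + f Q' e` is square integrable. -/
lemma memLp_deriv_apply_of_maps (hU : UniqueDiffOn ℝ I) (hP : ContDiffOn ℝ 1 (opPath P) I)
    (hQ : ContDiffOn ℝ 1 (opPath Q) I) {C : ℝ} (hPC : ∀ t ∈ I, ‖opPath P t‖ ≤ C)
    (hQC : ∀ t ∈ I, ‖opPath Q t‖ ≤ C) (hmap : MapsW22IntoL2 I P Q) {f f₁ f₂ : ℝ → ℝ}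
    (hf : MemLp f 2 volume) (hf₁ : MemLp f₁ 2 volume) (hf₂ : MemLp f₂ 2 volume)
    (hp : IsPrimitiveOn I f f₁) (hp₁ : IsPrimitiveOn I f₁ f₂) (e : EuclideanSpace ℝ (Fin n)) :
    MemLp (fun t => f₁ t • derivWithin (opPath P) I t e + f t • derivWithin (opPath Q) I t e) 2
      (volume.restrict I) := by
  have hL : ∀ {g : ℝ → ℝ}, MemLp g 2 volume → MemLp (fun t => g t • e) 2 (volume.restrict I) :=
    fun hg => (ContinuousLinearMap.toSpanSingleton ℝ e).comp_memLp'
      (hg.mono_measure Measure.restrict_le_self)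
  have hpr : ∀ {g g' : ℝ → ℝ}, IsPrimitiveOn I g g' →
      IsPrimitiveOn I (fun t => g t • e) (fun t => g' t • e) :=
    fun hg => hg.clm (ContinuousLinearMap.toSpanSingleton ℝ e)
  obtain ⟨q, hq⟩ := hmap (fun t => f t • e) (fun t => f₁ t • e) (fun t => f₂ t • e)
    ⟨(hpr hp).isW12 (hL hf) (hL hf₁), (hpr hp₁).isW12 (hL hf₁) (hL hf₂)⟩
  have hprod := ((isPrimitiveOn_of_contDiffOn hU hP).bilin (ContinuousLinearMap.id ℝ _)
    (hpr hp₁)).add ((isPrimitiveOn_of_contDiffOn hU hQ).bilin (ContinuousLinearMap.id ℝ _) (hpr hp))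
  have hae := hq.isPrimitiveOn.ae_eq hprod
  refine ((hq.2.1.sub (memLp_apply hP.continuousOn hPC (hL hf₂))).sub
    (memLp_apply hQ.continuousOn hQC (hL hf₁))).ae_eq ?_
  filter_upwards [hae] with t ht
  simp only [Pi.sub_apply, ht, ContinuousLinearMap.id_apply, map_smul]
  abel

/-- The derivatives of `P` and `Q` need not be bounded, but they map functions dominated by an
element of `W^{1,2}` to square integrable functions. To isolate `φ P' e`, the hypothesis is
applied to `φ cos t e` and to `φ sin t e`, where `φ` is a majorant. -/
lemma memLp_derivWithin_apply (hU : UniqueDiffOn ℝ I)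
    (hthick : ∀ t ∈ I, Set.Icc t (t + 1) ⊆ I ∨ Set.Icc (t - 1) t ⊆ I)
    (hP : ContDiffOn ℝ 1 (opPath P) I)
    (hQ : ContDiffOn ℝ 1 (opPath Q) I) {C : ℝ} (hPC : ∀ t ∈ I, ‖opPath P t‖ ≤ C)
    (hQC : ∀ t ∈ I, ‖opPath Q t‖ ≤ C) (hmap : MapsW22IntoL2 I P Q)
    {z z₁ : ℝ → EuclideanSpace ℝ ι} (hz : IsW12 I z z₁) {v : ℝ → EuclideanSpace ℝ (Fin n)}
    (hv : AEStronglyMeasurable v (volume.restrict I)) {K : ℝ} (hK : 0 ≤ K)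
    (hvz : ∀ t ∈ I, ‖v t‖ ≤ K * ‖z t‖) :
    MemLp (fun t => derivWithin (opPath P) I t (v t)) 2 (volume.restrict I) ∧
      MemLp (fun t => derivWithin (opPath Q) I t (v t)) 2 (volume.restrict I) := by
  obtain ⟨φ, φ₁, φ₂, hφ, hφ₁, hφ₂, hp, hp₁, hle, hzφ⟩ := hz.exists_majorant hthick
  replace hp := hp.mono (Set.subset_univ I)
  replace hp₁ := hp₁.mono (Set.subset_univ I)
  have hP' : ContinuousOn (derivWithin (opPath P) I) I := hP.continuousOn_derivWithin hU le_rfl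
  have hQ' : ContinuousOn (derivWithin (opPath Q) I) I := hQ.continuousOn_derivWithin hU le_rfl
  have hbdd : ∀ {c g : ℝ → ℝ}, Continuous c → (∀ t, |c t| ≤ 1) → MemLp g 2 volume →
      MemLp (fun t => c t * g t) 2 volume := fun hc hc1 hg => memLp_smul_of_abs_le_one hc hc1 hg
  have hmul : ∀ {c c' g g' : ℝ → ℝ}, (∀ t, HasDerivAt c (c' t) t) → Continuous c' →
      IsPrimitiveOn I g g' →
      IsPrimitiveOn I (fun t => c t * g t) (fun t => c' t * g t + c t * g' t) :=
    fun hc hc' hg => (isPrimitiveOn_of_hasDerivAt hc hc').bilin (ContinuousLinearMap.mul ℝ ℝ) hg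
  have hcos := Real.continuous_cos
  have hsin := Real.continuous_sin
  have hsin' : ∀ t, |-Real.sin t| ≤ 1 := fun t => by rw [abs_neg]; exact Real.abs_sin_le_one t
  have hcos' : ∀ t, |-Real.cos t| ≤ 1 := fun t => by rw [abs_neg]; exact Real.abs_cos_le_one t
  have dcos := Real.hasDerivAt_cos
  have dsin := Real.hasDerivAt_sin
  have dnsin : ∀ t, HasDerivAt (fun t => -Real.sin t) (-Real.cos t) t := fun t => (dsin t).neg
  have hPe : ∀ e, MemLp (fun t => φ t • derivWithin (opPath P) I t e) 2 (volume.restrict I) ∧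
      MemLp (fun t => φ₁ t • derivWithin (opPath P) I t e + φ t • derivWithin (opPath Q) I t e) 2
        (volume.restrict I) := by
    intro e
    have h1 := memLp_deriv_apply_of_maps hU hP hQ hPC hQC hmap
      (hbdd hcos Real.abs_cos_le_one hφ)
      ((hbdd hsin.neg hsin' hφ).add (hbdd hcos Real.abs_cos_le_one hφ₁))
      (((hbdd hcos.neg hcos' hφ).add (hbdd hsin.neg hsin' hφ₁)).add
        ((hbdd hsin.neg hsin' hφ₁).add (hbdd hcos Real.abs_cos_le_one hφ₂)))
      (hmul dcos hsin.neg hp) ((hmul dnsin hcos.neg hp).add (hmul dcos hsin.neg hp₁)) e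
    have h2 := memLp_deriv_apply_of_maps hU hP hQ hPC hQC hmap
      (hbdd hsin Real.abs_sin_le_one hφ)
      ((hbdd hcos Real.abs_cos_le_one hφ).add (hbdd hsin Real.abs_sin_le_one hφ₁))
      (((hbdd hsin.neg hsin' hφ).add (hbdd hcos Real.abs_cos_le_one hφ₁)).add
        ((hbdd hcos Real.abs_cos_le_one hφ₁).add (hbdd hsin Real.abs_sin_le_one hφ₂)))
      (hmul dsin hcos hp) ((hmul dcos hsin.neg hp).add (hmul dsin hcos hp₁)) e
    constructor
    · refine ((memLp_smul_of_abs_le_one hsin.neg hsin' h1).add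
        (memLp_smul_of_abs_le_one hcos Real.abs_cos_le_one h2)).ae_eq
        (Eventually.of_forall fun t => ?_)
      simp only [Pi.add_apply, Pi.neg_apply]
      linear_combination (norm := module)
        (Real.sin_sq_add_cos_sq t) • (φ t • derivWithin (opPath P) I t e)
    · refine ((memLp_smul_of_abs_le_one hcos Real.abs_cos_le_one h1).add
        (memLp_smul_of_abs_le_one hsin Real.abs_sin_le_one h2)).ae_eq
        (Eventually.of_forall fun t => ?_)
      simp only [Pi.add_apply, Pi.neg_apply]
      linear_combination (norm := module) (Real.sin_sq_add_cos_sq t) •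
        (φ₁ t • derivWithin (opPath P) I t e + φ t • derivWithin (opPath Q) I t e)
  have hQe : ∀ e, MemLp (fun t => φ t • derivWithin (opPath Q) I t e) 2 (volume.restrict I) := by
    intro e
    have h1 : MemLp (fun t => φ₁ t • derivWithin (opPath P) I t e) 2 (volume.restrict I) := by
      refine (hPe e).1.of_le ((hφ₁.1.mono_measure Measure.restrict_le_self).smul
        ((hP'.clm_apply continuousOn_const).aestronglyMeasurable hI.measurableSet))
        (Eventually.of_forall fun t => ?_)
      rw [norm_smul, norm_smul]
      gcongr
      exact (hle t).trans (le_abs_self _)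
    refine ((hPe e).2.sub h1).ae_eq (Eventually.of_forall fun t => ?_)
    simp
  have hvφ : ∀ t ∈ I, ‖v t‖ ≤ (K * Real.exp 1) * φ t := fun t ht =>
    (hvz t ht).trans (by rw [mul_assoc]; gcongr; exact hzφ t ht)
  exact ⟨memLp_apply_of_majorant hP' (fun e => (hPe e).1) hv (by positivity) hvφ,
    memLp_apply_of_majorant hQ' hQe hv (by positivity) hvφ⟩

end CoefficientDerivatives

/-! ### The Hamiltonian expression in components -/

section Pairs

variable {n : ℕ} {I : Set ℝ}

/-- The first component of a vector of `ℝ^{2n}`. -/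
noncomputable def pairFst (n : ℕ) :
    EuclideanSpace ℝ (Fin n ⊕ Fin n) →L[ℝ] EuclideanSpace ℝ (Fin n) :=
  LinearMap.toContinuousLinearMap
    { toFun := fun z => WithLp.toLp 2 fun i => z (Sum.inl i)
      map_add' := fun _ _ => rfl
      map_smul' := fun _ _ => rfl }

/-- The second component of a vector of `ℝ^{2n}`. -/
noncomputable def pairSnd (n : ℕ) :
    EuclideanSpace ℝ (Fin n ⊕ Fin n) →L[ℝ] EuclideanSpace ℝ (Fin n) :=
  LinearMap.toContinuousLinearMap
    { toFun := fun z => WithLp.toLp 2 fun i => z (Sum.inr i)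
      map_add' := fun _ _ => rfl
      map_smul' := fun _ _ => rfl }

/-- The inclusion `p ↦ (p, 0)`. -/
noncomputable def pairInl (n : ℕ) :
    EuclideanSpace ℝ (Fin n) →L[ℝ] EuclideanSpace ℝ (Fin n ⊕ Fin n) :=
  LinearMap.toContinuousLinearMap
    { toFun := fun p => pair p 0
      map_add' := fun p q => by rw [← pair_add, add_zero]
      map_smul' := fun c p => by rw [RingHom.id_apply, ← pair_smul, smul_zero] }

/-- The inclusion `q ↦ (0, q)`. -/
noncomputable def pairInr (n : ℕ) :
    EuclideanSpace ℝ (Fin n) →L[ℝ] EuclideanSpace ℝ (Fin n ⊕ Fin n) :=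
  LinearMap.toContinuousLinearMap
    { toFun := fun q => pair 0 q
      map_add' := fun p q => by rw [← pair_add, add_zero]
      map_smul' := fun c p => by rw [RingHom.id_apply, ← pair_smul, smul_zero] }

lemma pairFst_pair (p q : EuclideanSpace ℝ (Fin n)) : pairFst n (pair p q) = p := rfl

lemma pairSnd_pair (p q : EuclideanSpace ℝ (Fin n)) : pairSnd n (pair p q) = q := rfl

lemma pair_fst_snd (z : EuclideanSpace ℝ (Fin n ⊕ Fin n)) :
    pair (pairFst n z) (pairSnd n z) = z := by
  ext i; rcases i with i | i <;> rfl

lemma pairInl_add_pairInr (p q : EuclideanSpace ℝ (Fin n)) :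
    pairInl n p + pairInr n q = pair p q := by
  change pair p 0 + pair 0 q = pair p q
  rw [← pair_add, add_zero, zero_add]

lemma pair_sub (p q p' q' : EuclideanSpace ℝ (Fin n)) :
    pair p q - pair p' q' = pair (p - p') (q - q') := by
  ext i; rcases i with i | i <;> rfl

lemma pair_neg (p q : EuclideanSpace ℝ (Fin n)) : -pair p q = pair (-p) (-q) := by
  ext i; rcases i with i | i <;> rfl

lemma act_fromBlocks (A B C D : Matrix (Fin n) (Fin n) ℝ) (p q : EuclideanSpace ℝ (Fin n)) :
    act (Matrix.fromBlocks A B C D) (pair p q) =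
      pair (act A p + act B q) (act C p + act D q) := by
  ext i
  rcases i with i | i <;> simp [pair, Matrix.fromBlocks_mulVec, Matrix.toLpLin_apply]

lemma act_mul (A B : Matrix (Fin n) (Fin n) ℝ) (v : EuclideanSpace ℝ (Fin n)) :
    act (A * B) v = act A (act B v) := by
  ext i
  simp [Matrix.toLpLin_apply, Matrix.mulVec_mulVec]

/-- The Hamiltonian expression in components. -/
lemma hamExpr_pair (P Q R : Matrix (Fin n) (Fin n) ℝ) (p₁ w₁ p w : EuclideanSpace ℝ (Fin n)) :
    -act (Matrix.J (Fin n) ℝ) (pair p₁ w₁) - act (hamMatrix P Q R) (pair p w) =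
      pair (w₁ - act P⁻¹ (p - act Q w))
        (-p₁ + act Qᵀ (act P⁻¹ (p - act Q w)) + act R w) := by
  have e0 : act (0 : Matrix (Fin n) (Fin n) ℝ) = 0 := map_zero _
  have e1 : ∀ v, act (1 : Matrix (Fin n) (Fin n) ℝ) v = v := fun v => by
    ext i; simp
  have en : ∀ (A : Matrix (Fin n) (Fin n) ℝ) v, act (-A) v = -act A v := fun A v => by
    rw [act, map_neg]; rfl
  have es : ∀ (A B : Matrix (Fin n) (Fin n) ℝ) v, act (A - B) v = act A v - act B v :=
    fun A B v => by rw [act, map_sub]; rfl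
  rw [Matrix.J, hamMatrix, act_fromBlocks, act_fromBlocks, pair_neg, pair_sub]
  simp only [e0, e1, en, es, act_mul, LinearMap.zero_apply]
  simp only [map_sub]
  congr 1 <;> abel

lemma IsW12.clm {ι κ : Type} [Fintype ι] [Fintype κ] [I.OrdConnected]
    {u v : ℝ → EuclideanSpace ℝ ι} (h : IsW12 I u v)
    (T : EuclideanSpace ℝ ι →L[ℝ] EuclideanSpace ℝ κ) :
    IsW12 I (fun t => T (u t)) (fun t => T (v t)) :=
  (h.isPrimitiveOn.clm T).isW12 (T.comp_memLp' h.1) (T.comp_memLp' h.2.1)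

lemma IsW12.congr_left {ι : Type} [Fintype ι] [hI : I.OrdConnected]
    {u u' v : ℝ → EuclideanSpace ℝ ι} (h : IsW12 I u v) (hu : ∀ t ∈ I, u t = u' t) :
    IsW12 I u' v :=
  (h.isPrimitiveOn.congr hu fun _ _ => rfl).isW12
    (h.1.ae_eq ((ae_restrict_mem hI.measurableSet).mono hu)) h.2.1

lemma IsW12.congr_right {ι : Type} [Fintype ι] [hI : I.OrdConnected]
    {u v v' : ℝ → EuclideanSpace ℝ ι} (h : IsW12 I u v) (hv : v =ᵐ[volume.restrict I] v') :
    IsW12 I u v' :=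
  (h.isPrimitiveOn.congr_ae hv).isW12 h.1 (h.2.1.ae_eq hv)

lemma IsW12.pair [I.OrdConnected] {p p₁ w w₁ : ℝ → EuclideanSpace ℝ (Fin n)}
    (hp : IsW12 I p p₁) (hw : IsW12 I w w₁) :
    IsW12 I (fun t => pair (p t) (w t)) (fun t => pair (p₁ t) (w₁ t)) := by
  have h := (hp.clm (pairInl n)).add (hw.clm (pairInr n))
  simp only [← pairInl_add_pairInr]
  exact h

end Pairs

/-! ### Products with the coefficients -/

section CoefficientProducts

variable {n : ℕ} {P Q R : ℝ → Matrix (Fin n) (Fin n) ℝ} {I : Set ℝ}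

lemma IsCoefficient.act_act_inv (h : IsCoefficient I P Q R) {t : ℝ} (ht : t ∈ I)
    (v : EuclideanSpace ℝ (Fin n)) : act (P t) (act (P t)⁻¹ v) = v := by
  rw [← act_mul, Matrix.mul_nonsing_inv _ (isUnit_iff_ne_zero.2 (h.det_ne_zero_of_mem ht))]
  ext i; simp

lemma IsCoefficient.act_inv_act (h : IsCoefficient I P Q R) {t : ℝ} (ht : t ∈ I)
    (v : EuclideanSpace ℝ (Fin n)) : act (P t)⁻¹ (act (P t) v) = v := by
  rw [← act_mul, Matrix.nonsing_inv_mul _ (isUnit_iff_ne_zero.2 (h.det_ne_zero_of_mem ht))]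
  ext i; simp

lemma IsCoefficient.exists_bound_Q (h : IsCoefficient I P Q R) :
    ∃ C, ∀ t ∈ I, ‖opPath Q t‖ ≤ C := by
  obtain ⟨C, hC⟩ := h.upper_Q
  refine ⟨|C|, fun t ht => ContinuousLinearMap.opNorm_le_bound _ (abs_nonneg C) fun v => ?_⟩
  exact (hC t ht v).trans (by gcongr; exact le_abs_self C)

lemma IsCoefficient.exists_bound_R (h : IsCoefficient I P Q R) :
    ∃ C, ∀ t ∈ I, ‖opPath R t‖ ≤ C := by
  obtain ⟨C, hC⟩ := h.upper_R
  refine ⟨|C|, fun t ht => ContinuousLinearMap.opNorm_le_bound _ (abs_nonneg C) fun v => ?_⟩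
  exact (hC t ht v).trans (by gcongr; exact le_abs_self C)

lemma IsCoefficient.exists_bound_inv (h : IsCoefficient I P Q R) :
    ∃ C, 0 ≤ C ∧ ∀ t ∈ I, ‖opPath (fun t => (P t)⁻¹) t‖ ≤ C := by
  obtain ⟨C, hC, hb⟩ := h.lower_P
  refine ⟨C⁻¹, by positivity, fun t ht =>
    ContinuousLinearMap.opNorm_le_bound _ (by positivity) fun v => ?_⟩
  have h1 := hb t ht (act (P t)⁻¹ v)
  rw [h.act_act_inv ht] at h1
  change ‖act (P t)⁻¹ v‖ ≤ C⁻¹ * ‖v‖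
  rwa [← div_eq_inv_mul, le_div_iff₀' hC]

lemma IsCoefficient.opPath_inv (h : IsCoefficient I P Q R) {t : ℝ} (ht : t ∈ I) :
    opPath (fun t => (P t)⁻¹) t = Ring.inverse (opPath P t) := by
  have hd := isUnit_iff_ne_zero.2 (h.det_ne_zero_of_mem ht)
  have h1 : opPath P t * opPath (fun t => (P t)⁻¹) t = 1 := by
    rw [opPath, opPath, ← map_mul, Matrix.mul_nonsing_inv _ hd, map_one]
  have h2 : opPath (fun t => (P t)⁻¹) t * opPath P t = 1 := by
    rw [opPath, opPath, ← map_mul, Matrix.nonsing_inv_mul _ hd, map_one]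
  exact (Ring.inverse_unit ⟨opPath P t, opPath (fun t => (P t)⁻¹) t, h1, h2⟩).symm

lemma IsCoefficient.isUnit_opPath (h : IsCoefficient I P Q R) {t : ℝ} (ht : t ∈ I) :
    IsUnit (opPath P t) := by
  have hd := isUnit_iff_ne_zero.2 (h.det_ne_zero_of_mem ht)
  exact ((Matrix.isUnit_iff_isUnit_det _).2 hd).map (Matrix.toEuclideanCLM (𝕜 := ℝ))

lemma IsCoefficient.contDiffOn_opPath_inv (h : IsCoefficient I P Q R) :
    ContDiffOn ℝ 1 (opPath fun t => (P t)⁻¹) I := by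
  have h1 : ContDiffOn ℝ 1 (fun t => Ring.inverse (opPath P t)) I := fun t ht => by
    obtain ⟨x, hx⟩ := h.isUnit_opPath ht
    have h2 := contDiffAt_ringInverse ℝ (n := 1) x
    rw [hx] at h2
    exact h2.comp_contDiffWithinAt t (contDiffOn_opPath h.contDiffOn_P t ht)
  exact h1.congr fun t ht => h.opPath_inv ht

/-- The derivative of the inverse, in the form `(P⁻¹)' = -P⁻¹ P' P⁻¹`. -/
lemma IsCoefficient.derivWithin_opPath_inv (h : IsCoefficient I P Q R) (hU : UniqueDiffOn ℝ I)
    {t : ℝ} (ht : t ∈ I) (v : EuclideanSpace ℝ (Fin n)) :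
    derivWithin (opPath fun t => (P t)⁻¹) I t v =
      -act (P t)⁻¹ (derivWithin (opPath P) I t (act (P t)⁻¹ v)) := by
  obtain ⟨x, hx⟩ := h.isUnit_opPath ht
  have h2 := hasFDerivAt_ringInverse (𝕜 := ℝ) x
  rw [hx] at h2
  have h3 : HasDerivWithinAt (opPath P) (derivWithin (opPath P) I t) I t :=
    ((contDiffOn_opPath h.contDiffOn_P).differentiableOn one_ne_zero t ht).hasDerivWithinAt
  have h4 := h2.comp_hasDerivWithinAt t h3
  have h5 : HasDerivWithinAt (opPath fun t => (P t)⁻¹) _ I t :=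
    h4.congr (fun s hs => h.opPath_inv hs) (h.opPath_inv ht)
  have hxi : ((x⁻¹ : _ˣ) : EuclideanSpace ℝ (Fin n) →L[ℝ] EuclideanSpace ℝ (Fin n)) =
      opPath (fun t => (P t)⁻¹) t := by
    rw [h.opPath_inv ht, ← hx, Ring.inverse_unit]
  rw [h5.derivWithin (hU t ht), hxi]
  rfl

variable [hI : I.OrdConnected]

/-- A product with a bounded `C¹` path of operators is in `W^{1,2}` if the critical term is square
integrable. -/
lemma IsW12.clm_path {κ : Type} [Fintype κ] (hU : UniqueDiffOn ℝ I)
    {M : ℝ → EuclideanSpace ℝ κ →L[ℝ] EuclideanSpace ℝ κ} (hM : ContDiffOn ℝ 1 M I) {C : ℝ}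
    (hC : ∀ t ∈ I, ‖M t‖ ≤ C) {u u₁ : ℝ → EuclideanSpace ℝ κ} (hu : IsW12 I u u₁)
    (hMu : MemLp (fun t => derivWithin M I t (u t)) 2 (volume.restrict I)) :
    ∃ v, IsW12 I (fun t => M t (u t)) v := by
  have h1 := (isPrimitiveOn_of_contDiffOn hU hM).bilin
    (ContinuousLinearMap.id ℝ (EuclideanSpace ℝ κ →L[ℝ] EuclideanSpace ℝ κ)) hu.isPrimitiveOn
  have h2 := memLp_apply hM.continuousOn hC hu.1
  have h3 := hMu.add (memLp_apply hM.continuousOn hC hu.2.1)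
  exact ⟨fun t => derivWithin M I t (u t) + M t (u₁ t), h1.isW12 h2 h3⟩

/-- Multiplication by `P`, by `Q` and by `P⁻¹` preserves `W^{1,2}`, if the differential expression
maps `W^{2,2}` into `L²`. -/
lemma IsCoefficient.isW12_products (h : IsCoefficient I P Q R) (hmap : MapsW22IntoL2 I P Q)
    (hU : UniqueDiffOn ℝ I)
    (hthick : ∀ t ∈ I, Set.Icc t (t + 1) ⊆ I ∨ Set.Icc (t - 1) t ⊆ I)
    {C : ℝ} (hPC : ∀ t ∈ I, ‖opPath P t‖ ≤ C) {u u₁ : ℝ → EuclideanSpace ℝ (Fin n)}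
    (hu : IsW12 I u u₁) :
    (∃ v, IsW12 I (fun t => act (P t) (u t)) v) ∧ (∃ v, IsW12 I (fun t => act (Q t) (u t)) v) ∧
      ∃ v, IsW12 I (fun t => act (P t)⁻¹ (u t)) v := by
  obtain ⟨D, hQD⟩ := h.exists_bound_Q
  obtain ⟨K, hK, hPK⟩ := h.exists_bound_inv
  have hP := contDiffOn_opPath h.contDiffOn_P
  have hQ := contDiffOn_opPath h.contDiffOn_Q
  have key : ∀ {v : ℝ → EuclideanSpace ℝ (Fin n)} {K : ℝ},
      AEStronglyMeasurable v (volume.restrict I) → 0 ≤ K → (∀ t ∈ I, ‖v t‖ ≤ K * ‖u t‖) → _ :=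
    fun hv hK hvu => memLp_derivWithin_apply hU hthick hP hQ
      (fun t ht => (hPC t ht).trans (le_max_left C D))
      (fun t ht => (hQD t ht).trans (le_max_right C D)) hmap hu hv hK hvu
  have h1 := key hu.1.1 zero_le_one fun t _ => (one_mul _).ge
  have hinv := h.contDiffOn_opPath_inv
  have h2 := key (aestronglyMeasurable_apply hinv.continuousOn hu.1.1) hK
    fun t ht => (opPath (fun t => (P t)⁻¹) t).le_of_opNorm_le (hPK t ht) _
  refine ⟨hu.clm_path hU hP hPC h1.1, hu.clm_path hU hQ hQD h1.2, hu.clm_path hU hinv hPK ?_⟩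
  refine (memLp_apply hinv.continuousOn hPK h2.1).neg.ae_eq ?_
  filter_upwards [ae_restrict_mem hI.measurableSet] with t ht
  exact (h.derivWithin_opPath_inv hU ht (u t)).symm

end CoefficientProducts

/-! ### Comparison of the two operators -/

section Reduction

variable {n : ℕ} {P Q R : ℝ → Matrix (Fin n) (Fin n) ℝ} {I : Set ℝ}
  {L : Submodule ℝ (EuclideanSpace ℝ (Fin n ⊕ Fin n))}

/-- The map `g ↦ (0, g)` between spaces of square integrable functions. -/
noncomputable def inrL2 (I : Set ℝ) (n : ℕ) : L2 I (Fin n) →L[ℝ] L2 I (Fin n ⊕ Fin n) :=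
  (pairInr n).compLpL 2 (volume.restrict I)

/-- The map `(p, w) ↦ w` between spaces of square integrable functions. -/
noncomputable def sndL2 (I : Set ℝ) (n : ℕ) : L2 I (Fin n ⊕ Fin n) →L[ℝ] L2 I (Fin n) :=
  (pairSnd n).compLpL 2 (volume.restrict I)

lemma coeFn_inrL2 (g : L2 I (Fin n)) :
    inrL2 I n g =ᵐ[volume.restrict I] fun t => pair 0 (g t) :=
  (pairInr n).coeFn_compLpL g

lemma coeFn_sndL2 (z : L2 I (Fin n ⊕ Fin n)) :
    sndL2 I n z =ᵐ[volume.restrict I] fun t => pairSnd n (z t) :=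
  (pairSnd n).coeFn_compLpL z

variable [hI : I.OrdConnected]

/-- The Hamiltonian relation in components. -/
lemma mem_hamGraph_pair {x y : L2 I (Fin n ⊕ Fin n)} :
    (x, y) ∈ hamGraph I L P Q R ↔ ∃ p p₁ w w₁ : ℝ → EuclideanSpace ℝ (Fin n),
      IsW12 I p p₁ ∧ IsW12 I w w₁ ∧ pair (p 0) (w 0) ∈ L ∧
      x =ᵐ[volume.restrict I] (fun t => pair (p t) (w t)) ∧
      y =ᵐ[volume.restrict I] fun t =>
        pair (w₁ t - act (P t)⁻¹ (p t - act (Q t) (w t)))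
          (-p₁ t + act (Q t)ᵀ (act (P t)⁻¹ (p t - act (Q t) (w t))) + act (R t) (w t)) := by
  constructor
  · rintro ⟨z, z₁, hz, hL, h1, h2⟩
    refine ⟨fun t => pairFst n (z t), fun t => pairFst n (z₁ t), fun t => pairSnd n (z t),
      fun t => pairSnd n (z₁ t), hz.clm _, hz.clm _, ?_, ?_, ?_⟩
    · rwa [pair_fst_snd]
    · simpa only [pair_fst_snd] using h1
    · simpa only [← hamExpr_pair, pair_fst_snd] using h2
  · rintro ⟨p, p₁, w, w₁, hp, hw, hL, h1, h2⟩
    refine ⟨_, _, hp.pair hw, hL, h1, ?_⟩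
    simpa only [hamExpr_pair] using h2

/-- A solution `w` of the Sturm–Liouville equation gives the solution `(P w' + Q w, w)` of the
Hamiltonian system. -/
lemma IsCoefficient.exists_mem_hamGraph (h : IsCoefficient I P Q R)
    {x : L2 I (Fin n) × L2 I (Fin n)} (hx : x ∈ slGraph I L P Q R) :
    ∃ z, sndL2 I n z = x.1 ∧ (z, inrL2 I n x.2) ∈ hamGraph I L P Q R := by
  obtain ⟨w, w₁, w₂, q, hw, hq, hL, h1, h2⟩ := hx
  have hz := hq.pair hw.1
  refine ⟨hz.1.toLp _, Lp.ext ?_, mem_hamGraph_pair.2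
    ⟨_, _, _, _, hq, hw.1, hL, hz.1.coeFn_toLp, ?_⟩⟩
  · filter_upwards [h1, coeFn_sndL2 (hz.1.toLp _), hz.1.coeFn_toLp] with t e1 e2 e3
    rw [e1, e2, e3, pairSnd_pair]
  · filter_upwards [h2, coeFn_inrL2 x.2, ae_restrict_mem hI.measurableSet] with t e1 e2 ht
    rw [e2, e1, quasiDeriv, add_sub_cancel_right, h.act_inv_act ht, sub_self]

/-- The second component `w` of a solution of the Hamiltonian system with right-hand side `(0, g)`
is in `W^{2,2}` and solves the Sturm–Liouville equation. -/
lemma IsCoefficient.mem_slGraph (h : IsCoefficient I P Q R) (h0 : (0 : ℝ) ∈ I)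
    (hprod : ∀ u u₁ : ℝ → EuclideanSpace ℝ (Fin n), IsW12 I u u₁ →
      (∃ v, IsW12 I (fun t => act (Q t) (u t)) v) ∧ ∃ v, IsW12 I (fun t => act (P t)⁻¹ (u t)) v)
    {z : L2 I (Fin n ⊕ Fin n)} {g : L2 I (Fin n)}
    (hz : (z, inrL2 I n g) ∈ hamGraph I L P Q R) : (sndL2 I n z, g) ∈ slGraph I L P Q R := by
  obtain ⟨p, p₁, w, w', hp, hw, hL, h1, h2⟩ := mem_hamGraph_pair.1 hz
  obtain ⟨qw, hqw⟩ := (hprod _ _ hw).1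
  have hu : IsW12 I (fun t => p t - act (Q t) (w t)) (fun t => p₁ t - qw t) := by
    have := hp.add (hqw.smul (-1))
    convert this using 1 <;> (funext t; simp [sub_eq_add_neg])
  obtain ⟨w₂, hw₂⟩ := (hprod _ _ hu).2
  have hcomp : ∀ᵐ t ∂(volume.restrict I), w' t = act (P t)⁻¹ (p t - act (Q t) (w t)) ∧
      g t = -p₁ t + act (Q t)ᵀ (act (P t)⁻¹ (p t - act (Q t) (w t))) + act (R t) (w t) := by
    filter_upwards [h2, coeFn_inrL2 g] with t e1 e2
    rw [e2] at e1
    constructor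
    · have := congrArg (pairFst n) e1
      rw [pairFst_pair, pairFst_pair] at this
      exact (sub_eq_zero.1 this.symm)
    · have := congrArg (pairSnd n) e1
      rwa [pairSnd_pair, pairSnd_pair] at this
  have hquasi : ∀ t ∈ I, quasiDeriv P Q w (fun t => act (P t)⁻¹ (p t - act (Q t) (w t))) t = p t :=
    fun t ht => by rw [quasiDeriv, h.act_act_inv ht, sub_add_cancel]
  refine ⟨w, _, w₂, p₁, ⟨hw.congr_right (hcomp.mono fun t ht => ht.1), hw₂⟩,
    hp.congr_left fun t ht => (hquasi t ht).symm, ?_, ?_, hcomp.mono fun t ht => ht.2⟩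
  · rwa [hquasi 0 h0]
  · filter_upwards [h1, coeFn_sndL2 z] with t e1 e2
    rw [e2, e1, pairSnd_pair]

/-- An element of the kernel of the Hamiltonian operator is determined by its second component. -/
lemma IsCoefficient.eq_zero_of_sndL2_eq_zero (h : IsCoefficient I P Q R) (hn : I.Nontrivial)
    {z : L2 I (Fin n ⊕ Fin n)} (hz : (z, (0 : L2 I (Fin n ⊕ Fin n))) ∈ hamGraph I L P Q R)
    (hz0 : sndL2 I n z = 0) : z = 0 := by
  obtain ⟨p, p₁, w, w', hp, hw, hL, h1, h2⟩ := mem_hamGraph_pair.1 hz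
  have hw0 : w =ᵐ[volume.restrict I] 0 := by
    have e := coeFn_sndL2 z
    rw [hz0] at e
    filter_upwards [h1, e, Lp.coeFn_zero (EuclideanSpace ℝ (Fin n)) 2 (volume.restrict I)]
      with t e1 e2 e3
    rw [e1, pairSnd_pair, e3] at e2
    exact e2.symm
  obtain ⟨-, hw'⟩ := hw.eq_zero hn hw0
  refine Lp.ext ?_
  filter_upwards [h1, h2, hw0, hw', ae_restrict_mem hI.measurableSet,
    Lp.coeFn_zero (EuclideanSpace ℝ (Fin n ⊕ Fin n)) 2 (volume.restrict I)]
    with t e1 e2 e3 e4 ht e5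
  have e6 := congrArg (pairFst n) e2
  rw [e5, Pi.zero_apply, pairFst_pair, map_zero, e3, e4, Pi.zero_apply, map_zero, sub_zero,
    zero_sub, zero_eq_neg] at e6
  have e7 := h.act_act_inv ht (p t)
  rw [e6, map_zero] at e7
  rw [e1, e5, e3, ← e7, Pi.zero_apply, Pi.zero_apply, pair_zero]

/-- The range of the Hamiltonian operator together with the functions `(0, g)` spans `L²`: the
first component of the right-hand side is attained by solving the scalar equation `w' = c w + f`
with `w(0) = 0`. -/
lemma IsCoefficient.exists_mem_hamGraph_sub (h : IsCoefficient I P Q R)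
    (hL : L = ⊤ ∨ I ⊆ Set.Ici 0 ∨ I ⊆ Set.Iic 0)
    (hprod : ∀ u u₁ : ℝ → EuclideanSpace ℝ (Fin n), IsW12 I u u₁ →
      (∃ v, IsW12 I (fun t => act (P t) (u t)) v) ∧ ∃ v, IsW12 I (fun t => act (Q t) (u t)) v)
    (y : L2 I (Fin n ⊕ Fin n)) :
    ∃ x g, (x, y - inrL2 I n g) ∈ hamGraph I L P Q R := by
  set f : ℝ → EuclideanSpace ℝ (Fin n) := fun t => pairFst n (y t) with hf
  have hfL : MemLp f 2 (volume.restrict I) := (pairFst n).comp_memLp' (Lp.memLp y)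
  obtain ⟨c, w, hw, hw0⟩ : ∃ c : ℝ, ∃ w, IsW12 I w (fun t => c • w t + f t) ∧
      (L = ⊤ ∨ w 0 = 0) := by
    rcases hL with hL | hL | hL
    · obtain ⟨w, hw, -⟩ := exists_solution_smul one_ne_zero I hfL
      exact ⟨1, w, hw, Or.inl hL⟩
    · obtain ⟨w, hw, -, h1, -⟩ := exists_solution_smul (neg_ne_zero.2 one_ne_zero) I hfL
      exact ⟨-1, w, hw, Or.inr (h1 (by norm_num) hL)⟩
    · obtain ⟨w, hw, -, -, h1⟩ := exists_solution_smul one_ne_zero I hfL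
      exact ⟨1, w, hw, Or.inr (h1 one_pos hL)⟩
  obtain ⟨⟨Pw', hPw⟩, ⟨Qw', hQw⟩⟩ := hprod w _ hw
  -- The first component is chosen such that `P⁻¹ (p - Q w) = c w`.
  have hp : IsW12 I (fun t => c • act (P t) (w t) + act (Q t) (w t)) (fun t => c • Pw' t + Qw' t) :=
    (hPw.smul c).add hQw
  have hpair0 : pair (c • act (P 0) (w 0) + act (Q 0) (w 0)) (w 0) ∈ L := by
    rcases hw0 with rfl | hw0
    · exact Submodule.mem_top
    · rw [hw0, map_zero, map_zero, smul_zero, add_zero, pair_zero]; exact L.zero_mem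
  obtain ⟨CQ, hCQ⟩ := h.exists_bound_Q
  obtain ⟨CR, hCR⟩ := h.exists_bound_R
  have hR : MemLp (fun t => act (R t) (w t)) 2 (volume.restrict I) :=
    memLp_apply (contDiffOn_opPath h.contDiffOn_R).continuousOn hCR hw.1
  have hQt : MemLp (fun t => act (Q t)ᵀ (c • w t)) 2 (volume.restrict I) := by
    have e : ∀ t, opPath (fun t => (Q t)ᵀ) t = star (opPath Q t) := fun t => by
      rw [opPath, opPath, ← map_star, Matrix.star_eq_conjTranspose,
        Matrix.conjTranspose_eq_transpose_of_trivial]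
    exact memLp_apply (S := opPath fun t => (Q t)ᵀ)
      (contDiffOn_opPath fun i j => h.contDiffOn_Q j i).continuousOn
      (fun t ht => by
        rw [e]
        exact (ContinuousLinearMap.adjoint.norm_map (opPath Q t)).trans_le (hCQ t ht))
        (hw.1.const_smul c)
  have hs : MemLp (fun t => pairSnd n (y t) -
      (-(c • Pw' t + Qw' t) + act (Q t)ᵀ (c • w t) + act (R t) (w t))) 2 (volume.restrict I) :=
    ((pairSnd n).comp_memLp' (Lp.memLp y)).sub ((hp.2.1.neg.add hQt).add hR)
  have hx := hp.pair hw
  refine ⟨hx.1.toLp _, hs.toLp _, mem_hamGraph_pair.2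
    ⟨_, _, _, _, hp, hw, hpair0, hx.1.coeFn_toLp, ?_⟩⟩
  filter_upwards [Lp.coeFn_sub y (inrL2 I n (hs.toLp _)), coeFn_inrL2 (hs.toLp _), hs.coeFn_toLp,
    ae_restrict_mem hI.measurableSet] with t e1 e2 e3 ht
  have e4 : act (P t)⁻¹ (c • act (P t) (w t) + act (Q t) (w t) - act (Q t) (w t)) = c • w t := by
    rw [add_sub_cancel_right, map_smul, h.act_inv_act ht]
  rw [e1, Pi.sub_apply, e2, e3, e4, ← pair_fst_snd (y t), pair_sub, pairSnd_pair, sub_zero,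
    sub_sub_cancel, add_sub_cancel_left]

/-- The Sturm–Liouville operator and the Hamiltonian operator are Fredholm simultaneously. -/
lemma IsCoefficient.isFredholm_slOp_iff (h : IsCoefficient I P Q R) (hmap : MapsW22IntoL2 I P Q)
    (hn : I.Nontrivial) (hU : UniqueDiffOn ℝ I) (h0 : (0 : ℝ) ∈ I)
    (hthick : ∀ t ∈ I, Set.Icc t (t + 1) ⊆ I ∨ Set.Icc (t - 1) t ⊆ I)
    (hPC : ∃ C, ∀ t ∈ I, ‖opPath P t‖ ≤ C) (hSC : ∃ C, ∀ t ∈ I, ‖hamCoeff P Q R t‖ ≤ C)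
    (hL : L = ⊤ ∨ I ⊆ Set.Ici 0 ∨ I ⊆ Set.Iic 0) :
    IsFredholm (slOp I L P Q R) ↔ IsFredholm (hamOp I L P Q R) := by
  obtain ⟨C, hPC⟩ := hPC
  obtain ⟨D, hSC⟩ := hSC
  have hprod := fun u u₁ (hu : IsW12 I u u₁) => h.isW12_products hmap hU hthick hPC hu
  have hvol : volume I ≠ 0 := by
    refine fun hv => ?_
    rcases hthick 0 h0 with hs | hs
    · simpa using (measure_mono hs).trans hv.le
    · simpa using (measure_mono hs).trans hv.le
  rw [isFredholm_iff_graph, isFredholm_iff_graph, slOp_graph _ _ _ _ _ hn, hamOp_graph _ _ _ _ _ hn]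
  refine fredholm_iff_of_reduction _ _ (inrL2 I n) (sndL2 I n)
    (fun x hx => h.exists_mem_hamGraph hx)
    (fun z g hz => h.mem_slGraph h0 (fun u u₁ hu => (hprod u u₁ hu).2) hz)
    (fun z hz hz0 => h.eq_zero_of_sndL2_eq_zero hn hz hz0)
    (h.exists_mem_hamGraph_sub hL fun u u₁ hu => ⟨(hprod u u₁ hu).1, (hprod u u₁ hu).2.1⟩) ?_
  rw [hamGraph_eq_odeGraph]
  exact isClosed_odeGraph hvol (Or.inl h0) h.continuousOn_hamCoeff hSC

end Reduction

end SturmLiouville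

theorem mainTheorem4 (n : ℕ) (P Q R : ℝ → Matrix (Fin n) (Fin n) ℝ)
    (Pm Qm Rm Pp Qp Rp : Matrix (Fin n) (Fin n) ℝ) :
    -- the whole line
    (IsCoefficient Set.univ P Q R → MapsW22IntoL2 Set.univ P Q →
      Tendsto P atBot (𝓝 Pm) → Tendsto Q atBot (𝓝 Qm) → Tendsto R atBot (𝓝 Rm) →
      Tendsto P atTop (𝓝 Pp) → Tendsto Q atTop (𝓝 Qp) → Tendsto R atTop (𝓝 Rp) →
      (IsFredholm (slOp Set.univ ⊤ P Q R) ↔ IsFredholm (hamOp Set.univ ⊤ P Q R)) ∧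
      (IsFredholm (hamOp Set.univ ⊤ P Q R) ↔
        IsHyperbolic (Matrix.J (Fin n) ℝ * hamMatrix Pm Qm Rm) ∧
        IsHyperbolic (Matrix.J (Fin n) ℝ * hamMatrix Pp Qp Rp))) ∧
    -- the half-lines
    (∀ L₀ : Submodule ℝ (EuclideanSpace ℝ (Fin n ⊕ Fin n)), IsLagrangian L₀ →
      (IsCoefficient (Set.Ici 0) P Q R → MapsW22IntoL2 (Set.Ici 0) P Q →
        Tendsto P atTop (𝓝 Pp) → Tendsto Q atTop (𝓝 Qp) → Tendsto R atTop (𝓝 Rp) →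
        (IsFredholm (slOp (Set.Ici 0) L₀ P Q R) ↔ IsFredholm (hamOp (Set.Ici 0) L₀ P Q R)) ∧
        (IsFredholm (hamOp (Set.Ici 0) L₀ P Q R) ↔
          IsHyperbolic (Matrix.J (Fin n) ℝ * hamMatrix Pp Qp Rp))) ∧
      (IsCoefficient (Set.Iic 0) P Q R → MapsW22IntoL2 (Set.Iic 0) P Q →
        Tendsto P atBot (𝓝 Pm) → Tendsto Q atBot (𝓝 Qm) → Tendsto R atBot (𝓝 Rm) →
        (IsFredholm (slOp (Set.Iic 0) L₀ P Q R) ↔ IsFredholm (hamOp (Set.Iic 0) L₀ P Q R)) ∧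
        (IsFredholm (hamOp (Set.Iic 0) L₀ P Q R) ↔
          IsHyperbolic (Matrix.J (Fin n) ℝ * hamMatrix Pm Qm Rm)))) := by
  refine ⟨fun h hmap hPm hQm hRm hPp hQp hRp => ⟨?_, ?_⟩, fun L₀ _ =>
    ⟨fun h hmap hP hQ hR => ⟨?_, ?_⟩, fun h hmap hP hQ hR => ⟨?_, ?_⟩⟩⟩
  · have hS := h.continuousOn_hamCoeff
    have hPc := (contDiffOn_opPath h.contDiffOn_P).continuousOn
    exact h.isFredholm_slOp_iff hmap Set.nontrivial_univ uniqueDiffOn_univ (Set.mem_univ 0)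
      (fun _ _ => Or.inl (Set.subset_univ _))
      (exists_bound_univ hPc (tendsto_toEuclideanCLM hPm) (tendsto_toEuclideanCLM hPp))
      (exists_bound_univ hS (tendsto_hamCoeff (h.det_ne_zero (by simp) hPm) hPm hQm hRm)
        (tendsto_hamCoeff (h.det_ne_zero (by simp) hPp) hPp hQp hRp)) (Or.inl rfl)
  · exact isFredholm_hamOp_univ_iff ⊤ h hPm hQm hRm hPp hQp hRp
  · have hS := h.continuousOn_hamCoeff
    have hPc := (contDiffOn_opPath h.contDiffOn_P).continuousOn
    exact h.isFredholm_slOp_iff hmap nontrivial_Ici (uniqueDiffOn_Ici 0) Set.self_mem_Ici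
      (fun t ht => Or.inl fun s hs => Set.mem_Ici.2 (le_trans ht hs.1))
      (exists_bound_Ici hPc (tendsto_toEuclideanCLM hP))
      (exists_bound_Ici hS (tendsto_hamCoeff
        (h.det_ne_zero (eventually_ge_atTop 0) hP) hP hQ hR)) (Or.inr (Or.inl subset_rfl))
  · exact isFredholm_hamOp_Ici_iff L₀ h hP hQ hR
  · have hS := h.continuousOn_hamCoeff
    have hPc := (contDiffOn_opPath h.contDiffOn_P).continuousOn
    exact h.isFredholm_slOp_iff hmap nontrivial_Iic (uniqueDiffOn_Iic 0) Set.self_mem_Iic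
      (fun t ht => Or.inr fun s hs => Set.mem_Iic.2 (le_trans hs.2 ht))
      (exists_bound_Iic hPc (tendsto_toEuclideanCLM hP))
      (exists_bound_Iic hS (tendsto_hamCoeff
        (h.det_ne_zero (eventually_le_atBot 0) hP) hP hQ hR)) (Or.inr (Or.inr subset_rfl))
  · exact isFredholm_hamOp_Iic_iff L₀ h hP hQ hR
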